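/- **$3\times3$-lemma (in homotopy type theory).** Work in homotopy type theory: intensional dependent type theory with a hierarchy of cumulative universes, dependent function types, dependent pair types, identity types, the univalence axiom, and pushouts. Here the pushout $A\sqcup^C B$ of a span $A\xleftarrow{f}C\xrightarrow{g}B$ is the higher inductive type generated by $\mathrm{inl}:A\to A\sqcup^CB$, $\mathrm{inr}:B\to A\sqcup^CB$ and $\mathrm{push}:(c:C)\to \mathrm{inl}(f(c))=\mathrm{inr}(g(c))$; its induction principle computes by definition on $\mathrm{inl}$ and $\mathrm{inr}$, and up to an identification on $\mathrm{push}$. A theorem of this theory is a well-formed closed type for which some closed term can be derived. For every universe $\mathsf{Type}$ of the hierarchy the following is a theorem. Suppose given nine types $A_{ij}:\mathsf{Type}$ $(i,j\in\{0,2,4\})$, maps $$A_{00}\xleftarrow{f_{01}}A_{02}\xrightarrow{f_{03}}A_{04},\qquad A_{20}\xleftarrow{f_{21}}A_{22}\xrightarrow{f_{23}}A_{24},\qquad A_{40}\xleftarrow{f_{41}}A_{42}\xrightarrow{f_{43}}A_{44},$$ $$A_{00}\xleftarrow{f_{10}}A_{20}\xrightarrow{f_{30}}A_{40},\qquad A_{02}\xleftarrow{f_{12}}A_{22}\xrightarrow{f_{32}}A_{42},\qquad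 A_{04}\xleftarrow{f_{14}}A_{24}\xrightarrow{f_{34}}A_{44},$$ and homotopies, for $x:A_{22}$, $$H_{11}(x):f_{01}(f_{12}(x))=f_{10}(f_{21}(x)),\qquad H_{13}(x):f_{03}(f_{12}(x))=f_{14}(f_{23}(x)),$$ $$H_{31}(x):f_{41}(f_{32}(x))=f_{30}(f_{21}(x)),\qquad H_{33}(x):f_{43}(f_{32}(x))=f_{34}(f_{23}(x)).$$ For $j\in\{0,2,4\}$ let $A_{\bullet j}$ be the pushout of the column $A_{0j}\leftarrow A_{2j}\to A_{4j}$. Let $f_{\bullet1}:A_{\bullet2}\to A_{\bullet0}$ be the map with $\mathrm{inl}(x)\mapsto\mathrm{inl}(f_{01}(x))$, $\mathrm{inr}(x)\mapsto\mathrm{inr}(f_{41}(x))$ and $$\mathrm{ap}_{f_{\bullet1}}(\mathrm{push}(x)):=\mathrm{ap}_{\mathrm{inl}}(H_{11}(x))\cdot\mathrm{push}(f_{21}(x))\cdot\mathrm{ap}_{\mathrm{inr}}(H_{31}(x))^{-1},$$ and define $f_{\bullet3}:A_{\bullet2}\to A_{\bullet4}$ in the same way from $f_{03},f_{43},f_{23},H_{13},H_{33}$.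 Let $A_{\bullet\square}$ be the pushout of $A_{\bullet0}\xleftarrow{f_{\bullet1}}A_{\bullet2}\xrightarrow{f_{\bullet3}}A_{\bullet4}$. Symmetrically, for $i\in\{0,2,4\}$ let $A_{i\bullet}$ be the pushout of the row $A_{i0}\leftarrow A_{i2}\to A_{i4}$; let $f_{1\bullet}:A_{2\bullet}\to A_{0\bullet}$ be the map with $\mathrm{inl}(x)\mapsto\mathrm{inl}(f_{10}(x))$, $\mathrm{inr}(x)\mapsto\mathrm{inr}(f_{14}(x))$ and $$\mathrm{ap}_{f_{1\bullet}}(\mathrm{push}(x)):=\mathrm{ap}_{\mathrm{inl}}(H_{11}(x)^{-1})\cdot\mathrm{push}(f_{12}(x))\cdot\mathrm{ap}_{\mathrm{inr}}(H_{13}(x)^{-1})^{-1};$$ define $f_{3\bullet}:A_{2\bullet}\to A_{4\bullet}$ in the same way from $f_{30},f_{34},f_{32},H_{31},H_{33}$; and let $A_{\square\bullet}$ be the pushout of $A_{0\bullet}\xleftarrow{f_{1\bullet}}A_{2\bullet}\xrightarrow{f_{3\bullet}}A_{4\bullet}$. Then there is an equivalence $$A_{\bullet\square}\simeq A_{\square\bullet}.$$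 Here $A\simeq B$ is the type of functions $f:A\to B$ equipped with a left inverse and a right inverse (up to homotopy). -/

import Mathlib

/-!
Homotopy type theory as a formal system (raw terms, conversion, typing), in the style of
dependent type theories with primitive constants and an untyped convertibility relation.
A theorem of homotopy type theory is a closed type for which a closed term is derivable.
The system below has cumulative universes `Type 0 : Type 1 : …`, dependent function types,
dependent pair types, identity types, (homotopy) pushouts and the univalence axiom.  No rule
makes identity proofs unique, and the meta-level equality of Lean is never used as the identity
type of the object theory.  Further inductive types or axioms could be added as further constants
and conversion rules; every derivation in the system below remains one in such an extension.
-/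

namespace HoTT

/-! ### Raw terms -/

/-- The primitive constants. -/
inductive Const : Type
  | sigma | pair | sigmaElim
  | id | idp | J
  | pushout | inl | inr | push | pushoutElim | pushoutElimPush
  | univalence
  deriving DecidableEq

/-- Raw terms with de Bruijn indices; `pi A B` and `lam A b` bind one variable in `B`, `b`. -/
inductive Tm : Type
  | var (n : ℕ)
  | univ (i : ℕ)
  | pi (A B : Tm)
  | lam (A b : Tm)
  | app (f a : Tm)
  | const (c : Const)
  deriving DecidableEq

namespace Tm

/-- Extend a renaming under a binder. -/
def upRen (ξ : ℕ → ℕ) : ℕ → ℕ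
  | 0 => 0
  | n + 1 => ξ n + 1

/-- Renaming of free variables. -/
def rename : (ℕ → ℕ) → Tm → Tm
  | ξ, var n => var (ξ n)
  | _, univ i => univ i
  | ξ, pi A B => pi (rename ξ A) (rename (upRen ξ) B)
  | ξ, lam A b => lam (rename ξ A) (rename (upRen ξ) b)
  | ξ, app f a => app (rename ξ f) (rename ξ a)
  | _, const c => const c

/-- Weakening by `k` fresh variables. -/
def lift (k : ℕ) (t : Tm) : Tm := rename (fun n => n + k) t

/-- Extend a substitution under a binder. -/
def upSubst (σ : ℕ → Tm) : ℕ → Tm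
  | 0 => var 0
  | n + 1 => lift 1 (σ n)

/-- Simultaneous capture-avoiding substitution. -/
def subst : (ℕ → Tm) → Tm → Tm
  | σ, var n => σ n
  | _, univ i => univ i
  | σ, pi A B => pi (subst σ A) (subst (upSubst σ) B)
  | σ, lam A b => lam (subst σ A) (subst (upSubst σ) b)
  | σ, app f a => app (subst σ f) (subst σ a)
  | _, const c => const c

/-- `inst b a` replaces the variable `0` of `b` by `a` and lowers the other variables. -/
def inst (b a : Tm) : Tm :=
  subst (fun n => match n with
    | 0 => a
    | m + 1 => var m) b

/-- Iterated application. -/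
def apps (f : Tm) (l : List Tm) : Tm := l.foldl app f

end Tm

/-! ### Writing terms with named variables

An `Exp` gives, for every number `n` of variables in scope, a raw term in that scope.  The functions
`Exp.pi` and `Exp.lam` turn a Lean function into a binder: the variable bound in a scope of `n`
variables is the raw term `var (m - 1 - n)` in a scope of `m > n` variables.  The raw term denoted
by a closed expression `e` is `e 0`. -/

/-- Scoped expressions. -/
abbrev Exp : Type := ℕ → Tm

namespace Exp

/-- The variable that was bound in a scope of `n` variables. -/
def bvar (n : ℕ) : Exp := fun m => Tm.var (m - 1 - n)

/-- The universe `Type i`. -/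
def univ (i : ℕ) : Exp := fun _ => Tm.univ i

/-- `(x : A) → B x` -/
def pi (A : Exp) (B : Exp → Exp) : Exp := fun n => Tm.pi (A n) (B (bvar n) (n + 1))

/-- `fun x : A => b x` -/
def lam (A : Exp) (b : Exp → Exp) : Exp := fun n => Tm.lam (A n) (b (bvar n) (n + 1))

/-- Application. -/
def app (f a : Exp) : Exp := fun n => Tm.app (f n) (a n)

/-- Primitive constants. -/
def const (c : Const) : Exp := fun _ => Tm.const c

/-- The non-dependent function type `A → B`. -/
def arrow (A B : Exp) : Exp := pi A fun _ => B

infixl:90 " ⬝ " => app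
infixr:60 " ⇒ " => arrow

/-! #### Pair types -/

/-- The dependent pair type of `B : A → Type`. -/
def sigma (A B : Exp) : Exp := const .sigma ⬝ A ⬝ B

/-- The pair `(a, b)`. -/
def pair (A B a b : Exp) : Exp := const .pair ⬝ A ⬝ B ⬝ a ⬝ b

/-- The product type. -/
def prod (A B : Exp) : Exp := sigma A (lam A fun _ => B)

/-! #### Identity types -/

/-- The identity type `a =_A b`. -/
def id (A a b : Exp) : Exp := const .id ⬝ A ⬝ a ⬝ b

/-- The constant path at `a : A`. -/
def idp (A a : Exp) : Exp := const .idp ⬝ A ⬝ a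

/-- Path induction on `p : a =_A x`, with motive `P : (x : A) → a =_A x → Type` and
`d : P a idp`. -/
def J (A a P d x p : Exp) : Exp := const .J ⬝ A ⬝ a ⬝ P ⬝ d ⬝ x ⬝ p

/-- The inverse of `p : a =_A b`. -/
def inv (A a b p : Exp) : Exp :=
  J A a (lam A fun x => lam (id A a x) fun _ => id A x a) (idp A a) b p

/-- The composite of `p : a =_A b` and `q : b =_A c`. -/
def comp (A a b c p q : Exp) : Exp :=
  J A b (lam A fun x => lam (id A b x) fun _ => id A a x) p c q

/-- The path `ap f p : f a =_B f b` for `f : A → B` and `p : a =_A b`. -/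
def ap (A B f a b p : Exp) : Exp :=
  J A a (lam A fun x => lam (id A a x) fun _ => id B (f ⬝ a) (f ⬝ x)) (idp B (f ⬝ a)) b p

/-- Transport of `u : P a` along `p : a =_A b`, for `P : A → Type`. -/
def transport (A P a b p u : Exp) : Exp :=
  J A a (lam A fun x => lam (id A a x) fun _ => (P ⬝ a) ⇒ (P ⬝ x))
    (lam (P ⬝ a) fun v => v) b p ⬝ u

/-- Dependent paths from `u : P a` to `v : P b` over `p : a =_A b`. -/
def pathOver (A P a b p u v : Exp) : Exp := id (P ⬝ b) (transport A P a b p u) v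

/-- The dependent path induced by `h : (x : A) → P x` over `p : a =_A b`. -/
def apd (A P h a b p : Exp) : Exp :=
  J A a (lam A fun x => lam (id A a x) fun q => pathOver A P a x q (h ⬝ a) (h ⬝ x))
    (idp (P ⬝ a) (h ⬝ a)) b p

/-- Transport in a constant family is the identity: the path from the transport of `u : B` along
`p : a =_A b` to `u`. -/
def transportConst (A B a b p u : Exp) : Exp :=
  J A a (lam A fun x => lam (id A a x) fun q => id B (transport A (lam A fun _ => B) a x q u) u)
    (idp B u) b p

/-! #### Equivalences -/

/-- `f : A → B` is an equivalence: it has a left inverse and a right inverse. -/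
def isEquiv (A B f : Exp) : Exp :=
  prod
    (sigma (B ⇒ A) (lam (B ⇒ A) fun g => pi A fun x => id A (g ⬝ (f ⬝ x)) x))
    (sigma (B ⇒ A) (lam (B ⇒ A) fun h => pi B fun y => id B (f ⬝ (h ⬝ y)) y))

/-- The type `A ≃ B` of equivalences. -/
def equiv (A B : Exp) : Exp := sigma (A ⇒ B) (lam (A ⇒ B) fun f => isEquiv A B f)

/-- The function `A → B` induced by a path `p : A = B` in `Type i`. -/
def coe (i : ℕ) (A B p : Exp) : Exp :=
  J (univ i) A (lam (univ i) fun X => lam (id (univ i) A X) fun _ => A ⇒ X) (lam A fun a => a) B p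

/-- The function `B → A` induced by a path `p : A = B` in `Type i`. -/
def coeInv (i : ℕ) (A B p : Exp) : Exp :=
  J (univ i) A (lam (univ i) fun X => lam (id (univ i) A X) fun _ => X ⇒ A) (lam A fun a => a) B p

/-- `(a : A) → coeInv p (coe p a) = a` -/
def coeInvCoe (i : ℕ) (A B p : Exp) : Exp :=
  J (univ i) A
    (lam (univ i) fun X => lam (id (univ i) A X) fun q =>
      pi A fun a => id A (coeInv i A X q ⬝ (coe i A X q ⬝ a)) a)
    (lam A fun a => idp A a) B p

/-- `(b : B) → coe p (coeInv p b) = b` -/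
def coeCoeInv (i : ℕ) (A B p : Exp) : Exp :=
  J (univ i) A
    (lam (univ i) fun X => lam (id (univ i) A X) fun q =>
      pi X fun b => id X (coe i A X q ⬝ (coeInv i A X q ⬝ b)) b)
    (lam A fun a => idp A a) B p

/-- The map from `A = B` (in `Type i`) to `A ≃ B`. -/
def idToEquiv (i : ℕ) (A B : Exp) : Exp :=
  lam (id (univ i) A B) fun p =>
    pair (A ⇒ B) (lam (A ⇒ B) fun f => isEquiv A B f) (coe i A B p)
      (pair
        (sigma (B ⇒ A)
          (lam (B ⇒ A) fun g => pi A fun x => id A (g ⬝ (coe i A B p ⬝ x)) x))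
        (lam (sigma (B ⇒ A)
          (lam (B ⇒ A) fun g => pi A fun x => id A (g ⬝ (coe i A B p ⬝ x)) x)) fun _ =>
          sigma (B ⇒ A)
            (lam (B ⇒ A) fun h => pi B fun y => id B (coe i A B p ⬝ (h ⬝ y)) y))
        (pair (B ⇒ A)
          (lam (B ⇒ A) fun g => pi A fun x => id A (g ⬝ (coe i A B p ⬝ x)) x)
          (coeInv i A B p) (coeInvCoe i A B p))
        (pair (B ⇒ A)
          (lam (B ⇒ A) fun h => pi B fun y => id B (coe i A B p ⬝ (h ⬝ y)) y)
          (coeInv i A B p) (coeCoeInv i A B p)))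

/-! #### Pushouts of a span `A ← C → B` with legs `f : C → A` and `g : C → B` -/

/-- The pushout type. -/
def pushout (A B C f g : Exp) : Exp := const .pushout ⬝ A ⬝ B ⬝ C ⬝ f ⬝ g

/-- The point constructor `inl : A → pushout`. -/
def inl (A B C f g : Exp) : Exp := const .inl ⬝ A ⬝ B ⬝ C ⬝ f ⬝ g

/-- The point constructor `inr : B → pushout`. -/
def inr (A B C f g : Exp) : Exp := const .inr ⬝ A ⬝ B ⬝ C ⬝ f ⬝ g

/-- The path constructor `push : (c : C) → inl (f c) = inr (g c)`. -/
def push (A B C f g : Exp) : Exp := const .push ⬝ A ⬝ B ⬝ C ⬝ f ⬝ g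

/-- The dependent function out of the pushout given by the induction principle. -/
def pushoutElim (A B C f g P l r p : Exp) : Exp :=
  const .pushoutElim ⬝ A ⬝ B ⬝ C ⬝ f ⬝ g ⬝ P ⬝ l ⬝ r ⬝ p

/-- The type of the third datum of the induction principle:
`(c : C) → l (f c) =^P_{push c} r (g c)`. -/
def pushoutElimPath (A B C f g P l r : Exp) : Exp :=
  pi C fun c =>
    pathOver (pushout A B C f g) P (inl A B C f g ⬝ (f ⬝ c)) (inr A B C f g ⬝ (g ⬝ c))
      (push A B C f g ⬝ c) (l ⬝ (f ⬝ c)) (r ⬝ (g ⬝ c))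

/-- The non-dependent function `pushout → X` with `inl a ↦ l a`, `inr b ↦ r b` and
`push c ↦ p c : l (f c) = r (g c)`. -/
def pushoutRec (A B C f g X l r p : Exp) : Exp :=
  pushoutElim A B C f g (lam (pushout A B C f g) fun _ => X) l r
    (lam C fun c =>
      comp X
        (transport (pushout A B C f g) (lam (pushout A B C f g) fun _ => X)
          (inl A B C f g ⬝ (f ⬝ c)) (inr A B C f g ⬝ (g ⬝ c)) (push A B C f g ⬝ c) (l ⬝ (f ⬝ c)))
        (l ⬝ (f ⬝ c)) (r ⬝ (g ⬝ c))
        (transportConst (pushout A B C f g) X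
          (inl A B C f g ⬝ (f ⬝ c)) (inr A B C f g ⬝ (g ⬝ c)) (push A B C f g ⬝ c) (l ⬝ (f ⬝ c)))
        (p ⬝ c))

/-! ### The types of the primitive constants

The universe levels `i` (of the types involved) and `j` (of the motive of an eliminator) are
arbitrary. -/

/-- The type of a constant, at universe levels `i` and `j`. -/
def constType (i j : ℕ) : Const → Exp
  | .sigma => pi (univ i) fun A => (A ⇒ univ i) ⇒ univ i
  | .pair =>
      pi (univ i) fun A => pi (A ⇒ univ i) fun B => pi A fun a => (B ⬝ a) ⇒ sigma A B
  | .sigmaElim =>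
      pi (univ i) fun A => pi (A ⇒ univ i) fun B => pi (sigma A B ⇒ univ j) fun P =>
      (pi A fun x => pi (B ⬝ x) fun y => P ⬝ pair A B x y) ⇒
      pi (sigma A B) fun z => P ⬝ z
  | .id => pi (univ i) fun A => A ⇒ A ⇒ univ i
  | .idp => pi (univ i) fun A => pi A fun a => id A a a
  | .J =>
      pi (univ i) fun A => pi A fun a =>
      pi (pi A fun x => id A a x ⇒ univ j) fun P =>
      (P ⬝ a ⬝ idp A a) ⇒
      pi A fun x => pi (id A a x) fun p => P ⬝ x ⬝ p
  | .pushout =>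
      pi (univ i) fun A => pi (univ i) fun B => pi (univ i) fun C => (C ⇒ A) ⇒ (C ⇒ B) ⇒ univ i
  | .inl =>
      pi (univ i) fun A => pi (univ i) fun B => pi (univ i) fun C =>
      pi (C ⇒ A) fun f => pi (C ⇒ B) fun g => A ⇒ pushout A B C f g
  | .inr =>
      pi (univ i) fun A => pi (univ i) fun B => pi (univ i) fun C =>
      pi (C ⇒ A) fun f => pi (C ⇒ B) fun g => B ⇒ pushout A B C f g
  | .push =>
      pi (univ i) fun A => pi (univ i) fun B => pi (univ i) fun C =>
      pi (C ⇒ A) fun f => pi (C ⇒ B) fun g =>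
      pi C fun c =>
        id (pushout A B C f g) (inl A B C f g ⬝ (f ⬝ c)) (inr A B C f g ⬝ (g ⬝ c))
  | .pushoutElim =>
      pi (univ i) fun A => pi (univ i) fun B => pi (univ i) fun C =>
      pi (C ⇒ A) fun f => pi (C ⇒ B) fun g =>
      pi (pushout A B C f g ⇒ univ j) fun P =>
      pi (pi A fun a => P ⬝ (inl A B C f g ⬝ a)) fun l =>
      pi (pi B fun b => P ⬝ (inr A B C f g ⬝ b)) fun r =>
      pushoutElimPath A B C f g P l r ⇒
      pi (pushout A B C f g) fun x => P ⬝ x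
  | .pushoutElimPush =>
      -- the computation rule on `push c`, as an identification: `apd h (push c) = p c`
      pi (univ i) fun A => pi (univ i) fun B => pi (univ i) fun C =>
      pi (C ⇒ A) fun f => pi (C ⇒ B) fun g =>
      pi (pushout A B C f g ⇒ univ j) fun P =>
      pi (pi A fun a => P ⬝ (inl A B C f g ⬝ a)) fun l =>
      pi (pi B fun b => P ⬝ (inr A B C f g ⬝ b)) fun r =>
      pi (pushoutElimPath A B C f g P l r) fun p =>
      pi C fun c =>
        id
          (pathOver (pushout A B C f g) P (inl A B C f g ⬝ (f ⬝ c)) (inr A B C f g ⬝ (g ⬝ c))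
            (push A B C f g ⬝ c) (l ⬝ (f ⬝ c)) (r ⬝ (g ⬝ c)))
          (apd (pushout A B C f g) P (pushoutElim A B C f g P l r p)
            (inl A B C f g ⬝ (f ⬝ c)) (inr A B C f g ⬝ (g ⬝ c)) (push A B C f g ⬝ c))
          (p ⬝ c)
  | .univalence =>
      pi (univ i) fun A => pi (univ i) fun B =>
        isEquiv (id (univ i) A B) (equiv A B) (idToEquiv i A B)

end Exp

/-! ### Conversion and typing -/

open Tm in
/-- Convertibility (equality by definition): the congruence generated by the `β` and `η` rules for
functions and the computation rules of the eliminators on point constructors. -/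
inductive Conv : Tm → Tm → Prop
  | refl (t : Tm) : Conv t t
  | symm {t u : Tm} : Conv t u → Conv u t
  | trans {t u v : Tm} : Conv t u → Conv u v → Conv t v
  | pi {A A' B B' : Tm} : Conv A A' → Conv B B' → Conv (pi A B) (pi A' B')
  | lam {A A' b b' : Tm} : Conv A A' → Conv b b' → Conv (lam A b) (lam A' b')
  | app {f f' a a' : Tm} : Conv f f' → Conv a a' → Conv (app f a) (app f' a')
  | beta (A b a : Tm) : Conv (app (lam A b) a) (inst b a)
  | eta (A f : Tm) : Conv (lam A (app (lift 1 f) (var 0))) f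
  | sigmaElim (A B P d A' B' a b : Tm) :
      Conv (apps (const .sigmaElim) [A, B, P, d, apps (const .pair) [A', B', a, b]])
        (apps d [a, b])
  | J (A a P d x A' a' : Tm) :
      Conv (apps (const .J) [A, a, P, d, x, apps (const .idp) [A', a']]) d
  | pushoutInl (A B C f g P l r p A' B' C' f' g' a : Tm) :
      Conv (apps (const .pushoutElim)
          [A, B, C, f, g, P, l, r, p, apps (const .inl) [A', B', C', f', g', a]])
        (app l a)
  | pushoutInr (A B C f g P l r p A' B' C' f' g' b : Tm) :
      Conv (apps (const .pushoutElim)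
          [A, B, C, f, g, P, l, r, p, apps (const .inr) [A', B', C', f', g', b]])
        (app r b)

open Tm in
/-- The typing judgment `Γ ⊢ t : A`.  A context is the list of the types of its variables, the
innermost first; starting from the empty context, the rules only ever extend a context by a
well-formed type. -/
inductive HasType : List Tm → Tm → Tm → Prop
  | var {Γ : List Tm} {n : ℕ} {A : Tm} : Γ[n]? = some A → HasType Γ (var n) (lift (n + 1) A)
  | univ (Γ : List Tm) (i : ℕ) : HasType Γ (univ i) (univ (i + 1))
  | cumul {Γ : List Tm} {A : Tm} {i : ℕ} : HasType Γ A (univ i) → HasType Γ A (univ (i + 1))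
  | pi {Γ : List Tm} {A B : Tm} {i : ℕ} :
      HasType Γ A (univ i) → HasType (A :: Γ) B (univ i) → HasType Γ (pi A B) (univ i)
  | lam {Γ : List Tm} {A b B : Tm} {i : ℕ} :
      HasType Γ A (univ i) → HasType (A :: Γ) b B → HasType Γ (lam A b) (pi A B)
  | app {Γ : List Tm} {f a A B : Tm} :
      HasType Γ f (pi A B) → HasType Γ a A → HasType Γ (app f a) (inst B a)
  | const (Γ : List Tm) (c : Const) (i j : ℕ) : HasType Γ (const c) (Exp.constType i j c 0)
  | conv {Γ : List Tm} {t A B : Tm} {i : ℕ} :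
      HasType Γ t A → Conv A B → HasType Γ B (univ i) → HasType Γ t B

/-- A closed type is a theorem of homotopy type theory if it is well formed and some closed term
inhabits it. -/
def IsTheorem (T : Exp) : Prop :=
  (∃ i, HasType [] (T 0) (Tm.univ i)) ∧ ∃ t, HasType [] t (T 0)

/-! ### The 3×3 diagram -/

namespace Exp

/-- Composition of three paths `a = b = c = d` in `A`. -/
def comp₃ (A a b c d p q r : Exp) : Exp := comp A a c d (comp A a b c p q) r

/-- The map between the pushouts of two spans `A ← C → B` (legs `f`, `g`) and `A' ← C' → B'`
(legs `f'`, `g'`) given by `u : A → A'`, `v : B → B'`, `w : C → C'` and paths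
`s c : u (f c) = f' (w c)`, `t c : v (g c) = g' (w c)`:
`inl a ↦ inl (u a)`, `inr b ↦ inr (v b)`,
`push c ↦ ap inl (s c) · push (w c) · (ap inr (t c))⁻¹`. -/
def pushoutMap (A B C f g A' B' C' f' g' u v w s t : Exp) : Exp :=
  pushoutRec A B C f g (pushout A' B' C' f' g')
    (lam A fun a => inl A' B' C' f' g' ⬝ (u ⬝ a))
    (lam B fun b => inr A' B' C' f' g' ⬝ (v ⬝ b))
    (lam C fun c =>
      comp₃ (pushout A' B' C' f' g')
        (inl A' B' C' f' g' ⬝ (u ⬝ (f ⬝ c)))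
        (inl A' B' C' f' g' ⬝ (f' ⬝ (w ⬝ c)))
        (inr A' B' C' f' g' ⬝ (g' ⬝ (w ⬝ c)))
        (inr A' B' C' f' g' ⬝ (v ⬝ (g ⬝ c)))
        (ap A' (pushout A' B' C' f' g') (inl A' B' C' f' g')
          (u ⬝ (f ⬝ c)) (f' ⬝ (w ⬝ c)) (s ⬝ c))
        (push A' B' C' f' g' ⬝ (w ⬝ c))
        (inv (pushout A' B' C' f' g')
          (inr A' B' C' f' g' ⬝ (v ⬝ (g ⬝ c))) (inr A' B' C' f' g' ⬝ (g' ⬝ (w ⬝ c)))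
          (ap B' (pushout A' B' C' f' g') (inr A' B' C' f' g')
            (v ⬝ (g ⬝ c)) (g' ⬝ (w ⬝ c)) (t ⬝ c))))

/-- The pointwise inverse of a homotopy `h : (c : C) → k c =_X k' c`. -/
def homotopyInv (C X : Exp) (k k' : Exp → Exp) (h : Exp) : Exp :=
  lam C fun c => inv X (k c) (k' c) (h ⬝ c)

/-- The pushout of the pushouts of the three columns. -/
def columnsFirst (A00 A02 A04 A20 A22 A24 A40 A42 A44
    f01 f03 f10 f12 f14 f21 f23 f30 f32 f34 f41 f43 H11 H13 H31 H33 : Exp) : Exp :=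
  pushout (pushout A00 A40 A20 f10 f30) (pushout A04 A44 A24 f14 f34) (pushout A02 A42 A22 f12 f32)
    (pushoutMap A02 A42 A22 f12 f32 A00 A40 A20 f10 f30 f01 f41 f21 H11 H31)
    (pushoutMap A02 A42 A22 f12 f32 A04 A44 A24 f14 f34 f03 f43 f23 H13 H33)

/-- The pushout of the pushouts of the three rows. -/
def rowsFirst (A00 A02 A04 A20 A22 A24 A40 A42 A44
    f01 f03 f10 f12 f14 f21 f23 f30 f32 f34 f41 f43 H11 H13 H31 H33 : Exp) : Exp :=
  pushout (pushout A00 A04 A02 f01 f03) (pushout A40 A44 A42 f41 f43) (pushout A20 A24 A22 f21 f23)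
    (pushoutMap A20 A24 A22 f21 f23 A00 A04 A02 f01 f03 f10 f14 f12
      (homotopyInv A22 A00 (fun x => f01 ⬝ (f12 ⬝ x)) (fun x => f10 ⬝ (f21 ⬝ x)) H11)
      (homotopyInv A22 A04 (fun x => f03 ⬝ (f12 ⬝ x)) (fun x => f14 ⬝ (f23 ⬝ x)) H13))
    (pushoutMap A20 A24 A22 f21 f23 A40 A44 A42 f41 f43 f30 f34 f32
      (homotopyInv A22 A40 (fun x => f41 ⬝ (f32 ⬝ x)) (fun x => f30 ⬝ (f21 ⬝ x)) H31)
      (homotopyInv A22 A44 (fun x => f43 ⬝ (f32 ⬝ x)) (fun x => f34 ⬝ (f23 ⬝ x)) H33))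

/-- The closed type: for all types, maps and fillers
```
  A00 ←f01- A02 -f03→ A04
   ↑f10      ↑f12      ↑f14
  A20 ←f21- A22 -f23→ A24
   ↓f30      ↓f32      ↓f34
  A40 ←f41- A42 -f43→ A44
```
the two iterated pushouts are equivalent. -/
def threeByThree (ℓ : ℕ) : Exp :=
  pi (univ ℓ) fun A00 => pi (univ ℓ) fun A02 => pi (univ ℓ) fun A04 =>
  pi (univ ℓ) fun A20 => pi (univ ℓ) fun A22 => pi (univ ℓ) fun A24 =>
  pi (univ ℓ) fun A40 => pi (univ ℓ) fun A42 => pi (univ ℓ) fun A44 =>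
  pi (A02 ⇒ A00) fun f01 => pi (A02 ⇒ A04) fun f03 =>
  pi (A20 ⇒ A00) fun f10 => pi (A22 ⇒ A02) fun f12 => pi (A24 ⇒ A04) fun f14 =>
  pi (A22 ⇒ A20) fun f21 => pi (A22 ⇒ A24) fun f23 =>
  pi (A20 ⇒ A40) fun f30 => pi (A22 ⇒ A42) fun f32 => pi (A24 ⇒ A44) fun f34 =>
  pi (A42 ⇒ A40) fun f41 => pi (A42 ⇒ A44) fun f43 =>
  pi (pi A22 fun x => id A00 (f01 ⬝ (f12 ⬝ x)) (f10 ⬝ (f21 ⬝ x))) fun H11 =>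
  pi (pi A22 fun x => id A04 (f03 ⬝ (f12 ⬝ x)) (f14 ⬝ (f23 ⬝ x))) fun H13 =>
  pi (pi A22 fun x => id A40 (f41 ⬝ (f32 ⬝ x)) (f30 ⬝ (f21 ⬝ x))) fun H31 =>
  pi (pi A22 fun x => id A44 (f43 ⬝ (f32 ⬝ x)) (f34 ⬝ (f23 ⬝ x))) fun H33 =>
  equiv
    (columnsFirst A00 A02 A04 A20 A22 A24 A40 A42 A44
      f01 f03 f10 f12 f14 f21 f23 f30 f32 f34 f41 f43 H11 H13 H31 H33)
    (rowsFirst A00 A02 A04 A20 A22 A24 A40 A42 A44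
      f01 f03 f10 f12 f14 f21 f23 f30 f32 f34 f41 f43 H11 H13 H31 H33)

end Exp

end HoTT

namespace HoTT

/-! ### Renaming and substitution -/

namespace Tm

/-! Mathematical idea. A type is determined by the maps out of it, and both iterated pushouts have
the same maps out, naturally in the target. By the universal property, a map from `A_{•□}` to `X` is
a map on `A_{•0}`, a map on `A_{•4}`, and a homotopy over `A_{•2}` between their composites with
`f_{•1}` and `f_{•3}`. Each of these three is again a function on a pushout. Decomposing them leaves
four maps on the corners, four homotopies on `A_{20}`, `A_{24}`, `A_{02}`, `A_{42}`, and for every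
`x : A_{22}` a square in `X`. Two opposite sides of the square are homotopies on a column,
conjugated by the fillers `H`; the other two are homotopies on the middle column. The transposed
diagram yields the same maps and homotopies, with the two kinds of homotopies exchanged and the
fillers inverted, and it asks for the transposed squares. Transposition of squares is an equivalence
by path induction.

The decomposition rests on `pushoutUniversalProof`, `Legs.evalEquivProof` and
`Diagram.restrictEquivProof`, the transposition on `El.flipEquivProof` and
`Diagram.transposeDataEquivProof`. Most of the work is naturality in `X` (`Legs.evalNatProof`,
`Diagram.restrictNatProof`, `Diagram.transposeNatProof`), since `ap` commutes with composition only
up to paths. `yonedaProof` then turns two representations of the same data into an equivalence.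
Function extensionality comes from an interval made of a pushout. Univalence enters only through
induction on equivalences, which shows that a fibrewise equivalence over an equivalence is an
equivalence on pair types.

Formal side. What has to be exhibited is a derivation in the formal system. It is obtained by
reflection: a type checker is defined and proved sound (`Raw.hasType_of_check`), the object-level
proof is written as a list of named closed terms, and the kernel evaluates the checker on each of
them (`check_entries`). Only soundness is needed: a failed test would prove nothing, so neither
confluence nor normalization of the theory plays a role. The checker works at universe level 0, and
`HasType.raise` shifts the resulting derivation to an arbitrary level. -/

@[simp] lemma upRen_zero (ξ : ℕ → ℕ) : upRen ξ 0 = 0 := rfl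
@[simp] lemma upRen_succ (ξ : ℕ → ℕ) (n : ℕ) : upRen ξ (n + 1) = ξ n + 1 := rfl
@[simp] lemma upSubst_zero (σ : ℕ → Tm) : upSubst σ 0 = var 0 := rfl
@[simp] lemma upSubst_succ (σ : ℕ → Tm) (n : ℕ) : upSubst σ (n + 1) = lift 1 (σ n) := rfl

lemma rename_rename (ξ ζ : ℕ → ℕ) (t : Tm) :
    rename ξ (rename ζ t) = rename (fun n => ξ (ζ n)) t := by
  have up (ξ ζ : ℕ → ℕ) : (fun n => upRen ξ (upRen ζ n)) = upRen fun n => ξ (ζ n) := by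
    funext n; cases n <;> rfl
  induction t generalizing ξ ζ <;> simp_all [rename]

lemma subst_rename (σ : ℕ → Tm) (ξ : ℕ → ℕ) (t : Tm) :
    subst σ (rename ξ t) = subst (fun n => σ (ξ n)) t := by
  have up (σ : ℕ → Tm) (ξ : ℕ → ℕ) :
      (fun n => upSubst σ (upRen ξ n)) = upSubst fun n => σ (ξ n) := by
    funext n; cases n <;> rfl
  induction t generalizing σ ξ <;> simp_all [rename, subst]

lemma rename_subst (ξ : ℕ → ℕ) (σ : ℕ → Tm) (t : Tm) :
    rename ξ (subst σ t) = subst (fun n => rename ξ (σ n)) t := by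
  have up (ξ : ℕ → ℕ) (σ : ℕ → Tm) :
      (fun n => rename (upRen ξ) (upSubst σ n)) = upSubst fun n => rename ξ (σ n) := by
    funext n; cases n <;> simp [upSubst, lift, rename, rename_rename]
  induction t generalizing σ ξ <;> simp_all [rename, subst]

lemma subst_subst (τ σ : ℕ → Tm) (t : Tm) :
    subst τ (subst σ t) = subst (fun n => subst τ (σ n)) t := by
  have up (τ σ : ℕ → Tm) :
      (fun n => subst (upSubst τ) (upSubst σ n)) = upSubst fun n => subst τ (σ n) := by
    funext n; cases n <;> simp [upSubst, lift, subst, subst_rename, rename_subst]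
  induction t generalizing σ τ <;> simp_all [subst]

lemma upSubst_var : upSubst var = var := by
  funext n; cases n <;> rfl

lemma subst_var (t : Tm) : subst var t = t := by
  induction t <;> simp_all [subst, upSubst_var]

lemma rename_eq_subst (ξ : ℕ → ℕ) (t : Tm) : rename ξ t = subst (fun n => var (ξ n)) t := by
  have := rename_subst ξ var t
  rwa [subst_var] at this

/-- The substitution of `a` for the variable `0`. -/
def scons (a : Tm) : ℕ → Tm
  | 0 => a
  | m + 1 => var m

lemma inst_eq (b a : Tm) : inst b a = subst (scons a) b := by
  unfold inst; congr 1

lemma subst_inst (σ : ℕ → Tm) (b a : Tm) :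
    subst σ (inst b a) = inst (subst (upSubst σ) b) (subst σ a) := by
  simp only [inst_eq, subst_subst]
  congr 1; funext n
  cases n with
  | zero => rfl
  | succ n => simp [scons, subst, lift, subst_rename, subst_var]

lemma rename_inst (ξ : ℕ → ℕ) (b a : Tm) :
    rename ξ (inst b a) = inst (rename (upRen ξ) b) (rename ξ a) := by
  simp only [inst_eq, rename_subst, subst_rename]
  congr 1; funext n; cases n <;> rfl

lemma lift_zero (t : Tm) : lift 0 t = t := by
  simp only [lift, Nat.add_zero, rename_eq_subst]; exact subst_var t

lemma lift_lift (k l : ℕ) (t : Tm) : lift k (lift l t) = lift (l + k) t := by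
  simp only [lift, rename_rename, Nat.add_assoc]

lemma inst_lift (t a : Tm) : inst (lift 1 t) a = t := by
  rw [inst_eq, lift, subst_rename]; exact subst_var t

lemma subst_upSubst_lift (σ : ℕ → Tm) (t : Tm) :
    subst (upSubst σ) (lift 1 t) = lift 1 (subst σ t) := by
  simp only [lift, subst_rename, rename_subst]; rfl

lemma rename_upRen_lift (ξ : ℕ → ℕ) (t : Tm) :
    rename (upRen ξ) (lift 1 t) = lift 1 (rename ξ t) := by
  simp only [lift, rename_rename]; rfl

lemma subst_constType (σ : ℕ → Tm) (c : Const) (i j : ℕ) :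
    subst σ (Exp.constType i j c 0) = Exp.constType i j c 0 := by
  cases c <;> rfl

end Tm

open Tm

lemma Conv.subst {t u : Tm} (h : Conv t u) (σ : ℕ → Tm) : Conv (t.subst σ) (u.subst σ) := by
  induction h generalizing σ with
  | refl t => exact .refl _
  | symm _ ih => exact .symm (ih σ)
  | trans _ _ ih₁ ih₂ => exact .trans (ih₁ σ) (ih₂ σ)
  | pi _ _ ih₁ ih₂ => exact .pi (ih₁ σ) (ih₂ _)
  | lam _ _ ih₁ ih₂ => exact .lam (ih₁ σ) (ih₂ _)
  | app _ _ ih₁ ih₂ => exact .app (ih₁ σ) (ih₂ σ)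
  | beta A b a => rw [subst_inst]; exact .beta _ _ _
  | eta A f =>
    have := Conv.eta (A.subst σ) (f.subst σ)
    rwa [← subst_upSubst_lift] at this
  | sigmaElim => exact .sigmaElim ..
  | J => exact .J ..
  | pushoutInl => exact .pushoutInl ..
  | pushoutInr => exact .pushoutInr ..

lemma Conv.rename {t u : Tm} (h : Conv t u) (ξ : ℕ → ℕ) : Conv (t.rename ξ) (u.rename ξ) := by
  simpa only [rename_eq_subst] using h.subst fun n => var (ξ n)

/-- The annotation of an abstraction does not matter for conversion. -/
lemma Conv.lam_annotation (A A' b : Tm) : Conv (.lam A b) (.lam A' b) := by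
  have h : Conv (.app (lift 1 (.lam A b)) (.var 0)) b := by
    have := Conv.beta (A.rename (· + 1)) (b.rename (upRen (· + 1))) (.var 0)
    rw [inst_eq, subst_rename] at this
    rwa [show (fun n => scons (.var 0) (upRen (· + 1) n)) = Tm.var by
      funext n; cases n <;> rfl, subst_var] at this
  -- Expand the abstraction by η with the new annotation, then contract the β-redex in its body.
  exact (Conv.eta A' (.lam A b)).symm.trans (.lam (.refl _) h)

/-! ### Admissible rules -/

namespace HasType

/-- The condition that every variable is sent to one with the renamed type passes under a binder.
This is what the cases of `pi` and `lam` in the induction need; `subst_mem` plays the same part for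
substitutions. -/
lemma rename_mem {Γ Δ : List Tm} {ξ : ℕ → ℕ} {C : Tm}
    (h : ∀ n B, Γ[n]? = some B →
      ∃ B', Δ[ξ n]? = some B' ∧ lift (ξ n + 1) B' = Tm.rename ξ (lift (n + 1) B))
    (n : ℕ) (B : Tm) (hB : (C :: Γ)[n]? = some B) :
    ∃ B', (C.rename ξ :: Δ)[upRen ξ n]? = some B' ∧
      lift (upRen ξ n + 1) B' = Tm.rename (upRen ξ) (lift (n + 1) B) := by
  cases n with
  | zero =>
    obtain rfl : C = B := by simpa using hB
    exact ⟨_, rfl, (rename_upRen_lift ξ C).symm⟩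
  | succ n =>
    obtain ⟨B', h₁, h₂⟩ := h n B (by simpa using hB)
    refine ⟨B', by simpa using h₁, ?_⟩
    rw [upRen_succ, ← lift_lift 1, h₂, ← lift_lift 1 (n + 1), rename_upRen_lift]

lemma rename {Γ : List Tm} {t A : Tm} (ht : HasType Γ t A) {Δ : List Tm} {ξ : ℕ → ℕ}
    (h : ∀ n B, Γ[n]? = some B →
      ∃ B', Δ[ξ n]? = some B' ∧ lift (ξ n + 1) B' = Tm.rename ξ (lift (n + 1) B)) :
    HasType Δ (t.rename ξ) (A.rename ξ) := by
  induction ht generalizing Δ ξ with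
  | var hn =>
    obtain ⟨B', h₁, h₂⟩ := h _ _ hn
    exact h₂ ▸ .var h₁
  | univ Γ i => exact .univ _ i
  | cumul _ ih => exact .cumul (ih h)
  | pi _ _ ih₁ ih₂ => exact .pi (ih₁ h) (ih₂ (rename_mem h))
  | lam _ _ ih₁ ih₂ => exact .lam (ih₁ h) (ih₂ (rename_mem h))
  | app _ _ ih₁ ih₂ => rw [rename_inst]; exact .app (ih₁ h) (ih₂ h)
  | const Γ c i j =>
    rw [rename_eq_subst, rename_eq_subst, subst_constType]; exact .const _ c i j
  | conv _ hc _ ih₁ ih₂ => exact .conv (ih₁ h) (hc.rename ξ) (ih₂ h)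

lemma weaken {Γ : List Tm} {t A : Tm} (C : Tm) (ht : HasType Γ t A) :
    HasType (C :: Γ) (lift 1 t) (lift 1 A) :=
  ht.rename fun n B hB => ⟨B, by simpa using hB, by rw [← lift_lift 1 (n + 1)]; rfl⟩

lemma weaken_nil {t A : Tm} (ht : HasType [] t A) (ξ : ℕ → ℕ) (Γ : List Tm) :
    HasType Γ (t.rename ξ) (A.rename ξ) :=
  ht.rename fun n B hB => by simp at hB

lemma subst_mem {Γ Δ : List Tm} {σ : ℕ → Tm} {C : Tm}
    (h : ∀ n B, Γ[n]? = some B → HasType Δ (σ n) (Tm.subst σ (lift (n + 1) B)))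
    (n : ℕ) (B : Tm) (hB : (C :: Γ)[n]? = some B) :
    HasType (C.subst σ :: Δ) (upSubst σ n) (Tm.subst (upSubst σ) (lift (n + 1) B)) := by
  cases n with
  | zero =>
    obtain rfl : C = B := by simpa using hB
    rw [subst_upSubst_lift]
    exact .var rfl
  | succ n =>
    rw [← lift_lift 1, subst_upSubst_lift]
    exact (h n B (by simpa using hB)).weaken _

lemma subst {Γ : List Tm} {t A : Tm} (ht : HasType Γ t A) {Δ : List Tm} {σ : ℕ → Tm}
    (h : ∀ n B, Γ[n]? = some B → HasType Δ (σ n) (Tm.subst σ (lift (n + 1) B))) :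
    HasType Δ (t.subst σ) (A.subst σ) := by
  induction ht generalizing Δ σ with
  | var hn => exact h _ _ hn
  | univ Γ i => exact .univ _ i
  | cumul _ ih => exact .cumul (ih h)
  | pi _ _ ih₁ ih₂ => exact .pi (ih₁ h) (ih₂ (subst_mem h))
  | lam _ _ ih₁ ih₂ => exact .lam (ih₁ h) (ih₂ (subst_mem h))
  | app _ _ ih₁ ih₂ => rw [subst_inst]; exact .app (ih₁ h) (ih₂ h)
  | const Γ c i j => rw [subst_constType]; exact .const _ c i j
  | conv _ hc _ ih₁ ih₂ => exact .conv (ih₁ h) (hc.subst σ) (ih₂ h)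

lemma inst {Γ : List Tm} {A a b B : Tm} (hb : HasType (A :: Γ) b B) (ha : HasType Γ a A) :
    HasType Γ (b.inst a) (B.inst a) := by
  rw [inst_eq, inst_eq]
  refine hb.subst fun n C hC => ?_
  cases n with
  | zero =>
    obtain rfl : A = C := by simpa using hC
    rw [← inst_eq, inst_lift]; exact ha
  | succ n =>
    rw [← lift_lift 1, ← inst_eq, inst_lift]
    exact .var (by simpa using hC)

lemma cumul_le {Γ : List Tm} {A : Tm} {i j : ℕ} (h : HasType Γ A (.univ i)) (hij : i ≤ j) :
    HasType Γ A (.univ j) := by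
  induction hij with
  | refl => exact h
  | step _ ih => exact ih.cumul

/-- Cumulativity and conversion change the type but not the term, so every derivation for a function
type ends, up to these rules, with its formation. No injectivity of `pi` up to conversion is needed
later, because the checker applies only terms whose type is literally a `pi`. -/
lemma of_pi {Γ : List Tm} {A B T : Tm} (h : HasType Γ (.pi A B) T) :
    ∃ i, HasType Γ A (.univ i) ∧ HasType (A :: Γ) B (.univ i) := by
  generalize ht : Tm.pi A B = t at h
  induction h with
  | pi h₁ h₂ => cases ht; exact ⟨_, h₁, h₂⟩
  | cumul _ ih => exact ih ht
  | conv _ _ _ ih => exact ih ht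
  | _ => cases ht

end HasType

/-- `A` is a well-formed type in context `Γ`. -/
def IsType (Γ : List Tm) (A : Tm) : Prop := ∃ i, HasType Γ A (.univ i)

/-- The types of all variables of `Γ` are well formed. -/
def WellFormed (Γ : List Tm) : Prop := ∀ n A, Γ[n]? = some A → IsType Γ (lift (n + 1) A)

lemma WellFormed.nil : WellFormed [] := fun n A h => by simp at h

lemma WellFormed.cons {Γ : List Tm} (h : WellFormed Γ) {A : Tm} (hA : IsType Γ A) :
    WellFormed (A :: Γ) := by
  rintro (_ | n) B hB
  · obtain rfl : A = B := by simpa using hB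
    exact hA.imp fun i hi => hi.weaken _
  · rw [← lift_lift 1]
    exact (h n B (by simpa using hB)).imp fun i hi => hi.weaken _

/-! ### Universe levels -/

/-- Raise all universe levels by `k`. -/
def Tm.raise (k : ℕ) : Tm → Tm
  | .var n => .var n
  | .univ i => .univ (k + i)
  | .pi A B => .pi (raise k A) (raise k B)
  | .lam A b => .lam (raise k A) (raise k b)
  | .app f a => .app (raise k f) (raise k a)
  | .const c => .const c

lemma Tm.raise_rename (k : ℕ) (ξ : ℕ → ℕ) (t : Tm) :
    raise k (rename ξ t) = rename ξ (raise k t) := by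
  induction t generalizing ξ <;> simp_all [rename, raise]

lemma Tm.raise_subst (k : ℕ) (σ : ℕ → Tm) (t : Tm) :
    raise k (subst σ t) = subst (fun n => raise k (σ n)) (raise k t) := by
  have up (σ : ℕ → Tm) : (fun n => raise k (upSubst σ n)) = upSubst fun n => raise k (σ n) := by
    funext n; cases n <;> simp [lift, raise, raise_rename]
  induction t generalizing σ <;> simp_all [subst, raise]

lemma Tm.raise_inst (k : ℕ) (b a : Tm) : raise k (inst b a) = inst (raise k b) (raise k a) := by
  rw [inst_eq, inst_eq, raise_subst]
  congr 1; funext n; cases n <;> rfl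

lemma Conv.raise {t u : Tm} (h : Conv t u) (k : ℕ) : Conv (t.raise k) (u.raise k) := by
  induction h with
  | refl t => exact .refl _
  | symm _ ih => exact .symm ih
  | trans _ _ ih₁ ih₂ => exact .trans ih₁ ih₂
  | pi _ _ ih₁ ih₂ => exact .pi ih₁ ih₂
  | lam _ _ ih₁ ih₂ => exact .lam ih₁ ih₂
  | app _ _ ih₁ ih₂ => exact .app ih₁ ih₂
  | beta A b a => rw [raise_inst]; exact .beta _ _ _
  | eta A f =>
    have := Conv.eta (A.raise k) (f.raise k)
    rwa [lift, ← raise_rename] at this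
  | sigmaElim => exact .sigmaElim ..
  | J => exact .J ..
  | pushoutInl => exact .pushoutInl ..
  | pushoutInr => exact .pushoutInr ..

/-- The rules mention levels only through successors, and the constants exist at all levels, so a
derivation can be shifted uniformly. It therefore suffices to derive the theorem at level 0. -/
lemma HasType.raise {Γ : List Tm} {t A : Tm} (h : HasType Γ t A) (k : ℕ) :
    HasType (Γ.map (Tm.raise k)) (t.raise k) (A.raise k) := by
  induction h with
  | var hn => rw [lift, raise_rename]; exact .var (by simp [hn])
  | univ Γ i => exact .univ _ _
  | cumul _ ih => exact .cumul ih
  | pi _ _ ih₁ ih₂ => exact .pi ih₁ ih₂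
  | lam _ _ ih₁ ih₂ => exact .lam ih₁ ih₂
  | app _ _ ih₁ ih₂ => rw [raise_inst]; exact .app ih₁ ih₂
  | const Γ c i j =>
    have : (Exp.constType i j c 0).raise k = Exp.constType (k + i) (k + j) c 0 := by
      cases c <;> rfl
    rw [this]; exact .const _ c _ _
  | conv _ hc _ ih₁ ih₂ => exact .conv ih₁ (hc.raise k) ih₂

end HoTT

namespace HoTT

/-! ### A verified type checker

The checker is run by the kernel, so that its functions are defined by recursors. -/

/-- Raw terms with names for closed terms given beforehand. -/
inductive Code : Type
  | var (n : ℕ)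
  | univ (i : ℕ)
  | pi (A B : Code)
  | lam (A b : Code)
  | app (f a : Code)
  | const (c : Const)
  | glob (k : ℕ)

/-- The types of the named terms, and the values of those that may be unfolded. -/
abbrev Globals : Type := List (Code × Option Code)

/-- The type and the value of a named term. -/
noncomputable def Globals.get (G : Globals) (k : ℕ) : Option (Code × Option Code) :=
  List.rec (motive := fun _ => ℕ → Option (Code × Option Code)) (fun _ => none)
    (fun A _ ih n => Nat.rec (some A) (fun n _ => ih n) n) G k

namespace Code

/-- Iterated application. -/
noncomputable def apps (f : Code) (s : List Code) : Code :=
  List.rec (motive := fun _ => Code → Code) (fun f => f) (fun a _ ih f => ih (app f a)) s f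

/-- Add `k` to the variables from `c` on. -/
noncomputable def liftAt (k c : ℕ) (t : Code) : Code :=
  Code.rec (motive := fun _ => ℕ → Code)
    (fun n c => Bool.rec (motive := fun _ => Code) (var n) (var (Nat.add n k)) (Nat.ble c n))
    (fun i _ => univ i)
    (fun _ _ A B c => pi (A c) (B (Nat.succ c)))
    (fun _ _ A b c => lam (A c) (b (Nat.succ c)))
    (fun _ _ f a c => app (f c) (a c))
    (fun x _ => const x) (fun k _ => glob k) t c

/-- The value of the variable `n` under the list of values `ρ`, for variables from `k` on. -/
noncomputable def lookupSubst (k : ℕ) (ρ : List Code) (n : ℕ) : Code :=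
  List.rec (motive := fun _ => ℕ → Code) (fun n => var (Nat.add n k))
    (fun a _ ih n => Nat.rec (Bool.rec (motive := fun _ => Code) (liftAt k 0 a) a (Nat.beq k 0)) (fun n _ => ih n) n)
    ρ n

/-- Substitute the values `ρ` for the variables from `k` on. -/
noncomputable def msub (ρ : List Code) (k : ℕ) (t : Code) : Code :=
  Code.rec (motive := fun _ => ℕ → Code)
    (fun n k => Bool.rec (motive := fun _ => Code) (var n) (lookupSubst k ρ (Nat.sub n k)) (Nat.ble k n))
    (fun i _ => univ i)
    (fun _ _ A B k => pi (A k) (B (Nat.succ k)))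
    (fun _ _ A b k => lam (A k) (b (Nat.succ k)))
    (fun _ _ f a k => app (f k) (a k))
    (fun x _ => const x) (fun k _ => glob k) t k

/-- A term with values for its free variables. -/
noncomputable def close (t : Code) (ρ : List Code) : Code :=
  match ρ with
  | [] => t
  | _ => msub ρ 0 t

/-- Syntactic equality. -/
noncomputable def beq (t u : Code) : Bool :=
  Code.rec (motive := fun _ => Code → Bool)
    (fun n u => match u with | var m => Nat.beq n m | _ => false)
    (fun n u => match u with | univ m => Nat.beq n m | _ => false)
    (fun _ _ A B u => match u with
      | pi A' B' => Bool.rec (motive := fun _ => Bool) false (B B') (A A') | _ => false)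
    (fun _ _ A b u => match u with
      | lam A' b' => Bool.rec (motive := fun _ => Bool) false (b b') (A A') | _ => false)
    (fun _ _ f a u => match u with
      | app f' a' => Bool.rec (motive := fun _ => Bool) false (a a') (f f') | _ => false)
    (fun c u => match u with | const d => Nat.beq c.ctorIdx d.ctorIdx | _ => false)
    (fun n u => match u with | glob m => Nat.beq n m | _ => false) t u

/-- The components of a pair. -/
def asPair : Code → Option (Code × Code)
  | app (app (app (app (const .pair) _) _) a) b => some (a, b)
  | _ => none

/-- Whether the term is a constant path. -/
def isIdp : Code → Bool
  | app (app (const .idp) _) _ => true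
  | _ => false

/-- The argument of a point constructor of a pushout; `true` stands for `inl`. -/
def asPoint : Code → Option (Bool × Code)
  | app (app (app (app (app (app (const .inl) _) _) _) _) _) a => some (true, a)
  | app (app (app (app (app (app (const .inr) _) _) _) _) _) a => some (false, a)
  | _ => none

/-- Weak head reduction of a constant applied to a list of arguments, if `w` computes weak head
normal forms of the principal argument and `w'` reduces the result. -/
noncomputable def whnfConst (w w' : Code → List Code → List Code → Code) : Const → List Code → Code
  | .sigmaElim, A :: B :: P :: d :: z :: s =>
    -- Only the principal argument is reduced. If no constructor appears, the application is
    -- returned with its original argument.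
    match asPair (w z [] []) with
    | some (a, b) => w' d [] (a :: b :: s)
    | none => apps (const .sigmaElim) (A :: B :: P :: d :: z :: s)
  | .J, A :: a :: P :: d :: x :: p :: s =>
    bif isIdp (w p [] []) then w' d [] s
    else apps (const .J) (A :: a :: P :: d :: x :: p :: s)
  | .pushoutElim, A :: B :: C :: f :: g :: P :: l :: r :: p :: z :: s =>
    match asPoint (w z [] []) with
    | some (true, a) => w' l [] (a :: s)
    | some (false, b) => w' r [] (b :: s)
    | none => apps (const .pushoutElim) (A :: B :: C :: f :: g :: P :: l :: r :: p :: z :: s)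
  | c, s => apps (const c) s

/-- The names below this one are always unfolded. -/
abbrev eagerBound : ℕ := 14

/-- Weak head normal form of the application of a term with values for its free variables to a list
of arguments, with fuel `n`; the flag says whether named terms in head position are unfolded. -/
noncomputable def whnf (G : Globals) (n : ℕ) : Bool → Code → List Code → List Code → Code :=
  -- An abstract machine: a term, the values of its free variables, and a stack of arguments into
  -- which their values have already been substituted. When the fuel is spent the state is read back
  -- unreduced, which is still convertible to the input.
  Nat.rec (fun _ t ρ s => apps (close t ρ) s) (fun _ w e t => Code.rec
    (fun n ρ s => match ρ with
      | [] => apps (var n) s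
      | a :: ρ => w e (lookupSubst 0 (a :: ρ) n) [] s)
    (fun i _ s => apps (univ i) s)
    (fun A B _ _ ρ s => apps (close (pi A B) ρ) s)
    (fun A b _ _ ρ s => match s with
      | [] => close (lam A b) ρ
      | a :: s => w e b (a :: ρ) s)
    (fun f a _ _ ρ s => w e f ρ (close a ρ :: s))
    (fun c _ s => whnfConst (w true) (w e) c s)
    (fun k _ s => bif bif e then true else Nat.blt k eagerBound then match G.get k with
      | some (_, some v) => w e v [] s
      | _ => apps (glob k) s else apps (glob k) s) t) n

/-- The fuel for weak head normal forms. -/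
abbrev fuel : ℕ := 10000

/-- Whether the terms are applications of the same abstraction or named term to the same number of
arguments. -/
noncomputable def sameHead (t : Code) : Code → Bool :=
  Code.rec (motive := fun _ => Code → Bool) (fun _ _ => false) (fun _ _ => false) (fun _ _ _ _ _ => false)
    (fun A b _ _ u => match u with
      | lam A' b' => bif beq A A' then beq b b' else false
      | _ => false)
    (fun _ _ ih _ u => match u with
      | app f _ => ih f
      | _ => false)
    (fun _ _ => false)
    (fun k u => match u with
      | glob k' => Nat.beq k k'
      | _ => false) t

/-- The successor of the name in head position if it can be unfolded. -/
noncomputable def rank (G : Globals) (t : Code) : ℕ :=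
  Code.rec (fun _ => 0) (fun _ => 0) (fun _ _ _ _ => 0) (fun _ _ _ _ => 0) (fun _ _ ih _ => ih) (fun _ => 0)
    (fun k => match G.get k with
      | some (_, some _) => Nat.succ k
      | _ => 0) t

/-- Unfolding of the name in head position. -/
noncomputable def unfoldHead (G : Globals) (t : Code) : Code :=
  Code.rec (fun n => var n) (fun i => univ i) (fun A B _ _ => pi A B) (fun A b _ _ => lam A b)
    (fun _ a ih _ => app ih a) (fun c => const c)
    (fun k => match G.get k with
      | some (_, some v) => v
      | _ => glob k) t

/-- What is compared: arbitrary terms, terms reduced up to the name in head position, or the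
functions in applications of names. -/
inductive Mode : Type
  | any
  | head
  | spine

/-- One step of the comparison of reduced terms. -/
noncomputable def convStep (c : Mode → Code → Code → Bool) : Code → Code → Bool
  -- The annotations need not be compared, by `Conv.lam_annotation`.
  | lam _ b, lam _ b' => c .any b b'
  | lam _ b, u => c .any b (app (liftAt 1 0 u) (var 0))
  | u, lam _ b => c .any (app (liftAt 1 0 u) (var 0)) b
  | pi A B, pi A' B' => bif c .any A A' then c .any B B' else false
  | app f a, app f' a' => bif c .spine f f' then c .any a a' else false
  | t, u => beq t u

/-- One step of the comparison of functions in applications. -/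
noncomputable def spineStep (c : Mode → Code → Code → Bool) : Code → Code → Bool
  | app f a, app f' a' => bif c .spine f f' then c .any a a' else false
  | t, u => beq t u

/-- One step of the comparison of terms reduced up to the name in head position; the name given
later is unfolded first. -/
noncomputable def headStep (G : Globals) (c : Mode → Code → Code → Bool) (t u : Code) : Bool :=
  bif Nat.beq (rank G t) (rank G u) then
    -- With names of equal rank in head position, comparing the arguments is tried first; both names
    -- are unfolded only if that fails.
    bif convStep c t u then true else
    bif Nat.beq (rank G t) 0 then false else
      c .head (whnf G fuel false (unfoldHead G t) [] []) (whnf G fuel false (unfoldHead G u) [] [])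
  else bif Nat.blt (rank G t) (rank G u) then
    c .head t (whnf G fuel false (unfoldHead G u) [] [])
  else c .head (whnf G fuel false (unfoldHead G t) [] []) u

/-- One step of the comparison of arbitrary terms. -/
noncomputable def anyStep (G : Globals) (c : Mode → Code → Code → Bool) (t u : Code) : Bool :=
  bif beq t u then true else
  bif bif sameHead t u then convStep c t u else false then true else
    c .head (whnf G fuel false t [] []) (whnf G fuel false u [] [])

/-- Conversion test. -/
noncomputable def convTest (G : Globals) (n : ℕ) : Mode → Code → Code → Bool :=
  Nat.rec (fun _ t u => beq t u)
    (fun _ c m t u => match m with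
      | .any => anyStep G c t u
      | .head => headStep G c t u
      | .spine => spineStep c t u) n

end Code

/-- Codes with universe levels of the constants and type ascriptions. -/
inductive Raw : Type
  | var (n : ℕ)
  | univ (i : ℕ)
  | pi (A B : Raw)
  | lam (A b : Raw)
  | app (f a : Raw)
  | const (c : Const) (i j : ℕ)
  | ann (t A : Raw)
  | up (A : Raw)
  | glob (k : ℕ)

namespace Raw

open Code

/-- The underlying code. -/
noncomputable def erase (t : Raw) : Code :=
  Raw.rec (fun n => .var n) (fun i => .univ i) (fun _ _ A B => .pi A B) (fun _ _ A b => .lam A b)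
    (fun _ _ f a => .app f a) (fun c _ _ => .const c) (fun _ _ t _ => t) (fun _ A => A)
    (fun k => .glob k) t

end Raw

end HoTT

namespace HoTT

/-! ### Source expressions

The combinators of `Exp`, with universe levels for the checker. -/

/-- Scoped annotated expressions. -/
abbrev Src : Type := ℕ → Raw

namespace Src

def bvar (n : ℕ) : Src := fun m => .var (m - 1 - n)
def univ (i : ℕ) : Src := fun _ => .univ i
def pi (A : Src) (B : Src → Src) : Src := fun n => .pi (A n) (B (bvar n) (n + 1))
def lam (A : Src) (b : Src → Src) : Src := fun n => .lam (A n) (b (bvar n) (n + 1))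
def app (f a : Src) : Src := fun n => .app (f n) (a n)
def const (c : Const) (i j : ℕ) : Src := fun _ => .const c i j
def ann (t A : Src) : Src := fun n => .ann (t n) (A n)
def up (A : Src) : Src := fun n => .up (A n)
def glob (k : ℕ) : Src := fun _ => .glob k
def arrow (A B : Src) : Src := pi A fun _ => B

local infixl:90 " ⬝ₛ " => app
local infixr:60 " ⇒ₛ " => arrow

variable (i j : ℕ)

def sigma (A B : Src) : Src := const .sigma i 0 ⬝ₛ A ⬝ₛ B
def pair (A B a b : Src) : Src := const .pair i 0 ⬝ₛ A ⬝ₛ B ⬝ₛ a ⬝ₛ b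
def sigmaElim (A B P d z : Src) : Src := const .sigmaElim i j ⬝ₛ A ⬝ₛ B ⬝ₛ P ⬝ₛ d ⬝ₛ z
def prod (A B : Src) : Src := sigma i A (lam A fun _ => B)
def id (A a b : Src) : Src := const .id i 0 ⬝ₛ A ⬝ₛ a ⬝ₛ b
def idp (A a : Src) : Src := const .idp i 0 ⬝ₛ A ⬝ₛ a
def J (A a P d x p : Src) : Src := const .J i j ⬝ₛ A ⬝ₛ a ⬝ₛ P ⬝ₛ d ⬝ₛ x ⬝ₛ p

def inv (A a b p : Src) : Src :=
  J i i A a (lam A fun x => lam (id i A a x) fun _ => id i A x a) (idp i A a) b p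

def comp (A a b c p q : Src) : Src :=
  J i i A b (lam A fun x => lam (id i A b x) fun _ => id i A a x) p c q

def ap (A B f a b p : Src) : Src :=
  J i j A a (lam A fun x => lam (id i A a x) fun _ => id j B (f ⬝ₛ a) (f ⬝ₛ x))
    (idp j B (f ⬝ₛ a)) b p

/-- The inferred type of the eliminator is an instance of its motive, hence a β-redex and not
literally a function type. Since the checker does not normalize the type of a function before
applying it, an ascription is needed here, and likewise in `coe`, `coeInv` and `pushoutRec`. -/
def transport (A P a b p u : Src) : Src :=
  ann (J i j A a (lam A fun x => lam (id i A a x) fun _ => (P ⬝ₛ a) ⇒ₛ (P ⬝ₛ x))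
    (lam (P ⬝ₛ a) fun v => v) b p) ((P ⬝ₛ a) ⇒ₛ (P ⬝ₛ b)) ⬝ₛ u

def pathOver (A P a b p u v : Src) : Src := id j (P ⬝ₛ b) (transport i j A P a b p u) v

def apd (A P h a b p : Src) : Src :=
  J i j A a (lam A fun x => lam (id i A a x) fun q => pathOver i j A P a x q (h ⬝ₛ a) (h ⬝ₛ x))
    (idp j (P ⬝ₛ a) (h ⬝ₛ a)) b p

def transportConst (A B a b p u : Src) : Src :=
  J i j A a
    (lam A fun x => lam (id i A a x) fun q => id j B (transport i j A (lam A fun _ => B) a x q u) u)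
    (idp j B u) b p

def isEquiv (A B f : Src) : Src :=
  prod i
    (sigma i (B ⇒ₛ A) (lam (B ⇒ₛ A) fun g => pi A fun x => id i A (g ⬝ₛ (f ⬝ₛ x)) x))
    (sigma i (B ⇒ₛ A) (lam (B ⇒ₛ A) fun h => pi B fun y => id i B (f ⬝ₛ (h ⬝ₛ y)) y))

def equiv (A B : Src) : Src := sigma i (A ⇒ₛ B) (lam (A ⇒ₛ B) fun f => isEquiv i A B f)

def coe (A B p : Src) : Src :=
  ann (J (i + 1) i (univ i) A
    (lam (univ i) fun X => lam (id (i + 1) (univ i) A X) fun _ => A ⇒ₛ X)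
    (lam A fun a => a) B p) (A ⇒ₛ B)

def coeInv (A B p : Src) : Src :=
  ann (J (i + 1) i (univ i) A
    (lam (univ i) fun X => lam (id (i + 1) (univ i) A X) fun _ => X ⇒ₛ A)
    (lam A fun a => a) B p) (B ⇒ₛ A)

def coeInvCoe (A B p : Src) : Src :=
  J (i + 1) i (univ i) A
    (lam (univ i) fun X => lam (id (i + 1) (univ i) A X) fun q =>
      pi A fun a => id i A (coeInv i A X q ⬝ₛ (coe i A X q ⬝ₛ a)) a)
    (lam A fun a => idp i A a) B p

def coeCoeInv (A B p : Src) : Src :=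
  J (i + 1) i (univ i) A
    (lam (univ i) fun X => lam (id (i + 1) (univ i) A X) fun q =>
      pi X fun b => id i X (coe i A X q ⬝ₛ (coeInv i A X q ⬝ₛ b)) b)
    (lam A fun a => idp i A a) B p

def idToEquiv (A B : Src) : Src :=
  lam (id (i + 1) (univ i) A B) fun p =>
    pair i (A ⇒ₛ B) (lam (A ⇒ₛ B) fun f => isEquiv i A B f) (coe i A B p)
      (pair i
        (sigma i (B ⇒ₛ A)
          (lam (B ⇒ₛ A) fun g => pi A fun x => id i A (g ⬝ₛ (coe i A B p ⬝ₛ x)) x))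
        (lam (sigma i (B ⇒ₛ A)
          (lam (B ⇒ₛ A) fun g => pi A fun x => id i A (g ⬝ₛ (coe i A B p ⬝ₛ x)) x)) fun _ =>
          sigma i (B ⇒ₛ A)
            (lam (B ⇒ₛ A) fun h => pi B fun y => id i B (coe i A B p ⬝ₛ (h ⬝ₛ y)) y))
        (pair i (B ⇒ₛ A)
          (lam (B ⇒ₛ A) fun g => pi A fun x => id i A (g ⬝ₛ (coe i A B p ⬝ₛ x)) x)
          (coeInv i A B p) (coeInvCoe i A B p))
        (pair i (B ⇒ₛ A)
          (lam (B ⇒ₛ A) fun h => pi B fun y => id i B (coe i A B p ⬝ₛ (h ⬝ₛ y)) y)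
          (coeInv i A B p) (coeCoeInv i A B p)))

def pushout (A B C f g : Src) : Src := const .pushout i 0 ⬝ₛ A ⬝ₛ B ⬝ₛ C ⬝ₛ f ⬝ₛ g
def inl (A B C f g : Src) : Src := const .inl i 0 ⬝ₛ A ⬝ₛ B ⬝ₛ C ⬝ₛ f ⬝ₛ g
def inr (A B C f g : Src) : Src := const .inr i 0 ⬝ₛ A ⬝ₛ B ⬝ₛ C ⬝ₛ f ⬝ₛ g
def push (A B C f g : Src) : Src := const .push i 0 ⬝ₛ A ⬝ₛ B ⬝ₛ C ⬝ₛ f ⬝ₛ g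

def pushoutElim (A B C f g P l r p : Src) : Src :=
  const .pushoutElim i j ⬝ₛ A ⬝ₛ B ⬝ₛ C ⬝ₛ f ⬝ₛ g ⬝ₛ P ⬝ₛ l ⬝ₛ r ⬝ₛ p

def pushoutElimPush (A B C f g P l r p : Src) : Src :=
  const .pushoutElimPush i j ⬝ₛ A ⬝ₛ B ⬝ₛ C ⬝ₛ f ⬝ₛ g ⬝ₛ P ⬝ₛ l ⬝ₛ r ⬝ₛ p

def pushoutElimPath (A B C f g P l r : Src) : Src :=
  pi C fun c =>
    pathOver i j (pushout i A B C f g) P (inl i A B C f g ⬝ₛ (f ⬝ₛ c)) (inr i A B C f g ⬝ₛ (g ⬝ₛ c))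
      (push i A B C f g ⬝ₛ c) (l ⬝ₛ (f ⬝ₛ c)) (r ⬝ₛ (g ⬝ₛ c))

def pushoutRec (A B C f g X l r p : Src) : Src :=
  ann (pushoutElim i j A B C f g (lam (pushout i A B C f g) fun _ => X) l r
    (lam C fun c =>
      comp j X
        (transport i j (pushout i A B C f g) (lam (pushout i A B C f g) fun _ => X)
          (inl i A B C f g ⬝ₛ (f ⬝ₛ c)) (inr i A B C f g ⬝ₛ (g ⬝ₛ c)) (push i A B C f g ⬝ₛ c)
          (l ⬝ₛ (f ⬝ₛ c)))
        (l ⬝ₛ (f ⬝ₛ c)) (r ⬝ₛ (g ⬝ₛ c))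
        (transportConst i j (pushout i A B C f g) X
          (inl i A B C f g ⬝ₛ (f ⬝ₛ c)) (inr i A B C f g ⬝ₛ (g ⬝ₛ c)) (push i A B C f g ⬝ₛ c)
          (l ⬝ₛ (f ⬝ₛ c)))
        (p ⬝ₛ c))) (pushout i A B C f g ⇒ₛ X)

/-- The type of a constant. -/
def constType : Const → Src
  | .sigma => pi (univ i) fun A => (A ⇒ₛ univ i) ⇒ₛ univ i
  | .pair =>
      pi (univ i) fun A => pi (A ⇒ₛ univ i) fun B => pi A fun a => (B ⬝ₛ a) ⇒ₛ sigma i A B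
  | .sigmaElim =>
      pi (univ i) fun A => pi (A ⇒ₛ univ i) fun B => pi (sigma i A B ⇒ₛ univ j) fun P =>
      (pi A fun x => pi (B ⬝ₛ x) fun y => P ⬝ₛ pair i A B x y) ⇒ₛ
      pi (sigma i A B) fun z => P ⬝ₛ z
  | .id => pi (univ i) fun A => A ⇒ₛ A ⇒ₛ univ i
  | .idp => pi (univ i) fun A => pi A fun a => id i A a a
  | .J =>
      pi (univ i) fun A => pi A fun a =>
      pi (pi A fun x => id i A a x ⇒ₛ univ j) fun P =>
      (P ⬝ₛ a ⬝ₛ idp i A a) ⇒ₛ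
      pi A fun x => pi (id i A a x) fun p => P ⬝ₛ x ⬝ₛ p
  | .pushout =>
      pi (univ i) fun A => pi (univ i) fun B => pi (univ i) fun C =>
        (C ⇒ₛ A) ⇒ₛ (C ⇒ₛ B) ⇒ₛ univ i
  | .inl =>
      pi (univ i) fun A => pi (univ i) fun B => pi (univ i) fun C =>
      pi (C ⇒ₛ A) fun f => pi (C ⇒ₛ B) fun g => A ⇒ₛ pushout i A B C f g
  | .inr =>
      pi (univ i) fun A => pi (univ i) fun B => pi (univ i) fun C =>
      pi (C ⇒ₛ A) fun f => pi (C ⇒ₛ B) fun g => B ⇒ₛ pushout i A B C f g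
  | .push =>
      pi (univ i) fun A => pi (univ i) fun B => pi (univ i) fun C =>
      pi (C ⇒ₛ A) fun f => pi (C ⇒ₛ B) fun g =>
      pi C fun c =>
        id i (pushout i A B C f g) (inl i A B C f g ⬝ₛ (f ⬝ₛ c)) (inr i A B C f g ⬝ₛ (g ⬝ₛ c))
  | .pushoutElim =>
      pi (univ i) fun A => pi (univ i) fun B => pi (univ i) fun C =>
      pi (C ⇒ₛ A) fun f => pi (C ⇒ₛ B) fun g =>
      pi (pushout i A B C f g ⇒ₛ univ j) fun P =>
      pi (pi A fun a => P ⬝ₛ (inl i A B C f g ⬝ₛ a)) fun l =>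
      pi (pi B fun b => P ⬝ₛ (inr i A B C f g ⬝ₛ b)) fun r =>
      pushoutElimPath i j A B C f g P l r ⇒ₛ
      pi (pushout i A B C f g) fun x => P ⬝ₛ x
  | .pushoutElimPush =>
      pi (univ i) fun A => pi (univ i) fun B => pi (univ i) fun C =>
      pi (C ⇒ₛ A) fun f => pi (C ⇒ₛ B) fun g =>
      pi (pushout i A B C f g ⇒ₛ univ j) fun P =>
      pi (pi A fun a => P ⬝ₛ (inl i A B C f g ⬝ₛ a)) fun l =>
      pi (pi B fun b => P ⬝ₛ (inr i A B C f g ⬝ₛ b)) fun r =>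
      pi (pushoutElimPath i j A B C f g P l r) fun p =>
      pi C fun c =>
        id j
          (pathOver i j (pushout i A B C f g) P (inl i A B C f g ⬝ₛ (f ⬝ₛ c))
            (inr i A B C f g ⬝ₛ (g ⬝ₛ c)) (push i A B C f g ⬝ₛ c) (l ⬝ₛ (f ⬝ₛ c)) (r ⬝ₛ (g ⬝ₛ c)))
          (apd i j (pushout i A B C f g) P (pushoutElim i j A B C f g P l r p)
            (inl i A B C f g ⬝ₛ (f ⬝ₛ c)) (inr i A B C f g ⬝ₛ (g ⬝ₛ c)) (push i A B C f g ⬝ₛ c))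
          (p ⬝ₛ c)
  | .univalence =>
      pi (univ i) fun A => pi (univ i) fun B =>
        -- The checker never inserts cumulativity by itself; `up` moves the type of equivalences to
        -- the universe in which the identity type of `univ i` lies.
        isEquiv (i + 1) (id (i + 1) (univ i) A B) (up (equiv i A B)) (idToEquiv i A B)

/-! #### The statement -/

def comp₃ (A a b c d p q r : Src) : Src := comp 0 A a c d (comp 0 A a b c p q) r

def pushoutMap (A B C f g A' B' C' f' g' u v w s t : Src) : Src :=
  pushoutRec 0 0 A B C f g (pushout 0 A' B' C' f' g')
    (lam A fun a => inl 0 A' B' C' f' g' ⬝ₛ (u ⬝ₛ a))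
    (lam B fun b => inr 0 A' B' C' f' g' ⬝ₛ (v ⬝ₛ b))
    (lam C fun c =>
      comp₃ (pushout 0 A' B' C' f' g')
        (inl 0 A' B' C' f' g' ⬝ₛ (u ⬝ₛ (f ⬝ₛ c)))
        (inl 0 A' B' C' f' g' ⬝ₛ (f' ⬝ₛ (w ⬝ₛ c)))
        (inr 0 A' B' C' f' g' ⬝ₛ (g' ⬝ₛ (w ⬝ₛ c)))
        (inr 0 A' B' C' f' g' ⬝ₛ (v ⬝ₛ (g ⬝ₛ c)))
        (ap 0 0 A' (pushout 0 A' B' C' f' g') (inl 0 A' B' C' f' g')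
          (u ⬝ₛ (f ⬝ₛ c)) (f' ⬝ₛ (w ⬝ₛ c)) (s ⬝ₛ c))
        (push 0 A' B' C' f' g' ⬝ₛ (w ⬝ₛ c))
        (inv 0 (pushout 0 A' B' C' f' g')
          (inr 0 A' B' C' f' g' ⬝ₛ (v ⬝ₛ (g ⬝ₛ c))) (inr 0 A' B' C' f' g' ⬝ₛ (g' ⬝ₛ (w ⬝ₛ c)))
          (ap 0 0 B' (pushout 0 A' B' C' f' g') (inr 0 A' B' C' f' g')
            (v ⬝ₛ (g ⬝ₛ c)) (g' ⬝ₛ (w ⬝ₛ c)) (t ⬝ₛ c))))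

def homotopyInv (C X : Src) (k k' : Src → Src) (h : Src) : Src :=
  lam C fun c => inv 0 X (k c) (k' c) (h ⬝ₛ c)

def columnsFirst (A00 A02 A04 A20 A22 A24 A40 A42 A44
    f01 f03 f10 f12 f14 f21 f23 f30 f32 f34 f41 f43 H11 H13 H31 H33 : Src) : Src :=
  pushout 0 (pushout 0 A00 A40 A20 f10 f30) (pushout 0 A04 A44 A24 f14 f34) (pushout 0 A02 A42 A22 f12 f32)
    (pushoutMap A02 A42 A22 f12 f32 A00 A40 A20 f10 f30 f01 f41 f21 H11 H31)
    (pushoutMap A02 A42 A22 f12 f32 A04 A44 A24 f14 f34 f03 f43 f23 H13 H33)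

def rowsFirst (A00 A02 A04 A20 A22 A24 A40 A42 A44
    f01 f03 f10 f12 f14 f21 f23 f30 f32 f34 f41 f43 H11 H13 H31 H33 : Src) : Src :=
  pushout 0 (pushout 0 A00 A04 A02 f01 f03) (pushout 0 A40 A44 A42 f41 f43) (pushout 0 A20 A24 A22 f21 f23)
    (pushoutMap A20 A24 A22 f21 f23 A00 A04 A02 f01 f03 f10 f14 f12
      (homotopyInv A22 A00 (fun x => f01 ⬝ₛ (f12 ⬝ₛ x)) (fun x => f10 ⬝ₛ (f21 ⬝ₛ x)) H11)
      (homotopyInv A22 A04 (fun x => f03 ⬝ₛ (f12 ⬝ₛ x)) (fun x => f14 ⬝ₛ (f23 ⬝ₛ x)) H13))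
    (pushoutMap A20 A24 A22 f21 f23 A40 A44 A42 f41 f43 f30 f34 f32
      (homotopyInv A22 A40 (fun x => f41 ⬝ₛ (f32 ⬝ₛ x)) (fun x => f30 ⬝ₛ (f21 ⬝ₛ x)) H31)
      (homotopyInv A22 A44 (fun x => f43 ⬝ₛ (f32 ⬝ₛ x)) (fun x => f34 ⬝ₛ (f23 ⬝ₛ x)) H33))

/-- Only level 0 is written down, so that the checker deals with numerals. -/
def threeByThree : Src :=
  pi (univ 0) fun A00 => pi (univ 0) fun A02 => pi (univ 0) fun A04 =>
  pi (univ 0) fun A20 => pi (univ 0) fun A22 => pi (univ 0) fun A24 =>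
  pi (univ 0) fun A40 => pi (univ 0) fun A42 => pi (univ 0) fun A44 =>
  pi (A02 ⇒ₛ A00) fun f01 => pi (A02 ⇒ₛ A04) fun f03 =>
  pi (A20 ⇒ₛ A00) fun f10 => pi (A22 ⇒ₛ A02) fun f12 => pi (A24 ⇒ₛ A04) fun f14 =>
  pi (A22 ⇒ₛ A20) fun f21 => pi (A22 ⇒ₛ A24) fun f23 =>
  pi (A20 ⇒ₛ A40) fun f30 => pi (A22 ⇒ₛ A42) fun f32 => pi (A24 ⇒ₛ A44) fun f34 =>
  pi (A42 ⇒ₛ A40) fun f41 => pi (A42 ⇒ₛ A44) fun f43 =>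
  pi (pi A22 fun x => id 0 A00 (f01 ⬝ₛ (f12 ⬝ₛ x)) (f10 ⬝ₛ (f21 ⬝ₛ x))) fun H11 =>
  pi (pi A22 fun x => id 0 A04 (f03 ⬝ₛ (f12 ⬝ₛ x)) (f14 ⬝ₛ (f23 ⬝ₛ x))) fun H13 =>
  pi (pi A22 fun x => id 0 A40 (f41 ⬝ₛ (f32 ⬝ₛ x)) (f30 ⬝ₛ (f21 ⬝ₛ x))) fun H31 =>
  pi (pi A22 fun x => id 0 A44 (f43 ⬝ₛ (f32 ⬝ₛ x)) (f34 ⬝ₛ (f23 ⬝ₛ x))) fun H33 =>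
  equiv 0
    (columnsFirst A00 A02 A04 A20 A22 A24 A40 A42 A44
      f01 f03 f10 f12 f14 f21 f23 f30 f32 f34 f41 f43 H11 H13 H31 H33)
    (rowsFirst A00 A02 A04 A20 A22 A24 A40 A42 A44
      f01 f03 f10 f12 f14 f21 f23 f30 f32 f34 f41 f43 H11 H13 H31 H33)

end Src

/-- The stage at which a constant becomes available in the types of later constants. -/
def Const.rank : Const → ℕ
  | .sigma | .id | .pushout => 0
  | .pair | .idp | .inl | .inr => 1
  | .sigmaElim | .J | .push => 2
  | .pushoutElim => 3
  | .pushoutElimPush => 4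
  | .univalence => 3

/-- The highest universe level at which a constant is used. -/
def Const.maxLevel : Const → ℕ
  | .univalence => 0
  | _ => 1

/-- Whether the constant may be used at stage `n` with universe levels `i` and `j`. -/
def Const.available (n : ℕ) (c : Const) (i j : ℕ) : Bool :=
  Nat.blt c.rank n && (Nat.ble i c.maxLevel && Nat.ble j 1)

namespace Raw

open Code

/-- The level of the universe that the given type is convertible to. -/
noncomputable def asUniv (G : Globals) (T : Option (Code × List Code)) : Option ℕ :=
  match T with
  | some (T, ρ) => match whnf G fuel true T ρ [] with
    | .univ i => some i
    | _ => none
  | none => none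

/-- The type of an application to `a : T`, from the type of the function. -/
noncomputable def appType (G : Globals) (a T F : Code) (ρ : List Code) : Option (Code × List Code) :=
  match F with
  | .pi A B => bif convTest G fuel .any T (close A ρ) then some (B, a :: ρ) else none
  -- A type that is not syntactically a `pi` may become one once the pending substitution is carried
  -- out. No further reduction is attempted.
  | F => match close F ρ with
    | .pi A B => bif convTest G fuel .any T A then some (B, [a]) else none
    | _ => none

/-- The type of an application, from the types of the function and of the argument. -/
noncomputable def appTypes (G : Globals) (a : Code) (F T : Option (Code × List Code)) : Option (Code × List Code) :=
  match F with
  | some (F, ρ) => match T with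
    | some (T, ρ') => appType G a (close T ρ') F ρ
    | none => none
  | none => none

/-- The type of a variable. -/
noncomputable def varType (Γ : List Code) (n : ℕ) : Option Code :=
  List.rec (motive := fun _ => ℕ → Option Code) (fun _ => none)
    (fun A _ ih n => Nat.rec (some A) (fun n _ => ih n) n) Γ n

/-- Type inference; `ok` says which constants may be used. -/
noncomputable def infer (G : Globals) (ok : Const → ℕ → ℕ → Bool) (t : Raw) : List Code → Option (Code × List Code) :=
  Raw.rec (motive := fun _ => List Code → Option (Code × List Code))
    (fun n Γ => match varType Γ n with
      | some A => some (liftAt n.succ 0 A, [])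
      | none => none)
    (fun i _ => some (.univ i.succ, []))
    (fun A _ inferA inferB Γ => match asUniv G (inferA Γ) with
      | some i => match asUniv G (inferB (A.erase :: Γ)) with
        | some j => some (.univ (max i j), [])
        | none => none
      | none => none)
    (fun A _ inferA inferb Γ => match asUniv G (inferA Γ) with
      | some _ => match inferb (A.erase :: Γ) with
        | some (B, ρ) => some (.pi A.erase (close B ρ), [])
        | none => none
      | none => none)
    (fun _ a inferf infera Γ => appTypes G a.erase (inferf Γ) (infera Γ))
    (fun c i j _ => bif ok c i j then some ((Src.constType i j c 0).erase, []) else none)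
    (fun _ A infert inferA Γ => match asUniv G (inferA Γ) with
      | some _ => match infert Γ with
        | some (B, ρ) => bif convTest G fuel .any (close B ρ) A.erase then some (A.erase, []) else none
        | none => none
      | none => none)
    (fun _ inferA Γ => match asUniv G (inferA Γ) with
      | some i => some (.univ i.succ, [])
      | none => none)
    (fun k _ => match G.get k with
      | some (A, _) => some (A, [])
      | none => none) t

/-- Whether `t` has type `A`. -/
noncomputable def check (G : Globals) (ok : Const → ℕ → ℕ → Bool) (t A : Raw) : Bool :=
  (infer G ok (.ann t A) []).isSome

end Raw

end HoTT

namespace HoTT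

open Tm

/-! ### Soundness of the type checker -/

/-- Typable terms contain no variables beyond their context. In particular a term typable in the
empty context is invariant under all substitutions, so that the values of names can be used in any
context without lifting. -/
lemma HasType.subst_eq {Γ : List Tm} {t A : Tm} (h : HasType Γ t A) {σ : ℕ → Tm}
    (hσ : ∀ n < Γ.length, σ n = .var n) : t.subst σ = t := by
  have up {σ : ℕ → Tm} {m : ℕ} (hσ : ∀ n < m, σ n = .var n) : ∀ n < m + 1, upSubst σ n = .var n := by
    rintro (_ | n) hn
    · rfl
    · rw [upSubst_succ, hσ n (by omega)]; rfl
  induction h generalizing σ with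
  | var hn => exact hσ _ (List.getElem?_eq_some_iff.1 hn).1
  | univ => rfl
  | cumul _ ih => exact ih hσ
  | pi _ _ ih₁ ih₂ => exact congrArg₂ Tm.pi (ih₁ hσ) (ih₂ (up hσ))
  | lam _ _ ih₁ ih₂ => exact congrArg₂ Tm.lam (ih₁ hσ) (ih₂ (up hσ))
  | app _ _ ih₁ ih₂ => exact congrArg₂ Tm.app (ih₁ hσ) (ih₂ hσ)
  | const => rfl
  | conv _ _ _ ih => exact ih hσ

lemma HasType.subst_nil {t A : Tm} (h : HasType [] t A) (σ : ℕ → Tm) : t.subst σ = t :=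
  h.subst_eq fun n hn => by simp at hn

lemma HasType.of_nil {t A : Tm} (h : HasType [] t A) (Γ : List Tm) (hA : IsType [] A) : HasType Γ t A := by
  obtain ⟨i, hA⟩ := hA
  have := h.weaken_nil id Γ
  rwa [rename_eq_subst, rename_eq_subst, h.subst_nil, hA.subst_nil] at this

lemma IsType.of_nil {A : Tm} (h : IsType [] A) (Γ : List Tm) : IsType Γ A :=
  h.imp fun i hi => hi.of_nil Γ ⟨i + 1, .univ _ _⟩

lemma Conv.apps {f f' : Tm} (h : Conv f f') (s : List Tm) : Conv (apps f s) (apps f' s) := by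
  induction s generalizing f f' with
  | nil => exact h
  | cons a s ih => exact ih (.app h (.refl a))

namespace Code

/-- The term that a code stands for, given the values of the names. -/
def interp (E : ℕ → Tm) : Code → Tm
  | var n => .var n
  | univ i => .univ i
  | pi A B => .pi (interp E A) (interp E B)
  | lam A b => .lam (interp E A) (interp E b)
  | app f a => .app (interp E f) (interp E a)
  | const c => .const c
  | glob k => E k

/-- All names in the code are below `n`. -/
def Below (n : ℕ) : Code → Prop
  | var _ | univ _ | const _ => True
  | pi A B => Below n A ∧ Below n B
  | lam A b => Below n A ∧ Below n b
  | app f a => Below n f ∧ Below n a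
  | glob k => k < n

lemma interp_congr {E E' : ℕ → Tm} {n : ℕ} (h : ∀ k < n, E k = E' k) {t : Code} (ht : t.Below n) :
    interp E t = interp E' t := by
  induction t with
  | pi A B ih₁ ih₂ => exact congrArg₂ Tm.pi (ih₁ ht.1) (ih₂ ht.2)
  | lam A b ih₁ ih₂ => exact congrArg₂ Tm.lam (ih₁ ht.1) (ih₂ ht.2)
  | app f a ih₁ ih₂ => exact congrArg₂ Tm.app (ih₁ ht.1) (ih₂ ht.2)
  | glob k => exact h k ht
  | _ => rfl

lemma Below.mono {m n : ℕ} (h : m ≤ n) {t : Code} (ht : t.Below m) : t.Below n := by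
  induction t with
  | pi A B ih₁ ih₂ => exact ⟨ih₁ ht.1, ih₂ ht.2⟩
  | lam A b ih₁ ih₂ => exact ⟨ih₁ ht.1, ih₂ ht.2⟩
  | app f a ih₁ ih₂ => exact ⟨ih₁ ht.1, ih₂ ht.2⟩
  | glob k => exact Nat.lt_of_lt_of_le ht h
  | _ => trivial

lemma eq_of_beq {t u : Code} (h : beq t u = true) : t = u := by
  have and {a b : Bool} (h : (Bool.rec (motive := fun _ => Bool) false b a) = true) : a = true ∧ b = true := by
    cases a <;> cases b <;> simp_all
  induction t generalizing u with
  | var n => cases u with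
    | var m => exact congrArg var (Nat.eq_of_beq_eq_true h)
    | _ => cases h
  | univ n => cases u with
    | univ m => exact congrArg univ (Nat.eq_of_beq_eq_true h)
    | _ => cases h
  | pi A B ih₁ ih₂ => cases u with
    | pi => obtain ⟨h₁, h₂⟩ := and h; exact congrArg₂ pi (ih₁ h₁) (ih₂ h₂)
    | _ => cases h
  | lam A B ih₁ ih₂ => cases u with
    | lam => obtain ⟨h₁, h₂⟩ := and h; exact congrArg₂ lam (ih₁ h₁) (ih₂ h₂)
    | _ => cases h
  | app A B ih₁ ih₂ => cases u with
    | app => obtain ⟨h₁, h₂⟩ := and h; exact congrArg₂ app (ih₁ h₁) (ih₂ h₂)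
    | _ => cases h
  | const c => cases u with
    | const d =>
      have : c.ctorIdx = d.ctorIdx := Nat.eq_of_beq_eq_true h
      cases c <;> cases d <;> first | rfl | cases this
    | _ => cases h
  | glob n => cases u with
    | glob m => exact congrArg glob (Nat.eq_of_beq_eq_true h)
    | _ => cases h

variable {E : ℕ → Tm}

lemma interp_apps (f : Code) (s : List Code) :
    interp E (apps f s) = Tm.apps (interp E f) (s.map (interp E)) := by
  induction s generalizing f with
  | nil => rfl
  | cons a s ih => exact ih (app f a)

/-- The values of the names are closed. -/
def Closed (E : ℕ → Tm) : Prop := ∀ k σ, (E k).subst σ = E k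

/-- The code leaves names untouched, which agrees with renaming because their values are closed. -/
lemma interp_liftAt (hE : Closed E) (k c : ℕ) (t : Code) :
    interp E (liftAt k c t) = (interp E t).rename fun n => if c ≤ n then n + k else n := by
  have up (c : ℕ) : upRen (fun n => if c ≤ n then n + k else n) = fun n => if c + 1 ≤ n then n + k else n := by
    funext n
    rcases n with _ | n
    · simp
    · by_cases h : c ≤ n <;> simp [h]; omega
  induction t generalizing c with
  | var n =>
    by_cases h : c ≤ n
    · have : Nat.ble c n = true := Nat.ble_eq_true_of_le h
      simp [liftAt, interp, Tm.rename, this, h]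
    · have : Nat.ble c n = false := by simpa [← Nat.ble_eq] using h
      simp [liftAt, interp, Tm.rename, this, h]
  | pi A B ih₁ ih₂ =>
    exact congrArg₂ Tm.pi (ih₁ c) ((ih₂ (c + 1)).trans (by rw [up]))
  | lam A b ih₁ ih₂ =>
    exact congrArg₂ Tm.lam (ih₁ c) ((ih₂ (c + 1)).trans (by rw [up]))
  | app f a ih₁ ih₂ => exact congrArg₂ Tm.app (ih₁ c) (ih₂ c)
  | glob k =>
    rw [rename_eq_subst]
    exact (hE k _).symm
  | _ => rfl

lemma interp_lift (hE : Closed E) (k : ℕ) (t : Code) : interp E (liftAt k 0 t) = (interp E t).lift k := by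
  simp [interp_liftAt hE, Tm.lift]

lemma interp_lookupSubst (hE : Closed E) (ρ : List Code) (k n : ℕ) :
    interp E (lookupSubst k ρ n) = (interp E (lookupSubst 0 ρ n)).lift k := by
  induction ρ generalizing n with
  | nil => rfl
  | cons a ρ ih => cases n with
    | zero =>
      cases k with
      | zero => exact (lift_zero _).symm
      | succ k => exact interp_lift hE _ _
    | succ n => exact ih n

/-- The substitution given by a list of values. -/
noncomputable def substOf (E : ℕ → Tm) (ρ : List Code) (n : ℕ) : Tm := interp E (lookupSubst 0 ρ n)

lemma substOf_nil : substOf E [] = .var := rfl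

lemma interp_msub (hE : Closed E) (ρ : List Code) (k : ℕ) (t : Code) :
    interp E (msub ρ k t) = (interp E t).subst (upSubst^[k] (substOf E ρ)) := by
  induction t generalizing k with
  | var n =>
    have (k n : ℕ) : upSubst^[k] (substOf E ρ) n =
        if k ≤ n then (substOf E ρ (n - k)).lift k else .var n := by
      induction k generalizing n with
      | zero => simp [lift_zero]
      | succ k ih =>
        rw [Function.iterate_succ_apply']
        cases n with
        | zero => simp
        | succ n =>
          rw [upSubst_succ, ih]
          by_cases h : k ≤ n <;> simp [h, lift_lift]
          rfl
    change _ = upSubst^[k] (substOf E ρ) n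
    rw [this]
    by_cases h : k ≤ n
    · have h' : Nat.ble k n = true := Nat.ble_eq_true_of_le h
      rw [if_pos h, substOf, ← interp_lookupSubst hE]
      simp [msub, h']
    · have h' : Nat.ble k n = false := by simpa [← Nat.ble_eq] using h
      simp [msub, interp, h, h']
  | pi A B ih₁ ih₂ =>
    exact congrArg₂ Tm.pi (ih₁ k) ((ih₂ (k + 1)).trans (by rw [Function.iterate_succ_apply']))
  | lam A b ih₁ ih₂ =>
    exact congrArg₂ Tm.lam (ih₁ k) ((ih₂ (k + 1)).trans (by rw [Function.iterate_succ_apply']))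
  | app f a ih₁ ih₂ => exact congrArg₂ Tm.app (ih₁ k) (ih₂ k)
  | glob m => exact (hE m _).symm
  | _ => rfl

lemma interp_close (hE : Closed E) (t : Code) (ρ : List Code) :
    interp E (close t ρ) = (interp E t).subst (substOf E ρ) := by
  cases ρ with
  | nil => exact (subst_var _).symm
  | cons a ρ => exact interp_msub hE (a :: ρ) 0 t

/-- A β-step amounts to pushing the argument onto the list of values. The machine uses this for
abstractions, and type inference uses it for the codomain of a function type. -/
lemma inst_upSubst_substOf (ρ : List Code) (a : Code) (t : Tm) :
    Tm.inst (t.subst (upSubst (substOf E ρ))) (interp E a) = t.subst (substOf E (a :: ρ)) := by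
  rw [inst_eq, subst_subst]
  congr 1; funext n
  cases n with
  | zero => rfl
  | succ n => rw [upSubst_succ, ← inst_eq, inst_lift]; rfl

lemma _root_.HoTT.Globals.get_eq (G : Globals) (k : ℕ) : G.get k = G[k]? := by
  induction G generalizing k with
  | nil => rfl
  | cons A G ih => cases k with
    | zero => rfl
    | succ k => exact ih k

/-- The values of the names are closed terms as declared. -/
structure Valid (G : Globals) (E : ℕ → Tm) : Prop where
  closed : Closed E
  type {k : ℕ} {T : Code} {v : Option Code} :
    G[k]? = some (T, v) → HasType [] (E k) (interp E T) ∧ IsType [] (interp E T) ∧ T.Below G.length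
  value {k : ℕ} {T v : Code} : G[k]? = some (T, some v) → E k = interp E v ∧ v.Below G.length

lemma eq_of_asPair {t a b : Code} (h : asPair t = some (a, b)) :
    ∃ A B, t = apps (const .pair) [A, B, a, b] := by
  unfold asPair at h
  split at h <;> cases h
  exact ⟨_, _, rfl⟩

lemma eq_of_isIdp {t : Code} (h : isIdp t = true) : ∃ A a, t = apps (const .idp) [A, a] := by
  unfold isIdp at h
  split at h <;> cases h
  exact ⟨_, _, rfl⟩

lemma eq_of_asPoint {t a : Code} {i : Bool} (h : asPoint t = some (i, a)) :
    ∃ A B C f g, t = apps (const (bif i then .inl else .inr)) [A, B, C, f, g, a] := by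
  unfold asPoint at h
  split at h <;> cases h <;> exact ⟨_, _, _, _, _, rfl⟩

lemma conv_whnfConst {w w' : Code → List Code → List Code → Code}
    (hw : ∀ t, Conv (interp E t) (interp E (w t [] [])))
    (hw' : ∀ t s, Conv (Tm.apps (interp E t) (s.map (interp E))) (interp E (w' t [] s)))
    (c : Const) (s : List Code) :
    Conv (Tm.apps (.const c) (s.map (interp E))) (interp E (whnfConst w w' c s)) := by
  have fallback (c : Const) (s : List Code) :
      Conv (Tm.apps (.const c) (s.map (interp E))) (interp E (apps (const c) s)) := by
    rw [interp_apps]; exact .refl _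
  unfold whnfConst
  split
  · rename_i A B P d z s
    split
    · rename_i a b h
      obtain ⟨A', B', h⟩ := eq_of_asPair h
      refine .trans (Conv.apps (f := Tm.apps (.const .sigmaElim) ([A, B, P, d, z].map (interp E))) ?_ (s.map (interp E))) (hw' d (a :: b :: s))
      refine .trans (.app (.refl _) (hw z)) ?_
      rw [h]
      exact .sigmaElim ..
    · exact fallback _ _
  · rename_i A a P d x p s
    cases h : isIdp (w p [] []) with
    | false => exact fallback _ _
    | true =>
      obtain ⟨A', a', h⟩ := eq_of_isIdp h
      refine .trans (Conv.apps (f := Tm.apps (.const .J) ([A, a, P, d, x, p].map (interp E))) ?_ (s.map (interp E))) (hw' d s)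
      refine .trans (.app (.refl _) (hw p)) ?_
      rw [h]
      exact .J ..
  · rename_i A B C f g P l r p z s
    split
    · rename_i a h
      obtain ⟨A', B', C', f', g', h⟩ := eq_of_asPoint h
      refine .trans (Conv.apps (f := Tm.apps (.const .pushoutElim) ([A, B, C, f, g, P, l, r, p, z].map (interp E))) ?_ (s.map (interp E))) (hw' l (a :: s))
      refine .trans (.app (.refl _) (hw z)) ?_
      rw [h]
      exact .pushoutInl ..
    · rename_i a h
      obtain ⟨A', B', C', f', g', h⟩ := eq_of_asPoint h
      refine .trans (Conv.apps (f := Tm.apps (.const .pushoutElim) ([A, B, C, f, g, P, l, r, p, z].map (interp E))) ?_ (s.map (interp E))) (hw' r (a :: s))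
      refine .trans (.app (.refl _) (hw z)) ?_
      rw [h]
      exact .pushoutInr ..
    · exact fallback _ _
  · exact fallback _ _

/-- Each transition of the machine is a substitution bookkeeping step, a β-step, a computation rule,
or the replacement of a name by a value with the same interpretation. Nothing is claimed about the
result being normal. -/
theorem conv_whnf {G : Globals} (hG : Valid G E) (n : ℕ) (e : Bool) (t : Code) (ρ s : List Code) :
    Conv (Tm.apps ((interp E t).subst (substOf E ρ)) (s.map (interp E))) (interp E (whnf G n e t ρ s)) := by
  have hE := hG.closed
  induction n generalizing e t ρ s with
  | zero =>
    change Conv _ (interp E (apps (close t ρ) s))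
    rw [interp_apps, interp_close hE]; exact .refl _
  | succ n ihn =>
    have nil (e : Bool) (t : Code) (s : List Code) := subst_var (interp E t) ▸ ihn e t [] s
    induction t generalizing ρ s with
    | var m =>
      cases ρ with
      | nil =>
        change Conv _ (interp E (apps (var m) s))
        rw [interp_apps]; exact .refl _
      | cons a ρ => exact nil e (lookupSubst 0 (a :: ρ) m) s
    | univ i =>
      change Conv _ (interp E (apps (univ i) s))
      rw [interp_apps]; exact .refl _
    | pi A B =>
      change Conv _ (interp E (apps (close (pi A B) ρ) s))
      rw [interp_apps, interp_close hE]; exact .refl _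
    | lam A b =>
      cases s with
      | nil =>
        change Conv _ (interp E (close (lam A b) ρ))
        rw [interp_close hE]; exact .refl _
      | cons a s =>
        refine .trans (.apps (f := .app _ _) ?_ (s.map (interp E))) (ihn e b (a :: ρ) s)
        rw [← inst_upSubst_substOf]
        exact .beta _ _ _
    | app f a =>
      have := ihn e f ρ (close a ρ :: s)
      rw [List.map_cons, interp_close hE] at this
      exact this
    | const c => exact conv_whnfConst (fun t => nil true t []) (nil e) c s
    | glob k =>
      change Conv (Tm.apps ((E k).subst _) _) (interp E (bif bif e then true else Nat.blt k eagerBound then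
        match G.get k with
        | some (_, some v) => whnf G n e v [] s
        | _ => apps (glob k) s else apps (glob k) s))
      rw [hE]
      have fallback : Conv (Tm.apps (E k) (s.map (interp E))) (interp E (apps (glob k) s)) := by
        rw [interp_apps]; exact .refl _
      cases bif e then true else Nat.blt k eagerBound with
      | false => exact fallback
      | true =>
        simp only [cond_true, Globals.get_eq]
        split
        · rename_i h
          rw [(hG.value h).1]
          exact nil e _ s
        · exact fallback

lemma conv_whnf_nil {G : Globals} (hG : Valid G E) (n : ℕ) (e : Bool) (t : Code) :
    Conv (interp E t) (interp E (whnf G n e t [] [])) := by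
  have := conv_whnf hG n e t [] []
  rwa [substOf_nil, subst_var] at this

lemma conv_unfoldHead {G : Globals} (hG : Valid G E) (t : Code) :
    interp E (unfoldHead G t) = interp E t := by
  induction t with
  | app f a ih => exact congrArg (Tm.app · _) ih
  | glob k =>
    change interp E (match G.get k with
      | some (_, some v) => v
      | _ => glob k) = E k
    simp only [Globals.get_eq]
    split
    · rename_i h
      exact (hG.value h).1.symm
    · rfl
  | _ => rfl

lemma eq_true_of_cond {a b : Bool} (h : (bif a then b else false) = true) : a = true ∧ b = true := by
  cases a <;> simp_all

lemma conv_eta {u b A : Code} (hE : Closed E)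
    (h : Conv (interp E b) (interp E (app (liftAt 1 0 u) (var 0)))) :
    Conv (interp E (lam A b)) (interp E u) := by
  refine .trans (.lam (.refl _) h) ?_
  have := Conv.eta (interp E A) (interp E u)
  rwa [← interp_lift hE] at this

lemma conv_convStep {c : Mode → Code → Code → Bool} (hE : Closed E)
    (hc : ∀ m t u, c m t u = true → Conv (interp E t) (interp E u)) {t u : Code}
    (h : convStep c t u = true) : Conv (interp E t) (interp E u) := by
  unfold convStep at h
  split at h
  · exact .trans (.lam (.refl _) (hc _ _ _ h)) (Conv.lam_annotation _ _ _)
  · exact conv_eta hE (hc _ _ _ h)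
  · exact (conv_eta hE (hc _ _ _ h).symm).symm
  · exact .pi (hc _ _ _ (eq_true_of_cond h).1) (hc _ _ _ (eq_true_of_cond h).2)
  · exact .app (hc _ _ _ (eq_true_of_cond h).1) (hc _ _ _ (eq_true_of_cond h).2)
  · exact eq_of_beq h ▸ .refl _

lemma conv_spineStep {c : Mode → Code → Code → Bool}
    (hc : ∀ m t u, c m t u = true → Conv (interp E t) (interp E u)) {t u : Code}
    (h : spineStep c t u = true) : Conv (interp E t) (interp E u) := by
  unfold spineStep at h
  split at h
  · exact .app (hc _ _ _ (eq_true_of_cond h).1) (hc _ _ _ (eq_true_of_cond h).2)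
  · exact eq_of_beq h ▸ .refl _

lemma conv_headStep {G : Globals} (hG : Valid G E) {c : Mode → Code → Code → Bool}
    (hc : ∀ m t u, c m t u = true → Conv (interp E t) (interp E u)) {t u : Code}
    (h : headStep G c t u = true) : Conv (interp E t) (interp E u) := by
  have red (t : Code) : Conv (interp E t) (interp E (whnf G fuel false (unfoldHead G t) [] [])) :=
    conv_unfoldHead hG t ▸ conv_whnf_nil hG _ _ _
  unfold headStep at h
  cases h₁ : Nat.beq (rank G t) (rank G u) <;> rw [h₁] at h
  · cases h₂ : Nat.blt (rank G t) (rank G u) <;> rw [h₂] at h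
    · exact (red t).trans (hc _ _ _ h)
    · exact (hc _ _ _ h).trans (red u).symm
  · cases h₂ : convStep c t u <;> rw [h₂] at h
    · cases h₃ : Nat.beq (rank G t) 0 <;> rw [h₃] at h
      · exact (red t).trans ((hc _ _ _ h).trans (red u).symm)
      · cases h
    · exact conv_convStep hG.closed hc h₂

lemma conv_anyStep {G : Globals} (hG : Valid G E) {c : Mode → Code → Code → Bool}
    (hc : ∀ m t u, c m t u = true → Conv (interp E t) (interp E u)) {t u : Code}
    (h : anyStep G c t u = true) : Conv (interp E t) (interp E u) := by
  unfold anyStep at h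
  cases h₁ : beq t u <;> rw [h₁] at h
  · cases h₂ : bif sameHead t u then convStep c t u else false <;> rw [h₂] at h
    · exact (conv_whnf_nil hG _ _ t).trans ((hc _ _ _ h).trans (conv_whnf_nil hG _ _ u).symm)
    · exact conv_convStep hG.closed hc (eq_true_of_cond h₂).2
  · exact eq_of_beq h₁ ▸ .refl _

/-- All three modes are treated together by induction on the fuel: each step only combines positive
answers obtained with less fuel with reductions known to be conversions. -/
theorem conv_of_convTest {G : Globals} (hG : Valid G E) (n : ℕ) (m : Mode) (t u : Code)
    (h : convTest G n m t u = true) : Conv (interp E t) (interp E u) := by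
  induction n generalizing m t u with
  | zero => exact eq_of_beq h ▸ .refl _
  | succ n ih => cases m with
    | any => exact conv_anyStep hG ih h
    | head => exact conv_headStep hG ih h
    | spine => exact conv_spineStep ih h

end Code

namespace Raw

open Code

variable {G : Globals} {E : ℕ → Tm} {ok : Const → ℕ → ℕ → Bool}

/-- The constants that may be used have well-formed types. -/
def Sound (ok : Const → ℕ → ℕ → Bool) : Prop := ∀ c i j, ok c i j = true → IsType [] (Exp.constType i j c 0)

lemma interp_constType (i j : ℕ) (c : Const) :
    interp E (Src.constType i j c 0).erase = Exp.constType i j c 0 := by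
  cases c <;> rfl

lemma hasType_of_asUniv (hG : Valid G E) {Γ : List Tm} {A : Tm} {T : Option (Code × List Code)} {i : ℕ}
    (h : asUniv G T = some i)
    (hA : ∀ T' ρ, T = some (T', ρ) → HasType Γ A (interp E (close T' ρ))) : HasType Γ A (.univ i) := by
  unfold asUniv at h
  split at h
  · rename_i T' ρ
    split at h <;> cases h
    rename_i h
    refine .conv (hA T' ρ rfl) ?_ (.univ Γ i)
    have := conv_whnf hG fuel true T' ρ []
    rwa [h, ← interp_close hG.closed] at this
  · cases h

/-- Since the function type is well formed and literally a `pi`, inversion shows that its domain is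
a type; this is the premise that lets the argument be converted to it. -/
lemma hasType_of_appTypes (hG : Valid G E) {Γ : List Tm} {f : Tm} {a : Code}
    {F T : Option (Code × List Code)} {B : Code} {ρ : List Code} (h : appTypes G a F T = some (B, ρ))
    (hf : ∀ F' ρ, F = some (F', ρ) →
      HasType Γ f (interp E (close F' ρ)) ∧ IsType Γ (interp E (close F' ρ)))
    (ha : ∀ T' ρ, T = some (T', ρ) → HasType Γ (interp E a) (interp E (close T' ρ))) :
    HasType Γ (.app f (interp E a)) (interp E (close B ρ)) ∧ IsType Γ (interp E (close B ρ)) := by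
  have main {A : Tm} {B : Code} {ρ : List Code} {T' : Code} {ρ' : List Code} (hT : T = some (T', ρ'))
      (hf : HasType Γ f (.pi A ((interp E B).subst (upSubst (substOf E ρ)))))
      (hF : IsType Γ (.pi A ((interp E B).subst (upSubst (substOf E ρ)))))
      (hA : Conv (interp E (close T' ρ')) A) :
      HasType Γ (.app f (interp E a)) (interp E (close B (a :: ρ))) ∧
        IsType Γ (interp E (close B (a :: ρ))) := by
    obtain ⟨_, hF⟩ := hF
    obtain ⟨i, h₁, h₂⟩ := hF.of_pi
    have ha := (ha _ _ hT).conv hA h₁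
    rw [interp_close hG.closed, ← inst_upSubst_substOf]
    exact ⟨hf.app ha, i, h₂.inst ha⟩
  unfold appTypes at h
  split at h
  · rename_i F' ρF
    replace ⟨hf, i, hF⟩ := hf _ _ rfl
    split at h
    · rename_i T' ρ'
      unfold appType at h
      split at h
      · rename_i A B'
        cases h₁ : convTest G fuel .any (close T' ρ') (close A ρF) <;> simp only [h₁] at h <;> cases h
        rw [interp_close hG.closed] at hf hF
        refine main rfl hf ⟨i, hF⟩ ?_
        have := conv_of_convTest hG _ _ _ _ h₁
        rwa [interp_close hG.closed A] at this
      · split at h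
        · rename_i A B' h₂
          cases h₁ : convTest G fuel .any (close T' ρ') A <;> simp only [h₁] at h <;> cases h
          rw [h₂] at hf hF
          refine main rfl (ρ := []) ?_ ?_ (conv_of_convTest hG _ _ _ _ h₁) <;>
            rw [substOf_nil, upSubst_var, subst_var]
          exacts [hf, ⟨i, hF⟩]
        · cases h
    · cases h
  · cases h

lemma varType_eq (Γ : List Code) (n : ℕ) : varType Γ n = Γ[n]? := by
  induction Γ generalizing n with
  | nil => rfl
  | cons A Γ ih => cases n with
    | zero => rfl
    | succ n => exact ih n

/-- Well-formedness of the inferred type is proved along with typing: the application case needs it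
to invert the function type, and the abstraction case to form the new one. -/
theorem hasType_of_infer (hG : Valid G E) (hok : Sound ok)
    (t : Raw) {Γ : List Code} (hΓ : WellFormed (Γ.map (interp E))) {T : Code} {ρ : List Code}
    (h : infer G ok t Γ = some (T, ρ)) :
    HasType (Γ.map (interp E)) (interp E t.erase) (interp E (close T ρ)) ∧
      IsType (Γ.map (interp E)) (interp E (close T ρ)) := by
  have univ (Γ : List Tm) (i : ℕ) : IsType Γ (.univ i) := ⟨i + 1, .univ _ _⟩
  induction t generalizing Γ T ρ with
  | var n =>
    change (match varType Γ n with
      | some A => some (liftAt n.succ 0 A, [])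
      | none => none) = _ at h
    rw [varType_eq] at h
    split at h <;> cases h
    rename_i A hA
    have hA : (Γ.map (interp E))[n]? = some (interp E A) := by simp [hA]
    rw [close, interp_lift hG.closed]
    exact ⟨.var hA, hΓ n _ hA⟩
  | univ i => cases h; exact ⟨.univ _ _, univ _ _⟩
  | pi A B ihA ihB =>
    change (match asUniv G (infer G ok A Γ) with
      | some i => match asUniv G (infer G ok B (A.erase :: Γ)) with
        | some j => some (Code.univ (max i j), [])
        | none => none
      | none => none) = _ at h
    split at h
    · rename_i i hi
      have hA := hasType_of_asUniv hG hi fun _ _ h => (ihA hΓ h).1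
      split at h <;> cases h
      rename_i j hj
      have hB := hasType_of_asUniv hG hj fun _ _ h => (ihB (Γ := A.erase :: Γ) (hΓ.cons ⟨i, hA⟩) h).1
      exact ⟨.pi (hA.cumul_le (le_max_left i j)) (hB.cumul_le (le_max_right i j)), univ _ _⟩
    · cases h
  | lam A b ihA ihb =>
    change (match asUniv G (infer G ok A Γ) with
      | some _ => match infer G ok b (A.erase :: Γ) with
        | some (B, ρ) => some (Code.pi A.erase (close B ρ), [])
        | none => none
      | none => none) = _ at h
    split at h
    · rename_i i hi
      have hA := hasType_of_asUniv hG hi fun _ _ h => (ihA hΓ h).1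
      split at h <;> cases h
      rename_i B ρ hB
      obtain ⟨hb, j, hB⟩ := ihb (Γ := A.erase :: Γ) (hΓ.cons ⟨i, hA⟩) hB
      exact ⟨.lam hA hb, max i j, .pi (hA.cumul_le (le_max_left i j)) (hB.cumul_le (le_max_right i j))⟩
    · cases h
  | app f a ihf iha =>
    exact hasType_of_appTypes hG h (fun _ _ h => ihf hΓ h) fun _ _ h => (iha hΓ h).1
  | const c i j =>
    change (bif ok c i j then some ((Src.constType i j c 0).erase, []) else none) = _ at h
    cases hc : ok c i j <;> rw [hc] at h <;> cases h
    rw [close, interp_constType]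
    exact ⟨.const _ c i j, (hok c i j hc).of_nil _⟩
  | ann t A iht ihA =>
    change (match asUniv G (infer G ok A Γ) with
      | some _ => match infer G ok t Γ with
        | some (B, ρ) => bif convTest G fuel .any (close B ρ) A.erase then some (A.erase, []) else none
        | none => none
      | none => none) = _ at h
    split at h
    · rename_i i hi
      have hA := hasType_of_asUniv hG hi fun _ _ h => (ihA hΓ h).1
      split at h
      · rename_i B ρ hB
        cases hc : convTest G fuel .any (close B ρ) A.erase <;> simp only [hc] at h <;> cases h
        exact ⟨(iht hΓ hB).1.conv (conv_of_convTest hG _ _ _ _ hc) hA, i, hA⟩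
      · cases h
    · cases h
  | up A ihA =>
    change (match asUniv G (infer G ok A Γ) with
      | some i => some (Code.univ i.succ, [])
      | none => none) = _ at h
    split at h <;> cases h
    rename_i i hi
    exact ⟨(hasType_of_asUniv hG hi fun _ _ h => (ihA hΓ h).1).cumul, univ _ _⟩
  | glob k =>
    change (match G.get k with
      | some (A, _) => some (A, [])
      | none => none) = _ at h
    rw [Globals.get_eq] at h
    split at h <;> cases h
    rename_i hk
    obtain ⟨h₁, h₂, -⟩ := hG.type hk
    exact ⟨h₁.of_nil _ h₂, h₂.of_nil _⟩

/-- Inference fails at a name that is not yet declared, so success bounds all names that occur.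
Hence interpretations do not change when further names receive values. -/
lemma below_of_infer (t : Raw) {Γ : List Code} (h : (infer G ok t Γ).isSome = true) :
    t.erase.Below G.length := by
  have hT {T : Option (Code × List Code)} {i : ℕ} (h : asUniv G T = some i) : T.isSome = true := by
    cases T with
    | none => cases h
    | some => rfl
  induction t generalizing Γ with
  | pi A B ihA ihB =>
    change Option.isSome (match asUniv G (infer G ok A Γ) with
      | some i => match asUniv G (infer G ok B (A.erase :: Γ)) with
        | some j => some (Code.univ (max i j), [])
        | none => none
      | none => none) = true at h
    split at h
    · rename_i i hi
      split at h
      · rename_i j hj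
        exact ⟨ihA (hT hi), ihB (hT hj)⟩
      · cases h
    · cases h
  | lam A b ihA ihb =>
    change Option.isSome (match asUniv G (infer G ok A Γ) with
      | some _ => match infer G ok b (A.erase :: Γ) with
        | some (B, ρ) => some (Code.pi A.erase (close B ρ), [])
        | none => none
      | none => none) = true at h
    split at h
    · rename_i i hi
      split at h
      · rename_i B ρ hB
        exact ⟨ihA (hT hi), ihb (Option.isSome_of_eq_some hB)⟩
      · cases h
    · cases h
  | app f a ihf iha =>
    change Option.isSome (appTypes G a.erase (infer G ok f Γ) (infer G ok a Γ)) = true at h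
    unfold appTypes at h
    split at h
    · rename_i F ρ hF
      split at h
      · rename_i T ρ' hT
        exact ⟨ihf (Option.isSome_of_eq_some hF), iha (Option.isSome_of_eq_some hT)⟩
      · cases h
    · cases h
  | ann t A iht ihA =>
    change Option.isSome (match asUniv G (infer G ok A Γ) with
      | some _ => match infer G ok t Γ with
        | some (B, ρ) => bif convTest G fuel .any (close B ρ) A.erase then some (A.erase, []) else none
        | none => none
      | none => none) = true at h
    split at h
    · split at h
      · rename_i B ρ hB
        exact iht (Option.isSome_of_eq_some hB)
      · cases h
    · cases h
  | up A ihA =>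
    change Option.isSome (match asUniv G (infer G ok A Γ) with
      | some i => some (Code.univ i.succ, [])
      | none => none) = true at h
    split at h
    · rename_i i hi
      exact ihA (hT hi)
    · cases h
  | glob k =>
    change Option.isSome (match G.get k with
      | some (A, _) => some (A, [])
      | none => none) = true at h
    rw [Globals.get_eq] at h
    split at h
    · rename_i hk
      exact (List.getElem?_eq_some_iff.1 hk).1
    · cases h
  | _ => trivial

/-- A term and a type that pass the check. -/
theorem hasType_of_check (hG : Valid G E) (hok : Sound ok) {t A : Raw} (h : check G ok t A = true) :
    HasType [] (interp E t.erase) (interp E A.erase) ∧ IsType [] (interp E A.erase) ∧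
      t.erase.Below G.length ∧ A.erase.Below G.length := by
  unfold check at h
  have ht := below_of_infer _ h
  change Option.isSome (match asUniv G (infer G ok A []) with
      | some _ => match infer G ok t [] with
        | some (B, ρ) => bif convTest G fuel .any (close B ρ) A.erase then some (A.erase, []) else none
        | none => none
      | none => none) = true at h
  split at h
  · rename_i i hi
    have hA : A.erase.Below G.length := by
      refine below_of_infer (ok := ok) (Γ := []) A ?_
      cases hA : infer G ok A [] with
      | none => rw [hA] at hi; cases hi
      | some => rfl
    have hA' := hasType_of_asUniv hG hi fun _ _ h => (hasType_of_infer hG hok A (Γ := []) .nil h).1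
    split at h
    · rename_i B ρ hB
      cases hc : convTest G fuel .any (close B ρ) A.erase <;> simp only [hc] at h
      · cases h
      exact ⟨(hasType_of_infer hG hok t (Γ := []) .nil hB).1.conv (conv_of_convTest hG _ _ _ _ hc) hA', ⟨i, hA'⟩, ht, hA⟩
    · cases h
  · cases h

/-- The names have the given types and values for some choice of closed terms. -/
def _root_.HoTT.Globals.Realizable (G : Globals) : Prop := ∃ E, Valid G E

lemma realizable_nil : Globals.Realizable [] :=
  ⟨fun _ => .univ 0, fun _ _ => rfl, fun h => by simp at h, fun h => by simp at h⟩

/-- The new name is given the interpretation of its term. Earlier types and values mention only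
earlier names, so their interpretations are unaffected. If the name is declared without a value,
only its type is remembered. -/
lemma realizable_append (hG : G.Realizable) (hok : Sound ok) {t A : Raw} (h : check G ok t A = true)
    {v : Option Code} (hv : ∀ u, v = some u → u = t.erase) : Globals.Realizable (G ++ [(A.erase, v)]) := by
  obtain ⟨E, hG⟩ := hG
  obtain ⟨ht, ⟨i, hA⟩, bt, bA⟩ := hasType_of_check hG hok h
  let E' : ℕ → Tm := Function.update E G.length (interp E t.erase)
  have hE' {t : Code} (ht : t.Below G.length) : interp E' t = interp E t :=
    interp_congr (fun k hk => Function.update_of_ne (Nat.ne_of_lt hk) _ _) ht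
  have self : E' G.length = interp E t.erase := Function.update_self ..
  have ne {k : ℕ} (hk : k ≠ G.length) : E' k = E k := Function.update_of_ne hk _ _
  have hlen : G.length ≤ (G ++ [(A.erase, v)]).length := by simp
  have get {k : ℕ} {x : Code × Option Code} (h : (G ++ [(A.erase, v)])[k]? = some x) :
      (k ≠ G.length ∧ G[k]? = some x) ∨ (k = G.length ∧ (A.erase, v) = x) := by
    rcases lt_trichotomy k G.length with hk | hk | hk
    · exact .inl ⟨hk.ne, by rwa [List.getElem?_append_left hk] at h⟩
    · subst hk; exact .inr ⟨rfl, by simpa using h⟩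
    · rw [List.getElem?_eq_none (by simpa using hk)] at h; cases h
  refine ⟨E', fun k σ => ?_, fun {k T v} hk => ?_, fun {k T v} hk => ?_⟩
  · by_cases hk : k = G.length
    · rw [hk, self, ht.subst_nil]
    · rw [ne hk, hG.closed]
  · rcases get hk with ⟨hk, h⟩ | ⟨rfl, h⟩
    · obtain ⟨h₁, h₂, h₃⟩ := hG.type h
      rw [ne hk, hE' h₃]
      exact ⟨h₁, h₂, h₃.mono hlen⟩
    · cases h
      rw [self, hE' bA]
      exact ⟨ht, ⟨i, hA⟩, bA.mono hlen⟩
  · rcases get hk with ⟨hk, h⟩ | ⟨rfl, h⟩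
    · obtain ⟨h₁, h₂⟩ := hG.value h
      rw [ne hk, hE' h₂]
      exact ⟨h₁, h₂.mono hlen⟩
    · injection h with h₁ h₂
      obtain rfl := hv _ h₂
      rw [self, hE' bt]
      exact ⟨rfl, bt.mono hlen⟩

/-! #### The primitive constants -/

/-- The admitted levels are bounded, so this is a finite computation. The type of a constant is
checked with only the constants of smaller rank, which breaks the circle between soundness of
inference and well-formedness of the types of the constants. -/
lemma asUniv_constType (c : Const) (i j : ℕ) (h : Const.available (c.rank + 1) c i j = true) :
    (asUniv [] (infer [] (Const.available c.rank) (Src.constType i j c 0) [])).isSome = true := by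
  have hij : i ≤ 1 ∧ j ≤ 1 := by
    simp only [Const.available, Bool.and_eq_true, Nat.ble_eq] at h
    refine ⟨h.2.1.trans ?_, h.2.2⟩
    cases c <;> decide
  obtain ⟨hi, hj⟩ := hij
  interval_cases i <;> interval_cases j <;> cases c <;> first | decide +kernel | cases h

/-- The available constants have well-formed types. -/
theorem sound_available (n : ℕ) : Sound (Const.available n) := by
  induction n with
  | zero => intro c i j h; cases h
  | succ n ih =>
    intro c i j h
    simp only [Const.available, Bool.and_eq_true, Nat.blt_eq] at h
    rcases Nat.lt_succ_iff_lt_or_eq.1 h.1 with hn | rfl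
    · exact ih c i j (by simpa [Const.available, hn] using h.2)
    · have := asUniv_constType c i j (by simpa [Const.available] using h.2)
      obtain ⟨k, hk⟩ := Option.isSome_iff_exists.1 this
      obtain ⟨E, hE⟩ := realizable_nil
      rw [← interp_constType (E := E)]
      exact ⟨k, hasType_of_asUniv hE hk fun _ _ h => (hasType_of_infer hE ih _ (Γ := []) .nil h).1⟩

end Raw

end HoTT

set_option linter.unusedVariables false

namespace HoTT

/-! ### Typed expressions

Expressions tagged with their types, so that implicit arguments can be inferred.  The tags are not
relied on: every derivation goes through the type checker.

The number in `El.glob` is the position of the named term in the list `entries` below.  Both pushouts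
represent the functor of cocones under the diagram: maps from `A_{•□}` to `X` are decomposed by the
universal property of pushouts into data of points, paths and squares, naturally in `X`, and data for
the diagram and for its transpose correspond to each other by transposition of the squares. -/

/-- Expressions for types. -/
structure Ty where
  /-- The underlying expression. -/
  val : Src

/-- Expressions tagged with a type. -/
structure El (A : Ty) where
  /-- The underlying expression. -/
  val : Src

namespace Ty

/-- The universe of small types. -/
@[irreducible] def U : Ty := ⟨Src.univ 0⟩

/-- A large universe. -/
@[irreducible] def U₁ : Ty := ⟨Src.univ 1⟩

/-- Dependent function types. -/
@[irreducible] def pi (A : Ty) (B : El A → Ty) : Ty :=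
  ⟨Src.pi A.val fun x => (B ⟨x⟩).val⟩

/-- Function types. -/
abbrev arrow (A B : Ty) : Ty := pi A fun _ => B

/-- Dependent pair types. -/
@[irreducible] def sigma (A : Ty) (B : El A → Ty) : Ty :=
  ⟨Src.sigma 0 A.val (Src.lam A.val fun x => (B ⟨x⟩).val)⟩

/-- Identity types. -/
@[irreducible] def id {A : Ty} (a b : El A) : Ty := ⟨Src.id 0 A.val a.val b.val⟩

/-- A type as an element of the universe. -/
abbrev code (A : Ty) : El U := ⟨A.val⟩

end Ty

open Ty

infixr:60 " ⟹ " => Ty.arrow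
infix:65 " ≐ " => Ty.id

namespace El

instance : Coe (El U) Ty := ⟨fun A => ⟨A.val⟩⟩

/-- Change of the tag. -/
@[irreducible] def coerce {A B : Ty} (a : El A) : El B := ⟨a.val⟩

/-- A name for a closed term, with the tag of that term. -/
@[irreducible] def glob {A : Ty} (k : ℕ) (_ : El A) : El A := ⟨Src.glob k⟩

/-- Ascription of the tag. -/
@[irreducible] def ann {A : Ty} (a : El A) : El A := ⟨Src.ann a.val A.val⟩

@[irreducible] def lam {A : Ty} {B : El A → Ty} (b : (x : El A) → El (B x)) : El (pi A B) :=
  ⟨Src.lam A.val fun x => (b ⟨x⟩).val⟩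

@[irreducible] def app {A : Ty} {B : El A → Ty} (f : El (pi A B)) (a : El A) : El (B a) :=
  ⟨Src.app f.val a.val⟩

instance {A : Ty} {B : El A → Ty} : CoeFun (El (pi A B)) fun _ => (a : El A) → El (B a) := ⟨app⟩

@[irreducible] def pair {A : Ty} {B : El A → Ty} (a : El A) (b : El (B a)) : El (sigma A B) :=
  ⟨Src.pair 0 A.val (Src.lam A.val fun x => (B ⟨x⟩).val) a.val b.val⟩

/-- Elimination of pairs. -/
@[irreducible] def split {A : Ty} {B : El A → Ty} (P : El (sigma A B) → Ty)
    (d : (x : El A) → (y : El (B x)) → El (P (pair x y))) (z : El (sigma A B)) : El (P z) :=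
  ⟨Src.sigmaElim 0 0 A.val (Src.lam A.val fun x => (B ⟨x⟩).val)
    (Src.lam (sigma A B).val fun z => (P ⟨z⟩).val)
    (Src.lam A.val fun x => Src.lam (B ⟨x⟩).val fun y => (d ⟨x⟩ ⟨y⟩).val) z.val⟩

/-- The pattern for most of what follows: a closed term abstracted over all its parameters is
entered in `entries`, and a Lean function applies its name to actual parameters. Terms stay small in
this way and each of them is checked once. -/
def fstDef : El (Ty.pi U fun A => Ty.pi (A ⟹ U) fun B => (sigma A fun x => B x) ⟹ A) :=
  lam fun A => lam fun B => lam fun z => split (B := fun x => B x) (fun _ => A) (fun x _ => x) z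

/-- The first component of a pair. -/
def fst {A : Ty} {B : El A → Ty} (z : El (sigma A B)) : El A :=
  (glob 0 fstDef A.code (lam fun x => (B x).code) z.coerce).coerce

def sndDef : El (Ty.pi U fun A => Ty.pi (A ⟹ U) fun B => Ty.pi (sigma A fun x => B x) fun z => B (fst z)) :=
  lam fun A => lam fun B => lam fun z => split (B := fun x => B x) (fun z => B (fst z)) (fun _ y => y.coerce) z

/-- The second component of a pair. -/
def snd {A : Ty} {B : El A → Ty} (z : El (sigma A B)) : El (B (fst z)) :=
  (glob 1 sndDef A.code (lam fun x => (B x).code) z.coerce).coerce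

@[irreducible] def refl {A : Ty} (a : El A) : El (a ≐ a) := ⟨Src.idp 0 A.val a.val⟩

/-- Path induction. -/
@[irreducible] def J {A : Ty} {a : El A} (P : (x : El A) → El (a ≐ x) → Ty)
    (d : El (P a (refl a))) {x : El A} (p : El (a ≐ x)) : El (P x p) :=
  ⟨Src.J 0 0 A.val a.val (Src.lam A.val fun x => Src.lam (Src.id 0 A.val a.val x) fun q =>
    (P ⟨x⟩ ⟨q⟩).val) d.val x.val p.val⟩

@[irreducible] def inv {A : Ty} {a b : El A} (p : El (a ≐ b)) : El (b ≐ a) :=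
  ⟨Src.inv 0 A.val a.val b.val p.val⟩

/-- Composition of paths; `A` and `A'`, and `b` and `b'`, should be convertible. -/
@[irreducible] def comp {A A' : Ty} {a b : El A} {b' c : El A'} (p : El (a ≐ b))
    (q : El (b' ≐ c)) : El (a ≐ (⟨c.val⟩ : El A)) :=
  ⟨Src.comp 0 A.val a.val b.val c.val p.val q.val⟩

infixl:75 " ⊙ " => comp

@[irreducible] def ap {A B : Ty} (f : El (A ⟹ B)) {a b : El A} (p : El (a ≐ b)) :
    El (f a ≐ f b) :=
  ⟨Src.ap 0 0 A.val B.val f.val a.val b.val p.val⟩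

def apfDef : El (Ty.pi U fun A => Ty.pi U fun B => Ty.pi (A ⟹ B) fun f => Ty.pi A fun a => Ty.pi A fun b =>
    (a ≐ b) ⟹ f a ≐ f b) :=
  lam fun A => lam fun B => lam fun f => lam fun a => lam fun b => lam fun p => ap f p

/-- The action on paths of a function given by an expression. -/
def apf {A B : Ty} (f : El A → El B) {a b : El A} (p : El (a ≐ b)) : El (f a ≐ f b) :=
  (glob 2 apfDef A.code B.code (lam f).coerce a.coerce b.coerce p.coerce).coerce

def transDef : El (Ty.pi U fun A => Ty.pi A fun a => Ty.pi A fun b => Ty.pi A fun c => (a ≐ b) ⟹ (b ≐ c) ⟹ a ≐ c) :=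
  lam fun A => lam fun a => lam fun b => lam fun c => lam fun p => lam fun q => p ⊙ q

/-- Composition of paths, with the endpoints named. -/
def trans {A : Ty} {a b c : El A} (p : El (a ≐ b)) (q : El (b ≐ c)) : El (a ≐ c) :=
  (glob 3 transDef A.code a.coerce b.coerce c.coerce p.coerce q.coerce).coerce

/-- Transport in a family given by an expression. -/
@[irreducible] def transport {A : Ty} (P : El A → Ty) {a b : El A} (p : El (a ≐ b)) (u : El (P a)) :
    El (P b) :=
  ⟨Src.transport 0 0 A.val (Src.lam A.val fun x => (P ⟨x⟩).val) a.val b.val p.val u.val⟩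

/-- Dependent paths, in a family given by an expression. -/
@[irreducible] def Over {A : Ty} (P : El A → Ty) {a b : El A} (p : El (a ≐ b)) (u : El (P a))
    (v : El (P b)) : Ty :=
  ⟨Src.pathOver 0 0 A.val (Src.lam A.val fun x => (P ⟨x⟩).val) a.val b.val p.val u.val v.val⟩

@[irreducible] def apd {A : Ty} {P : El A → Ty} (h : El (pi A P)) {a b : El A} (p : El (a ≐ b)) :
    El (Over P p (h a) (h b)) :=
  ⟨Src.apd 0 0 A.val (Src.lam A.val fun x => (P ⟨x⟩).val) h.val a.val b.val p.val⟩

/-- A dependent path is by definition a path out of the transported point, so only the tag changes.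
-/
def apdEq {A : Ty} {P : El A → Ty} (h : El (pi A P)) {a b : El A} (p : El (a ≐ b)) :
    El (transport P p (h a) ≐ h b) :=
  (apd h p).coerce

end El

/-- Spans of types. -/
structure Span where
  (A B C : Ty)
  f : El (C ⟹ A)
  g : El (C ⟹ B)

namespace Span

open El

@[irreducible] def pushout (S : Span) : Ty :=
  ⟨Src.pushout 0 S.A.val S.B.val S.C.val S.f.val S.g.val⟩

@[irreducible] def inl (S : Span) : El (S.A ⟹ S.pushout) :=
  ⟨Src.inl 0 S.A.val S.B.val S.C.val S.f.val S.g.val⟩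

@[irreducible] def inr (S : Span) : El (S.B ⟹ S.pushout) :=
  ⟨Src.inr 0 S.A.val S.B.val S.C.val S.f.val S.g.val⟩

@[irreducible] def push (S : Span) : El (pi S.C fun c => S.inl (S.f c) ≐ S.inr (S.g c)) :=
  ⟨Src.push 0 S.A.val S.B.val S.C.val S.f.val S.g.val⟩

variable (S : Span) (P : El S.pushout → Ty) (l : El (pi S.A fun a => P (S.inl a)))
  (r : El (pi S.B fun b => P (S.inr b)))
  (p : El (pi S.C fun c => Over P (S.push c) (l (S.f c)) (r (S.g c))))

/-- The induction principle of the pushout. -/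
@[irreducible] def elim : El (pi S.pushout P) :=
  ⟨Src.ann (Src.pushoutElim 0 0 S.A.val S.B.val S.C.val S.f.val S.g.val
    (Src.lam S.pushout.val fun x => (P ⟨x⟩).val) l.val r.val p.val) (pi S.pushout P).val⟩

/-- The computation rule of the induction principle on paths. -/
@[irreducible] def elimPush (c : El S.C) :
    El ((apd (S.elim P l r p) (S.push c)).coerce (B := Over P (S.push c) (l (S.f c)) (r (S.g c)))
      ≐ p c) :=
  ⟨Src.app (Src.pushoutElimPush 0 0 S.A.val S.B.val S.C.val S.f.val S.g.val
    (Src.lam S.pushout.val fun x => (P ⟨x⟩).val) l.val r.val p.val) c.val⟩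

/-- The recursion principle of the pushout. -/
@[irreducible] def recur {X : Ty} (l : El (S.A ⟹ X)) (r : El (S.B ⟹ X))
    (p : El (pi S.C fun c => l (S.f c) ≐ r (S.g c))) : El (S.pushout ⟹ X) :=
  ⟨Src.pushoutRec 0 0 S.A.val S.B.val S.C.val S.f.val S.g.val X.val l.val r.val p.val⟩

end Span

end HoTT

namespace HoTT

open Ty El

/-! ### Function extensionality and induction on homotopies. -/

abbrev funextTy : Ty :=
  pi U fun A => pi (A ⟹ U) fun B => pi (pi A fun x => B x) fun f => pi (pi A fun x => B x) fun g =>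
    (pi A fun x => f x ≐ g x) ⟹ (f ≐ g)

/-- The span whose pushout is an interval. -/
def intervalSpan (A : Ty) : Span := ⟨A ⟹ A, A ⟹ A, A ⟹ A, lam fun c => c, lam fun c => c⟩

/-- A homotopy is a function on `A` with values in paths; exchanging the two arguments makes it a
path in the function type, parametrized by an interval. Because recursion computes on points by
definition, the ends of this path are the η-expansions of `f` and `g`. There is no unit type among
the constants, so `A ⟹ A` is used as a type with a point, the identity function. -/
def funextProof : El funextTy :=
  lam fun A => lam fun B => lam fun f => lam fun g => lam fun h =>
    let S := intervalSpan A
    let H (i : El S.pushout) : El (pi A fun x => B x) := lam fun x =>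
      S.recur (lam fun _ => f x) (lam fun _ => g x) (lam fun _ => (h x).coerce) i
    (apf H (S.push (lam fun x => x))).coerce

def funExt {A : Ty} {B : El A → Ty} {f g : El (pi A B)} (h : El (pi A fun x => f x ≐ g x)) :
    El (f ≐ g) :=
  (glob 4 funextProof A.code (lam fun x => (B x).code) f.coerce g.coerce h.coerce).coerce

abbrev homotopyIndTy : Ty :=
  pi U fun A => pi (A ⟹ U) fun B => pi (pi A fun x => B x) fun f =>
    pi (pi (pi A fun x => B x) fun g => (pi A fun x => f x ≐ g x) ⟹ U) fun M =>
      M f (lam fun x => refl (f x)) ⟹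
        pi (pi A fun x => B x) fun g => pi (pi A fun x => f x ≐ g x) fun h => M g h

/-- Pointwise, `(g x, h x)` lies in the type of paths starting at `f x`, where path induction joins
it to `(f x, refl)`. Function extensionality assembles a path `p` of sections, and `φ` turns
sections into pairs of a function and a homotopy. As `φ u` and `φ v` compute to the two ends that
are needed, no computation rule for function extensionality is required. -/
def homotopyIndProof : El homotopyIndTy :=
  lam fun A => lam fun B => lam fun f => lam fun M => lam fun d => lam fun g => lam fun h =>
    let Sx (x : El A) : Ty := sigma (B x) fun y => f x ≐ y
    let Sf : Ty := sigma (pi A fun x => B x) fun g => pi A fun x => f x ≐ g x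
    let φ (w : El (pi A Sx)) : El Sf := pair (lam fun x => fst (w x)) (lam fun x => (snd (w x)).coerce)
    let u : El (pi A Sx) := lam fun x => pair (f x) (refl (f x))
    let v : El (pi A Sx) := lam fun x => pair (g x) (h x)
    let p : El (u ≐ v) := funExt (lam fun x =>
      (J (A := B x) (a := f x) (fun y q => Ty.id (A := Sx x) (pair (f x) (refl (f x))) (pair y q))
        (refl _) (h x)).coerce)
    (J (fun z _ => (M (fst z) (snd z) : El U)) d.coerce (apf φ p)).coerce

/-- Induction on homotopies. -/
def homotopyInd {A : Ty} {B : El A → Ty} {f : El (pi A B)}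
    (M : (g : El (pi A B)) → El (pi A fun x => f x ≐ g x) → Ty)
    (d : El (M f (lam fun x => refl (f x)))) {g : El (pi A B)} (h : El (pi A fun x => f x ≐ g x)) :
    El (M g h) :=
  (glob 5 homotopyIndProof A.code (lam fun x => (B x).code) f.coerce
    (lam fun g => lam fun h => (M g.coerce h.coerce).code) d.coerce g.coerce h.coerce).coerce

/-! #### Equivalences -/

namespace Ty

def isEquivDef : El (Ty.pi U fun A => Ty.pi U fun B => (A ⟹ B) ⟹ U) :=
  lam fun A => lam fun B => lam fun f => code <|
    sigma (sigma (B ⟹ A) fun g => Ty.pi A fun x => g (f x) ≐ x) fun _ =>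
      sigma (B ⟹ A) fun h => Ty.pi B fun y => f (h y) ≐ y

/-- The type of proofs that `f` is an equivalence. -/
def isEquiv {A B : Ty} (f : El (A ⟹ B)) : Ty :=
  glob 6 isEquivDef A.code B.code f.coerce

/-- The type of equivalences. -/
def equiv (A B : Ty) : Ty := sigma (A ⟹ B) fun f => isEquiv f

end Ty

namespace El

def mkEquivDef : El (Ty.pi U fun A => Ty.pi U fun B => Ty.pi (A ⟹ B) fun f => Ty.pi (B ⟹ A) fun g =>
    (Ty.pi A fun x => g (f x) ≐ x) ⟹ Ty.pi (B ⟹ A) fun h => (Ty.pi B fun y => f (h y) ≐ y) ⟹ isEquiv f) :=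
  lam fun A => lam fun B => lam fun f => lam fun g => lam fun p => lam fun h => lam fun q =>
    coerce <| pair (A := sigma (B ⟹ A) fun g => Ty.pi A fun x => g (f x) ≐ x)
      (B := fun _ => sigma (B ⟹ A) fun h => Ty.pi B fun y => f (h y) ≐ y) (pair g p) (pair h q)

/-- A function with a left inverse and a right inverse is an equivalence. -/
def mkEquiv₂ {A B : Ty} {f : El (A ⟹ B)} (g : El (B ⟹ A)) (p : El (Ty.pi A fun x => g (f x) ≐ x))
    (h : El (B ⟹ A)) (q : El (Ty.pi B fun y => f (h y) ≐ y)) : El (isEquiv f) :=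
  (glob 7 mkEquivDef A.code B.code f.coerce g.coerce p.coerce h.coerce q.coerce).coerce

/-- A function with a two-sided inverse is an equivalence. -/
def mkEquiv {A B : Ty} {f : El (A ⟹ B)} (g : El (B ⟹ A)) (p : El (Ty.pi A fun x => g (f x) ≐ x))
    (q : El (Ty.pi B fun y => f (g y) ≐ y)) : El (isEquiv f) :=
  mkEquiv₂ g p g q

variable {A B : Ty} {f : El (A ⟹ B)} (e : El (isEquiv f))

abbrev isEquivSigma (A B : Ty) (f : El (A ⟹ B)) : Ty :=
  sigma (sigma (B ⟹ A) fun g => Ty.pi A fun x => g (f x) ≐ x) fun _ =>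
    sigma (B ⟹ A) fun h => Ty.pi B fun y => f (h y) ≐ y

def linvDef : El (Ty.pi U fun A => Ty.pi U fun B => Ty.pi (A ⟹ B) fun f => isEquiv f ⟹ B ⟹ A) :=
  lam fun A => lam fun B => lam fun f => lam fun e => fst (fst (e.coerce : El (isEquivSigma A B f)))

/-- The left inverse of an equivalence. -/
def linv : El (B ⟹ A) := (glob 8 linvDef A.code B.code f.coerce e.coerce).coerce

def rinvDef : El (Ty.pi U fun A => Ty.pi U fun B => Ty.pi (A ⟹ B) fun f => isEquiv f ⟹ B ⟹ A) :=
  lam fun A => lam fun B => lam fun f => lam fun e => fst (snd (e.coerce : El (isEquivSigma A B f)))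

/-- The right inverse of an equivalence. -/
def rinv : El (B ⟹ A) := (glob 9 rinvDef A.code B.code f.coerce e.coerce).coerce

def linvApplyProof : El (Ty.pi U fun A => Ty.pi U fun B => Ty.pi (A ⟹ B) fun f => Ty.pi (isEquiv f) fun e =>
    Ty.pi A fun x => linv e (f x) ≐ x) :=
  lam fun A => lam fun B => lam fun f => lam fun e => coerce <| snd (fst (e.coerce : El (isEquivSigma A B f)))

def linv_apply (x : El A) : El (linv e (f x) ≐ x) :=
  (glob 10 linvApplyProof A.code B.code f.coerce e.coerce x.coerce).coerce

def applyRinvProof : El (Ty.pi U fun A => Ty.pi U fun B => Ty.pi (A ⟹ B) fun f => Ty.pi (isEquiv f) fun e =>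
    Ty.pi B fun y => f (rinv e y) ≐ y) :=
  lam fun A => lam fun B => lam fun f => lam fun e => coerce <| snd (snd (e.coerce : El (isEquivSigma A B f)))

def apply_rinv (y : El B) : El (f (rinv e y) ≐ y) :=
  (glob 11 applyRinvProof A.code B.code f.coerce e.coerce y.coerce).coerce

/-- Names for the inverses of an equivalence and for the homotopies. -/
def withInverse {A B G : Ty} {f : El (A ⟹ B)} (e : El (isEquiv f))
    (k : (g h : El (B ⟹ A)) → El (pi A fun x => g (f x) ≐ x) → El (pi B fun y => f (h y) ≐ y) →
      El G) : El G :=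
  (lam fun g => lam fun h => lam fun p => lam fun q => k g h p q)
    (linv e) (rinv e) (coerce <| lam fun x => linv_apply e x) (coerce <| lam fun y => apply_rinv e y)

/-- Names for the inverses of a family of equivalences and for the homotopies. -/
def withInverses {A G : Ty} {S T : El A → Ty} {φ : (a : El A) → El (S a ⟹ T a)}
    (e : El (pi A fun a => isEquiv (φ a)))
    (k : (g h : El (pi A fun a => T a ⟹ S a)) → El (pi A fun a => pi (S a) fun s => g a (φ a s) ≐ s) →
      El (pi A fun a => pi (T a) fun t => φ a (h a t) ≐ t) → El G) : El G :=
  (lam fun g => lam fun h => lam fun p => lam fun q => k g h p q)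
    (lam fun a => linv (e a)) (lam fun a => rinv (e a))
    (coerce <| lam fun a => lam fun s => linv_apply (e a) s)
    (coerce <| lam fun a => lam fun t => apply_rinv (e a) t)

end El

/-- The equivalence induced by the constant path in the universe. -/
def idEquiv (A : Ty) : El (equiv A A) :=
  ⟨Src.app (Src.idToEquiv 0 A.val A.val) (Src.idp 1 (Src.univ 0) A.val)⟩

/-- The motive takes values in the larger universe because `sigmaMapBody` quantifies over families
of small types. -/
abbrev equivIndTy : Ty :=
  pi U fun A => pi (pi U fun B => equiv A B ⟹ U₁) fun M => (⟨(M A (idEquiv A)).val⟩ : Ty) ⟹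
    pi U fun B => pi (equiv A B) fun e => ⟨(M B e).val⟩

/-- Univalence provides a right inverse `h` of `idToEquiv`, and `q e` identifies `idToEquiv (h e)`
with `e`. Path induction along `q e` reduces the claim to equivalences of the form `idToEquiv p`,
and path induction on `p` reduces it to `idEquiv A`, which is `idToEquiv` at the constant path. The
left inverse is not used. -/
def equivIndProof : El equivIndTy :=
  lam fun A => lam fun M => lam fun d => lam fun B => lam fun e =>
    let E : Src := Src.up (equiv A B).val
    let I : Src := Src.id 1 (Src.univ 0) A.val B.val
    let f : Src := Src.idToEquiv 0 A.val B.val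
    let L : Src := Src.sigma 1 (Src.arrow E I) (Src.lam (Src.arrow E I) fun g =>
      Src.pi I fun x => Src.id 1 I (Src.app g (Src.app f x)) x)
    let R' (h : Src) : Src := Src.pi E fun y => Src.id 1 E (Src.app f (Src.app h y)) y
    let R : Src := Src.sigma 1 (Src.arrow E I) (Src.lam (Src.arrow E I) R')
    let T : Src := (M B e).val
    ⟨Src.sigmaElim 1 1 L (Src.lam L fun _ => R) (Src.lam (Src.prod 1 L R) fun _ => T)
      (Src.lam L fun _ => Src.lam R fun r =>
        Src.sigmaElim 1 1 (Src.arrow E I) (Src.lam (Src.arrow E I) R') (Src.lam R fun _ => T)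
          (Src.lam (Src.arrow E I) fun h => Src.lam (R' h) fun q =>
            Src.J 1 1 E (Src.app f (Src.app h e.val))
              (Src.lam E fun y => Src.lam (Src.id 1 E (Src.app f (Src.app h e.val)) y) fun _ =>
                (M B ⟨y⟩).val)
              (Src.J 1 1 (Src.univ 0) A.val
                (Src.lam (Src.univ 0) fun X => Src.lam (Src.id 1 (Src.univ 0) A.val X) fun p =>
                  (M ⟨X⟩ ⟨Src.app (Src.idToEquiv 0 A.val X) p⟩).val)
                d.val B.val (Src.app h e.val))
              e.val (Src.app q e.val)) r)
      (Src.app (Src.app (Src.const .univalence 0 0) A.val) B.val)⟩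

def withTripleDef : El (Ty.pi U fun A => Ty.pi (A ⟹ U) fun B => Ty.pi (Ty.pi A fun a => B a ⟹ U) fun C => Ty.pi U fun Z =>
    (Ty.pi A fun a => Ty.pi (B a) fun b => C a b ⟹ Z) ⟹ (sigma A fun a => sigma (B a) fun b => C a b) ⟹ Z) :=
  lam fun A => lam fun B => lam fun C => lam fun Z => lam fun k => lam fun z =>
    k (fst (B := fun a => sigma (B a) fun b => C a b) z) (fst (snd (B := fun a => sigma (B a) fun b => C a b) z))
      (snd (snd (B := fun a => sigma (B a) fun b => C a b) z)).coerce

/-- Application of a function to the components of an element of an iterated pair type. -/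
def withTriple {A Z : Ty} {B : El A → Ty} {C : (a : El A) → El (B a) → Ty} (z : El (sigma A fun a => sigma (B a) (C a)))
    (k : (a : El A) → (b : El (B a)) → El (C a b) → El Z) : El Z :=
  (glob 13 withTripleDef A.code (lam fun a => (B a).code)
    (coerce <| lam fun a => lam fun b => (C a b).code) Z.code (coerce <| lam fun a => lam fun b => lam fun c => k a b c)
    z.coerce).coerce

def sigmaMapDef : El (Ty.pi U fun A => Ty.pi U fun B => Ty.pi (A ⟹ U) fun S => Ty.pi (B ⟹ U) fun T =>
    Ty.pi (A ⟹ B) fun f => (Ty.pi A fun a => S a ⟹ T (f a)) ⟹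
      (sigma A fun a => S a) ⟹ sigma B fun b => T b) :=
  lam fun A => lam fun B => lam fun S => lam fun T => lam fun f => lam fun φ => lam fun z =>
    pair (B := fun b => T b) (f (fst z)) (φ (fst z) (snd z))

/-- The map between pair types induced by `f` and `φ`. -/
def sigmaMap {A B : Ty} {S : El A → Ty} {T : El B → Ty} (f : El (A ⟹ B))
    (φ : (a : El A) → El (S a) → El (T (f a))) : El (sigma A S ⟹ sigma B T) :=
  (glob 14 sigmaMapDef A.code B.code (lam fun a => (S a).code) (lam fun b => (T b).code) f.coerce
    (coerce <| lam fun a => lam (φ a))).coerce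

/-- Everything that depends on `B` and `f` is collected here, to serve as the motive of the
induction on equivalences. -/
abbrev sigmaMapBody (A : Ty) (S : El (A ⟹ U)) (B : Ty) (f : El (A ⟹ B)) : Ty :=
  pi (B ⟹ U) fun T => pi (pi A fun a => S a ⟹ T (f a)) fun φ =>
    (pi A fun a => isEquiv (A := S a) (B := T (f a)) (φ a)) ⟹
      isEquiv (A := sigma A fun a => S a) (B := sigma B fun b => T b)
        (glob 14 sigmaMapDef A.code B.code S T f φ).coerce

abbrev sigmaMapTy : Ty :=
  pi U fun A => pi (A ⟹ U) fun S => pi U fun B => pi (A ⟹ B) fun f =>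
    isEquiv f ⟹ sigmaMapBody A S B f

/-- By induction on equivalences `f` may be taken to be the identity; then the fibrewise left and
right inverses give the inverses on pairs. This avoids any coherence between the two homotopies of
`f`, which a direct construction would need. Pairs have no η-rule, so the homotopies are given by
pair elimination. -/
def sigmaMapProof : El sigmaMapTy :=
  lam fun A => lam fun S => lam fun B => lam fun f => lam fun e =>
    (glob 12 equivIndProof A (lam fun B => lam fun e => ⟨(sigmaMapBody A S B (fst e)).val⟩)
      (coerce <| lam fun (T : El (A ⟹ U)) => lam fun (φ : El (pi A fun a => S a ⟹ T a)) =>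
        lam fun (hφ : El (pi A fun a => isEquiv (A := S a) (B := T a) (φ a))) =>
          withInverses hφ fun g h p q =>
          let ST := sigma A fun a => S a
          let TT := sigma A fun a => T a
          let map (ψ : El (pi A fun a => T a ⟹ S a)) : El (TT ⟹ ST) :=
            lam fun w => pair (fst w) (ψ (fst w) (snd w))
          let f : El (ST ⟹ TT) := sigmaMap (lam fun a => a) fun a s => (φ a s).coerce
          mkEquiv₂ (f := f)
            (map g) (lam (B := fun z => map g (f z) ≐ z) fun z =>
              split (fun z => map g (f z) ≐ z)
                (fun x y => (apf (fun y => pair (B := fun a => S a) x y) (p x y)).coerce) z)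
            (map h) (lam (B := fun z => f (map h z) ≐ z) fun z =>
              split (fun z => f (map h z) ≐ z)
                (fun x y => (apf (fun y => pair (B := fun a => T a) x y) (q x y)).coerce) z))
      B (pair f e)).coerce (B := sigmaMapBody A S B f)

def isEquivSigmaMap {A B : Ty} {S : El A → Ty} {T : El B → Ty} {f : El (A ⟹ B)}
    (e : El (isEquiv f)) {φ : (a : El A) → El (S a) → El (T (f a))}
    (eφ : (a : El A) → El (isEquiv (lam (φ a)))) : El (isEquiv (sigmaMap (T := T) f φ)) :=
  (glob 15 sigmaMapProof A.code (lam fun a => (S a).code) B.code f.coerce e.coerce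
    (lam fun b => (T b).code) (coerce <| lam fun a => lam (φ a)) (coerce <| lam fun a => eφ a)).coerce

def isEquivId (A : Ty) : El (isEquiv (lam fun x : El A => x)) :=
  (mkEquiv (f := lam fun x : El A => x) (lam fun x => x) (lam fun x => (refl x).coerce)
    (lam fun x => (refl x).coerce))

abbrev equivCompTy : Ty :=
  pi U fun A => pi U fun B => pi U fun C => pi (A ⟹ B) fun f => pi (B ⟹ C) fun g =>
    isEquiv f ⟹ isEquiv g ⟹ isEquiv (lam fun x : El A => g (f x))

def equivCompProof : El equivCompTy :=
  lam fun A => lam fun B => lam fun C => lam fun f => lam fun g => lam fun e => lam fun e' =>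
    withInverse e fun l r p q => withInverse e' fun l' r' p' q' =>
      mkEquiv₂ (lam fun z => l (l' z)) (coerce <| lam fun x => apf (fun y => l y) (p' (f x)) ⊙ p x)
        (lam fun z => r (r' z)) (coerce <| lam fun z => apf (fun y => g y) (q (r' z)) ⊙ q' z)

def isEquivComp {A B C : Ty} {f : El (A ⟹ B)} {g : El (B ⟹ C)} (e : El (isEquiv f))
    (e' : El (isEquiv g)) : El (isEquiv (lam fun x => g (f x))) :=
  (glob 16 equivCompProof A.code B.code C.code f.coerce g.coerce e.coerce e'.coerce).coerce

/-! #### Paths -/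

/-- Reflexivity, for convertible elements. -/
def El.rfl' {A : Ty} {a b : El A} : El (a ≐ b) := (El.refl a).coerce

/-- Composition is defined by induction on the second path: `p ⊙ refl` computes to `p`, but a
constant path on the left has to be removed by an induction. -/
def lunitDef : El (pi U fun A => pi A fun a => pi A fun b => pi (a ≐ b) fun p => refl a ⊙ p ≐ p) :=
  lam fun A => lam fun a => lam fun b => lam fun p => J (fun _ p => refl a ⊙ p ≐ p) (refl (refl a)).coerce p

def lunit {A : Ty} {a b : El A} (p : El (a ≐ b)) : El (refl a ⊙ p ≐ p) :=
  (glob 17 lunitDef A.code a.coerce b.coerce p.coerce).coerce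

abbrev overEqTy : Ty :=
  pi U fun Z => pi (Z ⟹ U) fun E => pi (pi Z fun z => E z) fun h => pi (pi Z fun z => E z) fun k =>
    pi Z fun a => pi (h a ≐ k a) fun e => pi Z fun b => pi (a ≐ b) fun p => pi (h b ≐ k b) fun e' =>
      (apdEq h p ⊙ e' ≐
        apf (transport (fun z => E z) p) e ⊙ apdEq k p) ⟹ Over (fun z => h z ≐ k z) p e e'

/-- For constant `p` the hypothesis reads `refl ⊙ e' = ap transport e`, where the transport is the
identity by conversion. Removing the identity map and the unit on both sides leaves `e = e'`, which
is the dependent path sought. -/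
def overEqProof : El overEqTy :=
  lam fun Z => lam fun E => lam fun h => lam fun k => lam fun a => lam fun e => lam fun b =>
    lam fun p => J (fun b p => pi (h b ≐ k b) fun e' =>
      (apdEq h p ⊙ e' ≐
        apf (transport (fun z => E z) p) e ⊙ apdEq k p) ⟹ Over (fun z => h z ≐ k z) p e e')
      (lam fun e' => lam fun c =>
        let u := inv (J (fun y e => apf (transport (fun z => E z) (refl a)) e ≐ e.coerce)
          (refl (refl (h a))).coerce e)
        (u ⊙ inv c ⊙ lunit e').coerce) p

def overEq {Z : Ty} {E : El Z → Ty} (h k : El (pi Z E)) {a b : El Z} (p : El (a ≐ b))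
    {e : El (h a ≐ k a)} {e' : El (h b ≐ k b)}
    (c : El (apdEq h p ⊙ e' ≐
        apf (transport (fun z => E z) p) e ⊙ apdEq k p)) :
    El (Over (fun z => h z ≐ k z) p e e') :=
  (glob 18 overEqProof Z.code (lam fun z => (E z).code) h.coerce k.coerce a e.coerce b p e'.coerce c.coerce).coerce

/-! #### The universal property of pushouts -/

/-- Quantification over the data for dependent cocones. -/
abbrev piCocone (k : (A B C : El U) → (L : El (A ⟹ U)) → (R : El (B ⟹ U)) → (f : El (C ⟹ A)) → (g : El (C ⟹ B)) →
    El (pi C fun c => L (f c) ⟹ R (g c) ⟹ U) → Ty) : Ty :=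
  pi U fun A => pi U fun B => pi U fun C => pi (A ⟹ U) fun L => pi (B ⟹ U) fun R => pi (C ⟹ A) fun f =>
    pi (C ⟹ B) fun g => pi (pi C fun c => L (f c) ⟹ R (g c) ⟹ U) fun K => k A B C L R f g K

def coconeDef : El (piCocone fun _ _ _ _ _ _ _ _ => U) :=
  lam fun A => lam fun B => lam fun C => lam fun L => lam fun R => lam fun f => lam fun g => lam fun K => code <|
    sigma (pi A fun a => L a) fun l => sigma (pi B fun b => R b) fun r => pi C fun c => K c (l (f c)) (r (g c))

section Cocone

variable {A B C : Ty} (L : El A → Ty) (R : El B → Ty) (f : El (C ⟹ A)) (g : El (C ⟹ B))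
  (K : (c : El C) → El (L (f c)) → El (R (g c)) → Ty)

/-- Dependent cocones under a span, with path data in `K`. -/
def cocone : Ty :=
  glob 19 coconeDef A.code B.code C.code (lam fun a => (L a).code) (lam fun b => (R b).code)
    f.coerce g.coerce (coerce <| lam fun c => lam fun x => lam fun y => (K c x y).code)

abbrev coconeOf (A B C : El U) (L : El (A ⟹ U)) (R : El (B ⟹ U)) (f : El (C ⟹ A)) (g : El (C ⟹ B))
    (K : El (pi C fun c => L (f c) ⟹ R (g c) ⟹ U)) : Ty :=
  cocone (A := A) (B := B) (C := C) (fun a => L a) (fun b => R b) f g fun c x y => K c x y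

variable {L R f g K}

def coconeMkDef : El (piCocone fun A B C L R f g K => pi (pi A fun a => L a) fun l => pi (pi B fun b => R b) fun r =>
    (pi C fun c => K c (l (f c)) (r (g c))) ⟹ coconeOf A B C L R f g K) :=
  lam fun A => lam fun B => lam fun C => lam fun L => lam fun R => lam fun f => lam fun g => lam fun K =>
  lam fun l => lam fun r => lam fun k =>
    coerce <| pair (A := pi A fun a => L a) (B := fun l => sigma (pi B fun b => R b) fun r =>
      pi C fun c => K c (l (f c)) (r (g c))) l (pair r k)

def coconeMk (l : El (pi A L)) (r : El (pi B R)) (k : El (pi C fun c => K c (l (f c)) (r (g c)))) :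
    El (cocone L R f g K) :=
  (glob 20 coconeMkDef A.code B.code C.code (lam fun a => (L a).code) (lam fun b => (R b).code)
    f.coerce g.coerce (coerce <| lam fun c => lam fun x => lam fun y => (K c x y).code)
    l.coerce r.coerce k.coerce).coerce

variable (z : El (cocone L R f g K))

/-- The underlying pair of a cocone. -/
def coconePair : El (sigma (pi A L) fun l => sigma (pi B R) fun r => pi C fun c => K c (l (f c)) (r (g c))) :=
  z.coerce

def coconeLDef : El (piCocone fun A B C L R f g K => coconeOf A B C L R f g K ⟹ pi A fun a => L a) :=
  lam fun A => lam fun B => lam fun C => lam fun L => lam fun R => lam fun f => lam fun g => lam fun K =>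
  lam fun z => fst (coconePair z)

def coconeL : El (pi A L) :=
  (glob 21 coconeLDef A.code B.code C.code (lam fun a => (L a).code) (lam fun b => (R b).code)
    f.coerce g.coerce (coerce <| lam fun c => lam fun x => lam fun y => (K c x y).code) z.coerce).coerce

def coconeRDef : El (piCocone fun A B C L R f g K => coconeOf A B C L R f g K ⟹ pi B fun b => R b) :=
  lam fun A => lam fun B => lam fun C => lam fun L => lam fun R => lam fun f => lam fun g => lam fun K =>
  lam fun z => fst (snd (coconePair z))

def coconeR : El (pi B R) :=
  (glob 22 coconeRDef A.code B.code C.code (lam fun a => (L a).code) (lam fun b => (R b).code)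
    f.coerce g.coerce (coerce <| lam fun c => lam fun x => lam fun y => (K c x y).code) z.coerce).coerce

def coconePDef : El (piCocone fun A B C L R f g K => pi (coconeOf A B C L R f g K) fun z =>
    pi C fun c => K c (coconeL z (f c)) (coconeR z (g c))) :=
  lam fun A => lam fun B => lam fun C => lam fun L => lam fun R => lam fun f => lam fun g => lam fun K =>
  lam fun z => coerce <| snd (snd (coconePair z))

def coconeP : El (pi C fun c => K c (coconeL z (f c)) (coconeR z (g c))) :=
  (glob 23 coconePDef A.code B.code C.code (lam fun a => (L a).code) (lam fun b => (R b).code)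
    f.coerce g.coerce (coerce <| lam fun c => lam fun x => lam fun y => (K c x y).code) z.coerce).coerce

end Cocone

/-- The data defining a function on a pushout, with path data in `K`. -/
abbrev coconeType (S : Span) (E : El S.pushout → Ty)
    (K : (c : El S.C) → El (E (S.inl (S.f c))) → El (E (S.inr (S.g c))) → Ty) : Ty :=
  cocone (fun a => E (S.inl a)) (fun b => E (S.inr b)) S.f S.g K

abbrev coconeTypeMk {S : Span} (E : El S.pushout → Ty)
    (K : (c : El S.C) → El (E (S.inl (S.f c))) → El (E (S.inr (S.g c))) → Ty)
    (l : El (pi S.A fun a => E (S.inl a))) (r : El (pi S.B fun b => E (S.inr b)))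
    (k : El (pi S.C fun c => K c (l (S.f c)) (r (S.g c)))) : El (coconeType S E K) :=
  coconeMk l r k

/-- Path data are allowed to live in any `K` equivalent to dependent paths, and the path data of `h`
may be any `α h` that agrees with `κ (apd h push)` up to a path. Hence `evalEquivProof` can use `ap`
and ordinary paths, and `Legs.evalEquivProof` can use squares. -/
abbrev pushoutUniversalTy : Ty :=
  pi U fun A => pi U fun B => pi U fun C => pi (C ⟹ A) fun f => pi (C ⟹ B) fun g =>
    let S : Span := ⟨A, B, C, f, g⟩
    pi (S.pushout ⟹ U) fun E => pi (pi C fun c => E (S.inl (f c)) ⟹ E (S.inr (g c)) ⟹ U) fun K =>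
    pi (pi C fun c => pi (E (S.inl (f c))) fun x => pi (E (S.inr (g c))) fun y =>
      Over (fun z => E z) (S.push c) x y ⟹ K c x y) fun κ =>
    pi (pi C fun c => pi (E (S.inl (f c))) fun x => pi (E (S.inr (g c))) fun y =>
      K c x y ⟹ Over (fun z => E z) (S.push c) x y) fun ν =>
    (pi C fun c => pi (E (S.inl (f c))) fun x => pi (E (S.inr (g c))) fun y =>
      pi (Over (fun z => E z) (S.push c) x y) fun o => ν c x y (κ c x y o) ≐ o) ⟹
    (pi C fun c => pi (E (S.inl (f c))) fun x => pi (E (S.inr (g c))) fun y =>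
      pi (K c x y) fun k => κ c x y (ν c x y k) ≐ k) ⟹
    pi (pi (pi S.pushout fun z => E z) fun h => pi C fun c =>
      K c (h (S.inl (f c))) (h (S.inr (g c)))) fun α =>
    (pi (pi S.pushout fun z => E z) fun h => pi C fun c =>
      α h c ≐ κ c (h (S.inl (f c))) (h (S.inr (g c))) (apd h (S.push c))) ⟹
    isEquiv (A := pi S.pushout fun z => E z)
      (B := coconeType S (fun z => E z) (fun c x y => K c x y))
      (lam fun h => coconeMk (lam fun a => h (S.inl a)) (lam fun b => h (S.inr b))
        (coerce <| lam fun c => α h c))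

/-- The inverse is the eliminator, with path data translated by `ν`. Both round trips hold by
conversion on points, so only the path constructor needs an argument, through its propositional
computation rule. -/
def pushoutUniversalProof : El pushoutUniversalTy :=
  lam fun A => lam fun B => lam fun C => lam fun f => lam fun g =>
    let S : Span := ⟨A, B, C, f, g⟩
    lam fun E => lam fun K => lam fun κ => lam fun ν => lam fun νκ => lam fun κν => lam fun α => lam fun ακ =>
    let E' (z : El S.pushout) : Ty := E z
    let L : Ty := pi A fun a => E (S.inl a)
    let R : Ty := pi B fun b => E (S.inr b)
    let M (l : El L) (r : El R) : Ty := pi C fun c => K c (l (f c)) (r (g c))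
    let G (l : El L) (r : El R) (k : El (M l r)) : El (pi S.pushout E') :=
      S.elim E' l r (lam fun c => ν c (l (f c)) (r (g c)) (k c))
    let T := coconeType S (fun z => E z) (fun c x y => K c x y)
    let F (h : El (pi S.pushout E')) : El T := coconeMk (lam fun a => h (S.inl a))
      (lam fun b => h (S.inr b)) (coerce <| lam fun c => α h c)
    let G' (z : El T) : El (pi S.pushout E') := ann <| split (B := fun l => sigma R fun r => M l r) (fun _ => pi S.pushout E')
      (fun l z => split (fun _ => pi S.pushout E') (fun r k => G l r k) z) z.coerce
    let left (h : El (pi S.pushout E')) : El (G' (F h) ≐ h) :=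
      let h' := G (lam fun a => h (S.inl a)) (lam fun b => h (S.inr b)) (coerce <| lam fun c => α h c)
      coerce <| funExt (f := h') (g := h) <| S.elim (fun z => h' z ≐ h z)
        (lam fun a => rfl') (lam fun b => rfl')
        -- With constant paths at both ends the condition becomes `apd h' push = refl ⊙ apd h push`.
        -- The computation rule, `ακ` and `νκ` turn the left side into `apd h push`, and `lunit`
        -- accounts for the constant path.
        (lam fun c => overEq h' h (S.push c)
          (coerce <| (S.elimPush E' (lam fun a => h (S.inl a)) (lam fun b => h (S.inr b))
            (lam fun c => (ν c (h (S.inl (f c))) (h (S.inr (g c))) (α h c)).coerce) c) ⊙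
            apf (fun k => ν c (h (S.inl (f c))) (h (S.inr (g c))) k) (ακ h c) ⊙
            νκ c (h (S.inl (f c))) (h (S.inr (g c))) (apd h (S.push c)) ⊙
            (inv (lunit (A := E (S.inr (g c))) (a := transport E' (S.push c) (h (S.inl (f c)))) (b := h (S.inr (g c)))
              (coerce (apd h (S.push c)))))))
    let right (l : El L) (r : El R) (k : El (M l r)) : El (F (G l r k) ≐ coerce (pair (B := fun l => sigma R fun r => M l r) l (pair r k))) :=
      -- The point components agree by conversion; the path components are joined by `ακ`, the
      -- computation rule and `κν`.
      coerce <| apf (fun k => pair (B := fun l => sigma R fun r => M l r) l (pair r k.coerce))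
        (funExt (f := lam fun c => α (G l r k) c) (g := k.coerce) <| coerce <| lam fun c =>
          ακ (G l r k) c ⊙
          apf (fun o => κ c (l (f c)) (r (g c)) o) (S.elimPush E' l r (lam fun c => ν c (l (f c)) (r (g c)) (k c)) c) ⊙
          κν c (l (f c)) (r (g c)) (k c))
    mkEquiv (f := lam fun h => F h) (lam fun z => G' z)
      (lam fun h => (left h).coerce)
      (lam fun z => coerce <| split (B := fun l => sigma R fun r => M l r) (fun z => F (G' z.coerce) ≐ z.coerce)
        (fun l z => split (fun z => F (G' (coerce <| pair (B := fun l => sigma R fun r => M l r) l z)) ≐ (coerce <| pair (B := fun l => sigma R fun r => M l r) l z)) (fun r k => (right l r k).coerce) z) z.coerce)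

namespace El

def overConstDef : El (Ty.pi U fun A => Ty.pi U fun X => Ty.pi A fun a => Ty.pi A fun b => Ty.pi (a ≐ b) fun π =>
    Ty.pi X fun x => Ty.pi X fun y => Over (fun _ => X) π x y ⟹ x ≐ y) :=
  lam fun A => lam fun X => lam fun a => lam fun b => lam fun π => lam fun x => lam fun y =>
    J (fun _ π => Over (fun _ => X) π x y ⟹ x ≐ y) (coerce <| lam fun o : El (x ≐ y) => o) π

def overConst {A X : Ty} {a b : El A} (π : El (a ≐ b)) {x y : El X} :
    El (Over (fun _ => X) π x y ⟹ x ≐ y) :=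
  (glob 25 overConstDef A.code X.code a.coerce b.coerce π.coerce x.coerce y.coerce).coerce

def constOverDef : El (Ty.pi U fun A => Ty.pi U fun X => Ty.pi A fun a => Ty.pi A fun b => Ty.pi (a ≐ b) fun π =>
    Ty.pi X fun x => Ty.pi X fun y => (x ≐ y) ⟹ Over (fun _ => X) π x y) :=
  lam fun A => lam fun X => lam fun a => lam fun b => lam fun π => lam fun x => lam fun y =>
    J (fun _ π => (x ≐ y) ⟹ Over (fun _ => X) π x y) (coerce <| lam fun o : El (x ≐ y) => o) π

def constOver {A X : Ty} {a b : El A} (π : El (a ≐ b)) {x y : El X} :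
    El (x ≐ y ⟹ Over (fun _ => X) π x y) :=
  (glob 26 constOverDef A.code X.code a.coerce b.coerce π.coerce x.coerce y.coerce).coerce

end El

abbrev evalTy (S : Span) (X : Ty) : Ty :=
  coconeType S (fun _ => X) fun _ x y => x ≐ y

abbrev piSpan (k : Span → Ty) : Ty :=
  pi U fun A => pi U fun B => pi U fun C => pi (C ⟹ A) fun f => pi (C ⟹ B) fun g =>
    k ⟨A, B, C, f, g⟩

def lamSpan {k : Span → Ty} (d : (S : Span) → El (k S)) : El (piSpan k) :=
  lam fun A => lam fun B => lam fun C => lam fun f => lam fun g => d ⟨A, B, C, f, g⟩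

def appSpan {k : Span → Ty} (d : El (piSpan k)) (S : Span) : El (k S) :=
  (d S.A.code S.B.code S.C.code S.f.coerce S.g.coerce).coerce

def evalDef : El (piSpan fun S => pi U fun X => (S.pushout ⟹ X) ⟹ evalTy S X) :=
  lamSpan (k := fun S => pi U fun X => (S.pushout ⟹ X) ⟹ evalTy S X) fun S => lam fun X => lam fun h =>
    coconeMk (lam fun a => h (S.inl a)) (lam fun b => h (S.inr b)) (coerce <| lam fun c => ap h (S.push c))

/-- The restriction of a function on a pushout. -/
def eval (S : Span) {X : Ty} (h : El (S.pushout ⟹ X)) : El (evalTy S X) :=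
  (appSpan (glob 27 evalDef) S X.code h.coerce).coerce

abbrev evalEquivTy : Ty :=
  piSpan fun S => pi U fun X => isEquiv (A := S.pushout ⟹ X) (B := evalTy S X) (lam fun h => eval S h)

/-- The dependent universal property, with path data equivalent to dependent paths. -/
def pushoutUniversal (S : Span) (E : El S.pushout → Ty)
    (K : (c : El S.C) → El (E (S.inl (S.f c))) → El (E (S.inr (S.g c))) → Ty)
    (κ : ∀ c x y, El (Over E (S.push c) x y ⟹ K c x y))
    (ν : ∀ c x y, El (K c x y ⟹ Over E (S.push c) x y))
    (νκ : ∀ c x y o, El (ν c x y (κ c x y o) ≐ o))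
    (κν : ∀ c x y k, El (κ c x y (ν c x y k) ≐ k))
    (α : (h : El (pi S.pushout E)) → (c : El S.C) → El (K c (h (S.inl (S.f c))) (h (S.inr (S.g c)))))
    (ακ : ∀ h c, El (α h c ≐ κ c (h (S.inl (S.f c))) (h (S.inr (S.g c))) (apd h (S.push c))))
    {f : El (pi S.pushout E ⟹ coconeType S E K)} :
    El (isEquiv f) :=
  (glob 24 pushoutUniversalProof S.A.code S.B.code S.C.code S.f.coerce S.g.coerce (coerce <| lam fun z => (E z).code)
    (coerce <| lam fun c => lam fun x => lam fun y => (K c x y).code)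
    (coerce <| lam fun c => lam fun x => lam fun y => κ c x y)
    (coerce <| lam fun c => lam fun x => lam fun y => ν c x y)
    (coerce <| lam fun c => lam fun x => lam fun y => lam fun o => νκ c x y o)
    (coerce <| lam fun c => lam fun x => lam fun y => lam fun o => κν c x y o)
    (coerce <| lam fun h => lam fun c => α h c)
    (coerce <| lam fun h => lam fun c => ακ h c)).coerce

/-- The conditions on `κ`, `ν` and `α` concern an arbitrary path in place of `push c`; for the
constant path they hold by conversion. -/
def evalEquivProof : El evalEquivTy :=
  lamSpan fun S => lam fun X =>
    pushoutUniversal S (fun _ => X) (fun _ x y => x ≐ y) (fun c x y => overConst (S.push c))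
      (fun c x y => constOver (S.push c))
      (fun c x y o => (ann <| J (fun _ π => pi (Over (fun _ => X) π x y) fun o => constOver π (overConst π o) ≐ o)
        (coerce <| lam fun o : El (x ≐ y) => refl o) (S.push c)) o)
      (fun c x y o => (ann <| J (fun _ π => pi (x ≐ y) fun o => overConst π (constOver π o) ≐ o)
        (coerce <| lam fun o : El (x ≐ y) => refl o) (S.push c)) o)
      (fun h c => ap h (S.push c))
      (fun h c => J (fun _ π => ap h π ≐ overConst π (apd h π)) rfl' (S.push c))

def evalEquiv (S : Span) (X : Ty) : El (isEquiv (A := S.pushout ⟹ X) (B := evalTy S X) (lam fun h => eval S h)) :=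
  (appSpan (glob 28 evalEquivProof) S X.code).coerce

abbrev recurPushTy : Ty :=
  piSpan fun S => pi U fun X => pi (S.A ⟹ X) fun l => pi (S.B ⟹ X) fun r =>
    pi (pi S.C fun c => l (S.f c) ≐ r (S.g c)) fun p => pi S.C fun c =>
      ap (S.recur l r p) (S.push c) ≐ (p c).coerce

/-- The recursor is the eliminator with path data `tc ⊙ p`, where `tc` removes the transport in the
constant family. Passing from `ap` to `apd` and applying the computation rule leaves the
cancellation of `tc`, which holds along any path: for the constant one it is `lunit`. -/
def recurPushProof : El recurPushTy :=
  lamSpan fun S => lam fun X => lam fun l => lam fun r => lam fun p => lam fun c =>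
    let tc {A : Ty} {a b : El A} (π : El (a ≐ b)) (x : El X) : El (transport (fun _ => X) π x ≐ x) :=
      ⟨Src.transportConst 0 0 A.val X.val a.val b.val π.val x.val⟩
    let p' : El (pi S.C fun c => Over (fun _ => X) (S.push c) (l (S.f c)) (r (S.g c))) :=
      lam fun c => coerce (tc (S.push c) (l (S.f c)) ⊙ p c)
    let h := S.elim (fun _ => X) l r p'
    let d : El (ap h (S.push c) ≐ overConst (S.push c) (apd h (S.push c))) :=
      J (fun _ π => ap h π ≐ overConst π (apd h π)) rfl' (S.push c)
    coerce <| d ⊙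
      apf (fun o => overConst (S.push c) o) (S.elimPush (fun _ => X) l r p' c) ⊙
      J (fun _ π => overConst π (x := l (S.f c)) (y := r (S.g c))
          (coerce <| tc π (l (S.f c)) ⊙ p c) ≐ p c) (coerce <| lunit (p c)) (S.push c)

/-- The computation rule of the recursion principle on paths. -/
def Span.recurPush (S : Span) {X : Ty} (l : El (S.A ⟹ X)) (r : El (S.B ⟹ X))
    (p : El (pi S.C fun c => l (S.f c) ≐ r (S.g c))) (c : El S.C) {q : El (l (S.f c) ≐ r (S.g c))} :
    El ((ap (S.recur l r p) (S.push c)).coerce ≐ q) :=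
  (glob 29 recurPushProof S.A.code S.B.code S.C.code S.f.coerce S.g.coerce X.code l.coerce r.coerce p.coerce c).coerce

/-! #### Squares -/

namespace El

/-- When the left path is constant this computes to `t ⊙ r`, and when both are constant to `t`. A
square is then an equation for the carried path, so for constant first sides it is simply a path
between the other two. -/
def carryDef : El (Ty.pi U fun A => Ty.pi A fun a => Ty.pi A fun b => Ty.pi A fun c => Ty.pi A fun d =>
    (a ≐ c) ⟹ (b ≐ d) ⟹ (a ≐ b) ⟹ c ≐ d) :=
  lam fun A : El U => lam fun a : El A => lam fun b : El A => lam fun c : El A => lam fun d : El A =>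
    lam fun l : El (a ≐ c) => lam fun r : El (b ≐ d) => lam fun t : El (a ≐ b) =>
      J (fun c _ => c ≐ d) (t ⊙ r) l

/-- The path from `c` to `d` obtained from a path from `a` to `b`. -/
def carry {A : Ty} {a b c d : El A} (l : El (a ≐ c)) (r : El (b ≐ d)) (t : El (a ≐ b)) : El (c ≐ d) :=
  ((glob 30 carryDef) A.code a.coerce b.coerce c.coerce d.coerce l.coerce r.coerce t.coerce).coerce

/-- Squares with the given sides. -/
def Sq {A : Ty} {a b c d : El A} (l : El (a ≐ c)) (r : El (b ≐ d)) (t : El (a ≐ b)) (s : El (c ≐ d)) : Ty :=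
  carry l r t ≐ s

abbrev compInvCompTy : Ty :=
  pi U fun A => pi A fun x => pi A fun y => pi A fun z => pi (x ≐ y) fun c => pi (x ≐ z) fun o => c ⊙ (inv c ⊙ o) ≐ o

def compInvCompProof : El compInvCompTy :=
  lam fun A => lam fun x => lam fun y => lam fun z => lam fun c => lam fun o =>
  J (fun _ o => c ⊙ (inv c ⊙ o) ≐ o) (J (fun _ c => c ⊙ inv c ≐ refl x) rfl' c).coerce o

def compInvComp {A : Ty} {x y z : El A} (c : El (x ≐ y)) (o : El (x ≐ z)) : El (c ⊙ (inv c ⊙ o) ≐ o) :=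
  (glob 31 compInvCompProof A.code x.coerce y.coerce z.coerce c.coerce o.coerce).coerce

abbrev invCompCompTy : Ty :=
  pi U fun A => pi A fun x => pi A fun y => pi A fun z => pi (x ≐ y) fun c => pi (y ≐ z) fun o => inv c ⊙ (c ⊙ o) ≐ o

def invCompCompProof : El invCompCompTy :=
  lam fun A => lam fun x => lam fun y => lam fun z => lam fun c => lam fun o =>
  J (fun _ o => inv c ⊙ (c ⊙ o) ≐ o) (J (fun y c => inv c ⊙ c ≐ refl y) rfl' c).coerce o

def invCompComp {A : Ty} {x y z : El A} (c : El (x ≐ y)) (o : El (y ≐ z)) : El (inv c ⊙ (c ⊙ o) ≐ o) :=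
  (glob 32 invCompCompProof A.code x.coerce y.coerce z.coerce c.coerce o.coerce).coerce

variable {Y₀ Y₁ Z X : Ty} (F : El (Z ⟹ Y₀)) (G : El (Z ⟹ Y₁))
  (u : El (Y₀ ⟹ X)) (v : El (Y₁ ⟹ X))

/-- The sides `l` and `r` are arbitrary paths identified with `ap F π` and `ap G π`. For maps
defined by recursion on a pushout this replaces their action on `push` by its prescribed value.
After induction on `β₀`, `β₁` and `π` both sides coincide. -/
def transportPathDef :=
  lam fun Y₀ : El U => lam fun Y₁ : El U => lam fun Z : El U => lam fun X : El U =>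
    lam fun F : El (Z ⟹ Y₀) => lam fun G : El (Z ⟹ Y₁) => lam fun u : El (Y₀ ⟹ X) => lam fun v : El (Y₁ ⟹ X) =>
    lam fun z : El Z => lam fun z' : El Z => lam fun π : El (z ≐ z') => lam fun l : El (F z ≐ F z') =>
    lam fun r : El (G z ≐ G z') => lam fun β₀ : El (ap F π ≐ l) => lam fun β₁ : El (ap G π ≐ r) =>
    lam fun p : El (u (F z) ≐ v (G z)) =>
      J (fun l _ => transport (fun z => u (F z) ≐ v (G z)) π p ≐ carry (ap u l) (ap v r) p)
      (J (fun r _ => transport (fun z => u (F z) ≐ v (G z)) π p ≐ carry (ap u (ap F π)) (ap v r) p)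
        (J (fun _ π => transport (fun z => u (F z) ≐ v (G z)) π p ≐
          carry (ap u (ap F π)) (ap v (ap G π)) p) rfl' π) β₁) β₀

/-- Transport in a family of path types. -/
def transportPath {z z' : El Z} (π : El (z ≐ z')) {l : El (F z ≐ F z')} {r : El (G z ≐ G z')}
    (β₀ : El (ap F π ≐ l)) (β₁ : El (ap G π ≐ r)) (p : El (u (F z) ≐ v (G z))) :
    El (transport (fun z => u (F z) ≐ v (G z)) π p ≐ carry (ap u l) (ap v r) p) :=
  ((glob 33 transportPathDef)
    Y₀.code Y₁.code Z.code X.code F.coerce G.coerce u.coerce v.coerce z.coerce z'.coerce π.coerce l.coerce r.coerce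
      β₀.coerce β₁.coerce p.coerce).coerce

def squareOfOverDef :=
  lam fun Y₀ : El U => lam fun Y₁ : El U => lam fun Z : El U => lam fun X : El U =>
    lam fun F : El (Z ⟹ Y₀) => lam fun G : El (Z ⟹ Y₁) => lam fun u : El (Y₀ ⟹ X) => lam fun v : El (Y₁ ⟹ X) =>
    lam fun z : El Z => lam fun z' : El Z => lam fun π : El (z ≐ z') => lam fun l : El (F z ≐ F z') =>
    lam fun r : El (G z ≐ G z') => lam fun β₀ : El (ap F π ≐ l) => lam fun β₁ : El (ap G π ≐ r) =>
    lam fun p : El (u (F z) ≐ v (G z)) => lam fun q : El (u (F z') ≐ v (G z')) =>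
    lam fun o : El (transport (fun z => u (F z) ≐ v (G z)) π p ≐ q) =>
      inv (transportPath F G u v π β₀ β₁ p) ⊙ o

/-- The square given by a dependent path in a family of path types. -/
def squareOfOver {z z' : El Z} (π : El (z ≐ z')) {l : El (F z ≐ F z')} {r : El (G z ≐ G z')}
    (β₀ : El (ap F π ≐ l)) (β₁ : El (ap G π ≐ r)) {p : El (u (F z) ≐ v (G z))} {q : El (u (F z') ≐ v (G z'))}
    (o : El (Over (fun z => u (F z) ≐ v (G z)) π p q)) : El (Sq (ap u l) (ap v r) p q) :=
  ((glob 34 squareOfOverDef)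
    Y₀.code Y₁.code Z.code X.code F.coerce G.coerce u.coerce v.coerce z.coerce z'.coerce π.coerce l.coerce r.coerce
      β₀.coerce β₁.coerce p.coerce q.coerce o.coerce).coerce

end El

/-- Maps from a pushout to two types, with their values on paths. -/
structure Legs where
  S : Span
  (Y₀ Y₁ : Ty)
  F : El (S.pushout ⟹ Y₀)
  G : El (S.pushout ⟹ Y₁)
  l : El (pi S.C fun c => F (S.inl (S.f c)) ≐ F (S.inr (S.g c)))
  r : El (pi S.C fun c => G (S.inl (S.f c)) ≐ G (S.inr (S.g c)))
  β₀ : El (pi S.C fun c => ap F (S.push c) ≐ l c)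
  β₁ : El (pi S.C fun c => ap G (S.push c) ≐ r c)

namespace Legs

abbrev piAll (k : Legs → Ty) : Ty :=
  piSpan fun S => pi U fun Y₀ => pi U fun Y₁ => pi (S.pushout ⟹ Y₀) fun F => pi (S.pushout ⟹ Y₁) fun G =>
    pi (pi S.C fun c => F (S.inl (S.f c)) ≐ F (S.inr (S.g c))) fun l =>
    pi (pi S.C fun c => G (S.inl (S.f c)) ≐ G (S.inr (S.g c))) fun r =>
    pi (pi S.C fun c => ap F (S.push c) ≐ l c) fun β₀ =>
    pi (pi S.C fun c => ap G (S.push c) ≐ r c) fun β₁ => k ⟨S, Y₀, Y₁, F, G, l, r, β₀, β₁⟩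

def lamAll (k : Legs → Ty) (d : (L : Legs) → El (k L)) : El (piAll k) :=
  lam fun A => lam fun B => lam fun C => lam fun f => lam fun g =>
    let S : Span := ⟨A, B, C, f, g⟩
    lam fun Y₀ => lam fun Y₁ => lam fun F => lam fun G => lam fun l => lam fun r =>
    lam fun β₀ => lam fun β₁ => d ⟨S, Y₀, Y₁, F, G, l, r, β₀, β₁⟩

def appAll {k : Legs → Ty} (d : El (piAll k)) (L : Legs) : El (k L) :=
  (d L.S.A.code L.S.B.code L.S.C.code L.S.f.coerce L.S.g.coerce L.Y₀.code L.Y₁.code L.F.coerce L.G.coerce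
    L.l.coerce L.r.coerce L.β₀.coerce L.β₁.coerce).coerce

variable (L : Legs) {X : Ty}

def span : Span := ⟨L.Y₀, L.Y₁, L.S.pushout, L.F, L.G⟩

def fillerTyDef : El (piAll fun L => pi U fun X => (L.Y₀ ⟹ X) ⟹ (L.Y₁ ⟹ X) ⟹ U) :=
  lamAll (fun L => pi U fun X => (L.Y₀ ⟹ X) ⟹ (L.Y₁ ⟹ X) ⟹ U) fun L => lam fun X => lam fun u => lam fun v => code <|
    coconeType L.S (fun z => u (L.F z) ≐ v (L.G z)) fun c x y => Sq (ap u (L.l c)) (ap v (L.r c)) x y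

def fillerTy (u : El (L.Y₀ ⟹ X)) (v : El (L.Y₁ ⟹ X)) : Ty :=
  appAll (glob 35 fillerTyDef) L X.code u.coerce v.coerce

abbrev coconeTy (X : Ty) : Ty :=
  sigma (L.Y₀ ⟹ X) fun u => sigma (L.Y₁ ⟹ X) fun v => L.fillerTy u v

abbrev fillerDefTy (L : Legs) : Ty := pi U fun X => pi (L.Y₀ ⟹ X) fun u => pi (L.Y₁ ⟹ X) fun v =>
  (pi L.S.pushout fun z => u (L.F z) ≐ v (L.G z)) ⟹ L.fillerTy u v

def fillerDef : El (piAll fillerDefTy) :=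
  lamAll fillerDefTy fun L => lam fun X => lam fun u => lam fun v => lam fun w =>
    coerce <| coconeTypeMk (S := L.S) (E := fun z => u (L.F z) ≐ v (L.G z)) (K := fun c x y => Sq (ap u (L.l c)) (ap v (L.r c)) x y) (lam fun a => w (L.S.inl a)) (lam fun b => w (L.S.inr b)) <| coerce <|
      lam fun c => squareOfOver L.F L.G u v (L.S.push c) (L.β₀ c) (L.β₁ c) (apd w (L.S.push c))

def filler {u : El (L.Y₀ ⟹ X)} {v : El (L.Y₁ ⟹ X)} (w : El (pi L.S.pushout fun z => u (L.F z) ≐ v (L.G z))) :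
    El (L.fillerTy u v) :=
  (appAll (k := fillerDefTy) (glob 36 fillerDef) L X.code u.coerce v.coerce w.coerce).coerce

abbrev evalDefTy (L : Legs) : Ty := pi U fun X => (L.span.pushout ⟹ X) ⟹ L.coconeTy X

def evalDef : El (piAll evalDefTy) :=
  lamAll evalDefTy fun L => lam fun X => lam fun h =>
    pair (lam fun a => h (L.span.inl a)) <| pair (lam fun b => h (L.span.inr b)) <|
      (L.filler (u := lam fun a => h (L.span.inl a)) (v := lam fun b => h (L.span.inr b))
        (coerce <| lam fun z => ap h (L.span.push z)))

def eval (h : El (L.span.pushout ⟹ X)) : El (L.coconeTy X) :=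
  (appAll (k := evalDefTy) (glob 37 evalDef) L X.code h.coerce).coerce

abbrev evalEquivTy : Ty :=
  piAll fun L => pi U fun X => isEquiv (A := L.span.pushout ⟹ X) (B := L.coconeTy X) (lam fun h => L.eval h)

/-- The outer universal property gives two maps and a homotopy over the middle pushout. With these
two maps fixed, the homotopy is a dependent function on a pushout in a family of path types, where
dependent paths are squares by `transportPath`; so the dependent universal property applies in each
fibre. -/
def evalEquivProof : El evalEquivTy :=
  lamAll (fun L => pi U fun X => isEquiv (A := L.span.pushout ⟹ X) (B := L.coconeTy X) (lam fun h => L.eval h)) fun L => lam fun X => coerce <| isEquivComp (A := L.span.pushout ⟹ X)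
    (B := sigma (L.Y₀ ⟹ X) fun u => sigma (L.Y₁ ⟹ X) fun v => pi L.S.pushout fun z => u (L.F z) ≐ v (L.G z))
    (f := lam fun h => coerce <| HoTT.eval L.span h) (HoTT.evalEquiv L.span X).coerce <|
    isEquivSigmaMap (A := L.Y₀ ⟹ X) (B := L.Y₀ ⟹ X) (f := lam fun u => u)
      (S := fun u => sigma (L.Y₁ ⟹ X) fun v => pi L.S.pushout fun z => u (L.F z) ≐ v (L.G z))
      (T := fun u => sigma (L.Y₁ ⟹ X) fun v => L.fillerTy u v)
      (φ := fun u z => coerce <| (sigmaMap (A := L.Y₁ ⟹ X) (B := L.Y₁ ⟹ X)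
        (S := fun v => pi L.S.pushout fun z => u (L.F z) ≐ v (L.G z))
        (T := fun v => L.fillerTy u v) (lam fun v => v) fun v w => (L.filler w).coerce) z)
      (isEquivId _) fun u => coerce <|
    isEquivSigmaMap (A := L.Y₁ ⟹ X) (B := L.Y₁ ⟹ X) (f := lam fun v => v)
      (S := fun v => pi L.S.pushout fun z => u (L.F z) ≐ v (L.G z))
      (T := fun v => L.fillerTy u v) (φ := fun v w => (L.filler w).coerce) (isEquivId _) fun v => coerce <|
    pushoutUniversal L.S (fun z => u (L.F z) ≐ v (L.G z))
      (fun c x y => Sq (ap u (L.l c)) (ap v (L.r c)) x y)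
      (fun c _ _ => lam fun o => squareOfOver L.F L.G u v (L.S.push c) (L.β₀ c) (L.β₁ c) o)
      (fun c x _ => lam fun k =>
        coerce <| transportPath L.F L.G u v (L.S.push c) (L.β₀ c) (L.β₁ c) x ⊙ k)
      (fun c x y o => coerce <| compInvComp (z := y) (transportPath L.F L.G u v (L.S.push c) (L.β₀ c) (L.β₁ c) x) o.coerce)
      (fun c x y o => coerce <| invCompComp (z := y) (transportPath L.F L.G u v (L.S.push c) (L.β₀ c) (L.β₁ c) x) o.coerce)
      (fun w c => squareOfOver L.F L.G u v (L.S.push c) (L.β₀ c) (L.β₁ c) (apd w (L.S.push c)))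
      (fun _ _ => rfl') (f := lam fun w => (L.filler w).coerce)

end Legs

/-! ### Naturality of the decomposition of maps out of the total pushout. -/

namespace El

variable {X X' : Ty} (k : El (X ⟹ X'))

def apAppDef : El (Ty.pi U fun X => Ty.pi U fun X' => Ty.pi (X ⟹ X') fun k => Ty.pi U fun Y => Ty.pi (Y ⟹ X) fun u =>
    Ty.pi Y fun a => Ty.pi Y fun b => Ty.pi (a ≐ b) fun p => ap (lam fun y => k (u y)) p ≐ (ap k (ap u p)).coerce) :=
  lam fun X => lam fun X' => lam fun k => lam fun Y => lam fun u => lam fun a => lam fun b => lam fun p =>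
    J (fun _ p => ap (lam fun y => k (u y)) p ≐ (ap k (ap u p)).coerce) rfl' p

def apApp {Y : Ty} (u : El (Y ⟹ X)) {a b : El Y} (p : El (a ≐ b)) :
    El ((ap (lam fun y => k (u y)) p).coerce ≐ ap k (ap u p)) :=
  (glob 39 apAppDef X.code X'.code k.coerce Y.code u.coerce a.coerce b.coerce p.coerce).coerce

variable {Y₀ Y₁ : Ty}

/-- The first two sides of the image are the actions of the composites `k ∘ u` and `k ∘ v`, as the
type of fillers over these composites requires. The variant `apSq` has `ap k` applied to the given
sides instead; the two differ by `apApp`. -/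
def mapSqDef :=
  lam fun X : El U => lam fun X' : El U => lam fun k : El (X ⟹ X') => lam fun Y₀ : El U => lam fun Y₁ : El U =>
    lam fun u : El (Y₀ ⟹ X) => lam fun v : El (Y₁ ⟹ X) => lam fun a : El Y₀ => lam fun a' : El Y₀ =>
    lam fun b : El Y₁ => lam fun b' : El Y₁ => lam fun l : El (a ≐ a') => lam fun r : El (b ≐ b') =>
    lam fun p : El (u a ≐ v b) => lam fun q : El (u a' ≐ v b') => lam fun s : El (Sq (ap u l) (ap v r) p q) =>
      (J (fun _ l => carry (a := k (u a)) (b := k (v b)) (d := k (v b')) (ap (lam fun y => k (u y)) l).coerce (ap (lam fun y => k (v y)) r).coerce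
          (ap k p) ≐ ap k (carry (ap u l) (ap v r) p))
        (J (fun b' r => carry (a := k (u a)) (b := k (v b)) (d := k (v b')) (refl (k (u a))) (ap (lam fun y => k (v y)) r).coerce (ap k p) ≐
          ap k (carry (refl (u a)) (ap v r) p)) rfl' r).coerce l) ⊙ apf (fun q => ap k q) s

/-- The action of a function on a square whose first two sides come from paths. -/
def mapSq {u : El (Y₀ ⟹ X)} {v : El (Y₁ ⟹ X)} {a a' : El Y₀} {b b' : El Y₁} {l : El (a ≐ a')}
    {r : El (b ≐ b')} {p : El (u a ≐ v b)} {q : El (u a' ≐ v b')} (s : El (Sq (ap u l) (ap v r) p q)) :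
    El (Sq (a := k (u a)) (b := k (v b)) (c := k (u a')) (d := k (v b')) (ap (lam fun y => k (u y)) l).coerce
      (ap (lam fun y => k (v y)) r).coerce (ap k p) (ap k q)) :=
  (glob 40 mapSqDef
    X.code X'.code k.coerce Y₀.code Y₁.code u.coerce v.coerce a.coerce a'.coerce b.coerce b'.coerce l.coerce r.coerce
      p.coerce q.coerce s.coerce).coerce

abbrev squareOfOverNatTy : Ty :=
  pi U fun X => pi U fun X' => pi (X ⟹ X') fun k => pi U fun Y₀ => pi U fun Y₁ => pi U fun Z =>
  pi (Z ⟹ Y₀) fun F => pi (Z ⟹ Y₁) fun G => pi (Y₀ ⟹ X) fun u => pi (Y₁ ⟹ X) fun v =>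
  pi Z fun z => pi Z fun z' => pi (z ≐ z') fun π => pi (F z ≐ F z') fun l => pi (G z ≐ G z') fun r =>
  pi (ap F π ≐ l) fun β₀ => pi (ap G π ≐ r) fun β₁ => pi (pi Z fun z => u (F z) ≐ v (G z)) fun w =>
  coerce (squareOfOver F G (lam fun y => k (u y)) (lam fun y => k (v y)) π β₀ β₁
        (apd (coerce <| lam fun z => ap k (w z)) π)) ≐
      mapSq k (squareOfOver F G u v π β₀ β₁ (apd w π))

def squareOfOverNatProof : El squareOfOverNatTy :=
  lam fun X => lam fun X' => lam fun k => lam fun Y₀ => lam fun Y₁ => lam fun Z => lam fun F => lam fun G =>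
  lam fun u => lam fun v => lam fun z => lam fun z' => lam fun π => lam fun l => lam fun r => lam fun β₀ =>
  lam fun β₁ => lam fun w =>
  -- Stated for variable `π`, `β₀` and `β₁`, so that the inductions can be carried out on the
  -- identifications first and on `π` last.
  let P {z' : El Z} (π : El (z ≐ z')) {l : El (F z ≐ F z')} {r : El (G z ≐ G z')}
    (β₀ : El (ap F π ≐ l)) (β₁ : El (ap G π ≐ r)) : Ty :=
      coerce (squareOfOver F G (lam fun y => k (u y)) (lam fun y => k (v y)) π β₀ β₁
        (apd (coerce <| lam fun z => ap k (w z)) π)) ≐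
      mapSq k (squareOfOver F G u v π β₀ β₁ (apd w π))
  (J (fun _ β₀ => P π β₀ β₁) (J (fun _ β₁ => P π (refl (ap F π)) β₁)
    (J (fun _ π => P π (refl (ap F π)) (refl (ap G π))) rfl' π).coerce β₁).coerce β₀).coerce

/-- Naturality of the square given by a dependent path. -/
def squareOfOverNat {Z : Ty} (F : El (Z ⟹ Y₀)) (G : El (Z ⟹ Y₁)) (u : El (Y₀ ⟹ X)) (v : El (Y₁ ⟹ X))
    {z z' : El Z} (π : El (z ≐ z')) {l : El (F z ≐ F z')} {r : El (G z ≐ G z')}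
    (β₀ : El (ap F π ≐ l)) (β₁ : El (ap G π ≐ r)) (w : El (pi Z fun z => u (F z) ≐ v (G z))) :
    El (coerce (squareOfOver F G (lam fun y => k (u y)) (lam fun y => k (v y)) π β₀ β₁
        (apd (coerce <| lam fun z => ap k (w z)) π)) ≐
      mapSq k (squareOfOver F G u v π β₀ β₁ (apd w π))) :=
  (glob 41 squareOfOverNatProof X.code X'.code k.coerce Y₀.code Y₁.code Z.code F.coerce G.coerce u.coerce v.coerce z.coerce
    z'.coerce π.coerce l.coerce r.coerce β₀.coerce β₁.coerce w.coerce).coerce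

end El

namespace Legs

variable (L : Legs) {X X' : Ty} (k : El (X ⟹ X'))

abbrev mapFillerTy (L : Legs) : Ty := pi U fun X => pi U fun X' => pi (X ⟹ X') fun k => pi (L.Y₀ ⟹ X) fun u =>
  pi (L.Y₁ ⟹ X) fun v => L.fillerTy u v ⟹ L.fillerTy (lam fun y => k (u y)) (lam fun y => k (v y))

def mapFillerDef : El (piAll mapFillerTy) :=
  lamAll mapFillerTy fun L => lam fun X => lam fun X' => lam fun k => lam fun u => lam fun v => lam fun z =>
    let z : El (coconeType L.S (fun z => u (L.F z) ≐ v (L.G z)) fun c x y => Sq (ap u (L.l c)) (ap v (L.r c)) x y) :=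
      z.coerce
    coerce <| coconeTypeMk (S := L.S) (E := fun z => k (u (L.F z)) ≐ k (v (L.G z)))
      (K := fun c x y => Sq (ap (lam fun y => k (u y)) (L.l c)).coerce (ap (lam fun y => k (v y)) (L.r c)).coerce x y)
      (coerce <| lam fun a => ap k (coconeL z a)) (coerce <| lam fun b => ap k (coconeR z b))
      (coerce <| lam fun c => mapSq k (coconeP z c))

def mapFiller {u : El (L.Y₀ ⟹ X)} {v : El (L.Y₁ ⟹ X)} (z : El (L.fillerTy u v)) :
    El (L.fillerTy (lam fun y => k (u y)) (lam fun y => k (v y))) :=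
  (appAll (k := mapFillerTy) (glob 42 mapFillerDef) L X.code X'.code k.coerce u.coerce v.coerce z.coerce).coerce

abbrev mapCoconeTy (L : Legs) : Ty := pi U fun X => pi U fun X' => (X ⟹ X') ⟹ L.coconeTy X ⟹ L.coconeTy X'

def mapCoconeDef : El (piAll mapCoconeTy) :=
  lamAll mapCoconeTy fun L => lam fun X => lam fun X' => lam fun k => lam fun z =>
    withTriple z fun u v f => pair (lam fun y => k (u y)) <| pair (lam fun y => k (v y)) <| (L.mapFiller k f).coerce

def mapCocone (z : El (L.coconeTy X)) : El (L.coconeTy X') :=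
  (appAll (k := mapCoconeTy) (glob 43 mapCoconeDef) L X.code X'.code k.coerce z.coerce).coerce

abbrev evalNatTy : Ty :=
  piAll fun L => pi U fun X => pi U fun X' => pi (X ⟹ X') fun k => pi (L.span.pushout ⟹ X) fun h =>
    L.eval (lam fun y => k (h y)) ≐ L.mapCocone k (L.eval h)

def evalNatProof : El evalNatTy :=
  lamAll (fun L => pi U fun X => pi U fun X' => pi (X ⟹ X') fun k => pi (L.span.pushout ⟹ X) fun h =>
    L.eval (lam fun y => k (h y)) ≐ L.mapCocone k (L.eval h)) fun L =>
  lam fun X => lam fun X' => lam fun k => lam fun h =>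
    let u : El (L.Y₀ ⟹ X) := lam fun y => h (L.span.inl y)
    let v : El (L.Y₁ ⟹ X) := lam fun y => h (L.span.inr y)
    let ku : El (L.Y₀ ⟹ X') := lam fun y => k (h (L.span.inl y))
    let kv : El (L.Y₁ ⟹ X') := lam fun y => k (h (L.span.inr y))
    let w : El (pi L.S.pushout fun z => u (L.F z) ≐ v (L.G z)) := coerce <| lam fun z => ap h (L.span.push z)
    let W : Ty := pi L.S.pushout fun z => ku (L.F z) ≐ kv (L.G z)
    let w₁ : El W := coerce <| lam fun z => ap (lam fun y => k (h y)) (L.span.push z)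
    let w₂ : El W := coerce <| lam fun z => ap k (w z)
    let E (z : El L.S.pushout) : Ty := ku (L.F z) ≐ kv (L.G z)
    let K := fun (c : El L.S.C) (x : El (E (L.S.inl (L.S.f c)))) (y : El (E (L.S.inr (L.S.g c)))) =>
      Sq (ap ku (L.l c)) (ap kv (L.r c)) x y
    let l : El (pi L.S.A fun a => E (L.S.inl a)) := lam fun a => w₂ (L.S.inl a)
    let r : El (pi L.S.B fun b => E (L.S.inr b)) := lam fun b => w₂ (L.S.inr b)
    let s : El (pi L.S.C fun c => K c (l (L.S.f c)) (r (L.S.g c))) :=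
      lam fun c => coerce <| squareOfOver L.F L.G ku kv (L.S.push c) (L.β₀ c) (L.β₁ c) (apd w₂ (L.S.push c))
    let s' : El (pi L.S.C fun c => K c (l (L.S.f c)) (r (L.S.g c))) :=
      lam fun c => coerce <| mapSq k (squareOfOver L.F L.G u v (L.S.push c) (L.β₀ c) (L.β₁ c) (apd w (L.S.push c)))
    let mk (s : El (pi L.S.C fun c => K c (l (L.S.f c)) (r (L.S.g c)))) : El (L.fillerTy ku kv) :=
      (coconeTypeMk (S := L.S) (E := E) (K := K) l r s).coerce
    -- The action of `k ∘ h` on paths is not the iterated action by conversion: `apApp` and function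
    -- extensionality pass from `w₁` to `w₂`. The values at the two point constructors then agree,
    -- and `squareOfOverNat` compares the squares.
    let e : El (L.filler w₁ ≐ mk s') :=
      apf (fun w : El W => L.filler w) (funExt (f := w₁) (g := w₂) <| coerce <| lam fun z => apApp k h (L.span.push z)) ⊙
      apf mk (funExt (f := s) (g := s') <| coerce <| lam fun c =>
        squareOfOverNat k L.F L.G u v (L.S.push c) (L.β₀ c) (L.β₁ c) w)
    (apf (fun f : El (L.fillerTy ku kv) =>
      pair (B := fun u => sigma (L.Y₁ ⟹ X') fun v => L.fillerTy u v) ku (pair kv f)) e).coerce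

end Legs

/-! ### Sides of squares: composites of a path with the images of two others. -/

namespace El

section

variable {A B Y X : Ty} (i : El (A ⟹ Y)) (j : El (B ⟹ Y)) (u : El (Y ⟹ X)) {a a' : El A} {b b' : El B}
  (p : El (a ≐ a')) (q : El (i a' ≐ j b')) (r : El (b ≐ b'))

/-- This is the shape of the value of `pushoutMap` on `push`; the same shape, in the target `X`,
occurs after maps have been decomposed. -/
def sideDef :=
  lam fun A : El U => lam fun B : El U => lam fun Y : El U => lam fun i : El (A ⟹ Y) => lam fun j : El (B ⟹ Y) =>
  lam fun a : El A => lam fun a' : El A => lam fun b : El B => lam fun b' : El B => lam fun p : El (a ≐ a') =>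
  lam fun q : El (i a' ≐ j b') => lam fun r : El (b ≐ b') =>
    (ap i p ⊙ q ⊙ inv (ap j r)).coerce (B := i a ≐ j b)

/-- The composite of the images of `p` and of `r⁻¹` with a path between them. -/
def side : El (i a ≐ j b) :=
  (glob 45 sideDef A.code B.code Y.code i.coerce j.coerce a.coerce a'.coerce b.coerce b'.coerce p.coerce q.coerce
    r.coerce).coerce

/-- The endpoints of `q` move with `p` and `r`, so `q` is quantified in the motive of the first two
inductions and comes last. -/
def apSideDef :=
  lam fun A : El U => lam fun B : El U => lam fun Y : El U => lam fun X : El U => lam fun i : El (A ⟹ Y) =>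
  lam fun j : El (B ⟹ Y) => lam fun u : El (Y ⟹ X) => lam fun a : El A => lam fun a' : El A =>
  lam fun b : El B => lam fun b' : El B => lam fun p : El (a ≐ a') => lam fun q : El (i a' ≐ j b') =>
  lam fun r : El (b ≐ b') =>
    let P {a' : El A} (p : El (a ≐ a')) {b' : El B} (q : El (i a' ≐ j b')) (r : El (b ≐ b')) : Ty :=
      ap u (side i j p q r) ≐ (side (lam fun a => u (i a)) (lam fun b => u (j b)) p (ap u q).coerce r).coerce
    app (A := i a' ≐ j b') (B := fun q => P p q r) (ann <| J (fun a' p => Ty.pi (i a' ≐ j b') fun q => P p q r)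
      (J (fun b' r => Ty.pi (i a ≐ j b') fun q => P (refl a) q r)
        (lam fun q : El (i a ≐ j b) =>
          J (fun y q => ap u (refl (i a) ⊙ q ⊙ inv (refl y)) ≐ (refl (u (i a)) ⊙ ap u q ⊙ inv (refl (u y))))
            rfl' q).coerce r) p) q

def apSide : El (ap u (side i j p q r) ≐ (side (lam fun a => u (i a)) (lam fun b => u (j b)) p (ap u q).coerce r).coerce) :=
  (glob 46 apSideDef A.code B.code Y.code X.code i.coerce j.coerce u.coerce a.coerce a'.coerce b.coerce
    b'.coerce p.coerce q.coerce r.coerce).coerce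

end

section

variable {A : Ty} {a b c d : El A} {l l' : El (a ≐ c)} {r r' : El (b ≐ d)} {t : El (a ≐ b)} {t' : El (c ≐ d)}

def sqCastDef :=
  lam fun A : El U => lam fun a : El A => lam fun b : El A => lam fun c : El A => lam fun d : El A =>
    lam fun l : El (a ≐ c) => lam fun l' : El (a ≐ c) => lam fun r : El (b ≐ d) => lam fun r' : El (b ≐ d) =>
    lam fun t : El (a ≐ b) => lam fun t' : El (c ≐ d) => lam fun e : El (l ≐ l') => lam fun e' : El (r ≐ r') =>
      J (fun l' _ => Sq l r t t' ⟹ Sq l' r' t t') (J (fun r' _ => Sq l r t t' ⟹ Sq l r' t t')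
        (lam fun s : El (Sq l r t t') => s) e') e

/-- Change of the first two sides of a square. -/
def sqCast (e : El (l ≐ l')) (e' : El (r ≐ r')) : El (Sq l r t t' ⟹ Sq l' r' t t') :=
  ((glob 47 sqCastDef)
    A.code a.coerce b.coerce c.coerce d.coerce l.coerce l'.coerce r.coerce r'.coerce t.coerce t'.coerce
    e.coerce e'.coerce).coerce

abbrev sqCastEquivTy : Ty :=
  pi U fun A => pi A fun a => pi A fun b => pi A fun c => pi A fun d =>
    pi (a ≐ c) fun l => pi (a ≐ c) fun l' => pi (b ≐ d) fun r => pi (b ≐ d) fun r' =>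
    pi (a ≐ b) fun t => pi (c ≐ d) fun t' => pi (l ≐ l') fun e => pi (r ≐ r') fun e' =>
      isEquiv (A := Sq l r t t') (B := Sq l' r' t t') (sqCast e e')

def sqCastEquivProof : El sqCastEquivTy :=
  lam fun A => lam fun a => lam fun b => lam fun c => lam fun d =>
    lam fun l => lam fun l' => lam fun r => lam fun r' => lam fun t => lam fun t' => lam fun e => lam fun e' =>
      J (fun l' e => isEquiv (A := Sq l r t t') (B := Sq l' r' t t') (sqCast e e'))
        (J (fun r' e' => isEquiv (A := Sq l r t t') (B := Sq l r' t t') (sqCast (refl l) e'))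
          (isEquivId (Sq l r t t')).coerce e') e

def sqCastEquiv (e : El (l ≐ l')) (e' : El (r ≐ r')) :
    El (isEquiv (A := Sq l r t t') (B := Sq l' r' t t') (sqCast e e')) :=
  (glob 48 sqCastEquivProof A.code a.coerce b.coerce c.coerce d.coerce l.coerce l'.coerce r.coerce r'.coerce t.coerce
    t'.coerce e.coerce e'.coerce).coerce

def apSqDef :=
  lam fun A : El U => lam fun X : El U => lam fun k : El (A ⟹ X) => lam fun a : El A => lam fun b : El A =>
    lam fun c : El A => lam fun d : El A =>
    lam fun l : El (a ≐ c) => lam fun r : El (b ≐ d) => lam fun t : El (a ≐ b) => lam fun t' : El (c ≐ d) =>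
    lam fun s : El (Sq l r t t') =>
      J (fun _ l => carry (ap k l) (ap k r) (ap k t) ≐ ap k (carry l r t))
        (J (fun d r => carry (refl (k a)) (ap k r) (ap k t) ≐ ap k (carry (refl a) r t)) rfl' r).coerce l ⊙
      apf (fun t => ap k t) s

/-- The action of a function on squares. -/
def apSq {X : Ty} (k : El (A ⟹ X)) (s : El (Sq l r t t')) : El (Sq (ap k l) (ap k r) (ap k t) (ap k t')) :=
  ((glob 49 apSqDef)
    A.code X.code k.coerce a.coerce b.coerce c.coerce d.coerce l.coerce r.coerce t.coerce t'.coerce s.coerce).coerce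

end

section

variable {X X' Y Y' A B A' B' : Ty} (k : El (X ⟹ X')) (i : El (A ⟹ Y)) (j : El (B ⟹ Y)) (i' : El (A' ⟹ Y'))
  (j' : El (B' ⟹ Y')) (u : El (Y ⟹ X)) (v : El (Y' ⟹ X))
  {a₀ a₁ : El A} {b₀ b₁ : El B} {a₀' a₁' : El A'} {b₀' b₁' : El B'}
  (p : El (a₀ ≐ a₁)) (q : El (i a₁ ≐ j b₁)) (r : El (b₀ ≐ b₁))
  (p' : El (a₀' ≐ a₁')) (q' : El (i' a₁' ≐ j' b₁')) (r' : El (b₀' ≐ b₁'))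
  (t : El (u (i a₀) ≐ v (i' a₀'))) (t' : El (u (j b₀) ≐ v (j' b₀')))
  (s : El (Sq (ap u (side i j p q r)) (ap v (side i' j' p' q' r')) t t'))

def apSideCompDef :=
  lam fun X : El U => lam fun X' : El U => lam fun Y : El U => lam fun A : El U => lam fun B : El U =>
  lam fun k : El (X ⟹ X') => lam fun i : El (A ⟹ Y) => lam fun j : El (B ⟹ Y) => lam fun u : El (Y ⟹ X) =>
  lam fun a₀ : El A => lam fun a₁ : El A => lam fun b₀ : El B => lam fun b₁ : El B => lam fun p : El (a₀ ≐ a₁) =>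
  lam fun q : El (i a₁ ≐ j b₁) => lam fun r : El (b₀ ≐ b₁) =>
    let S (q : El (k (u (i a₁)) ≐ k (u (j b₁)))) : El (k (u (i a₀)) ≐ k (u (j b₀))) :=
      (side (lam fun a => k (u (i a))) (lam fun b => k (u (j b))) p q.coerce r).coerce
    let e : El ((ap (lam fun y => k (u y)) (side i j p q r)).coerce ≐ S (ap (lam fun y => k (u y)) q).coerce) :=
      (apSide i j (lam fun y => k (u y)) p q r).coerce
    let e' : El ((ap (lam fun y => k (u y)) q).coerce ≐ ap k (ap u q)) := apApp k u q
    e ⊙ apf S e'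

/-- The comparison of the two ways to apply the composite of two functions to a side. -/
def apSideComp : El ((ap (lam fun y => k (u y)) (side i j p q r)).coerce ≐
    side (lam fun a => k (u (i a))) (lam fun b => k (u (j b))) p (ap k (ap u q)).coerce r) :=
  (glob 50 apSideCompDef X.code X'.code Y.code A.code B.code k.coerce i.coerce j.coerce u.coerce a₀.coerce
    a₁.coerce b₀.coerce b₁.coerce p.coerce q.coerce r.coerce).coerce

/-- Naturality of the decomposition of squares. -/
abbrev sideNatTy : Ty :=
  let su : El (u (i a₀) ≐ u (j b₀)) := (side (lam fun a => u (i a)) (lam fun b => u (j b)) p (ap u q).coerce r).coerce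
  let sv : El (v (i' a₀') ≐ v (j' b₀')) :=
    (side (lam fun a => v (i' a)) (lam fun b => v (j' b)) p' (ap v q').coerce r').coerce
  let ku : El (k (u (i a₀)) ≐ k (u (j b₀))) :=
    (side (lam fun a => k (u (i a))) (lam fun b => k (u (j b))) p (ap k (ap u q)).coerce r).coerce
  let kv : El (k (v (i' a₀')) ≐ k (v (j' b₀'))) :=
    (side (lam fun a => k (v (i' a))) (lam fun b => k (v (j' b))) p' (ap k (ap v q')).coerce r').coerce
  let l : El (k (u (i a₀)) ≐ k (u (j b₀))) := (ap (lam fun y => k (u y)) (side i j p q r)).coerce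
  let l' : El (k (v (i' a₀')) ≐ k (v (j' b₀'))) := (ap (lam fun y => k (v y)) (side i' j' p' q' r')).coerce
  let e : El (ap k su ≐ ku) := (apSide (lam fun a => u (i a)) (lam fun b => u (j b)) k p (ap u q).coerce r).coerce
  let e' : El (ap k sv ≐ kv) :=
    (apSide (lam fun a => v (i' a)) (lam fun b => v (j' b)) k p' (ap v q').coerce r').coerce
  let s₁ : El (Sq su sv t t') := sqCast (apSide i j u p q r).coerce (apSide i' j' v p' q' r').coerce s
  sqCast (l := l) (r := l') (l' := ku) (r' := kv) (t := ap k t) (t' := ap k t')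
    (apSideComp k i j u p q r).coerce (apSideComp k i' j' v p' q' r').coerce (coerce (mapSq k s)) ≐
  sqCast e e' (apSq k s₁)

end

abbrev sideNatAllTy : Ty :=
  pi U fun X => pi U fun X' => pi U fun Y => pi U fun Y' => pi U fun A => pi U fun B => pi U fun A' => pi U fun B' =>
  pi (X ⟹ X') fun k => pi (A ⟹ Y) fun i => pi (B ⟹ Y) fun j => pi (A' ⟹ Y') fun i' => pi (B' ⟹ Y') fun j' =>
  pi (Y ⟹ X) fun u => pi (Y' ⟹ X) fun v =>
  pi A fun a₀ => pi A fun a₁ => pi B fun b₀ => pi B fun b₁ =>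
  pi A' fun a₀' => pi A' fun a₁' => pi B' fun b₀' => pi B' fun b₁' =>
  pi (a₀ ≐ a₁) fun p => pi (b₀ ≐ b₁) fun r => pi (a₀' ≐ a₁') fun p' => pi (b₀' ≐ b₁') fun r' =>
  pi (i a₁ ≐ j b₁) fun q => pi (i' a₁' ≐ j' b₁') fun q' =>
  pi (u (i a₀) ≐ v (i' a₀')) fun t => pi (u (j b₀) ≐ v (j' b₀')) fun t' =>
  pi (Sq (ap u (side i j p q r)) (ap v (side i' j' p' q' r')) t t') fun s =>
    sideNatTy k i j i' j' u v p q r p' q' r' t t' s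

/-- The two ways of applying `k` to a square and straightening its sides, `k` first or straightening
first, agree. Once all paths and the square itself are constant, every cast is trivial. -/
def sideNatProof : El sideNatAllTy :=
  lam fun X => lam fun X' => lam fun Y => lam fun Y' => lam fun A => lam fun B => lam fun A' => lam fun B' =>
  lam fun k => lam fun i => lam fun j => lam fun i' => lam fun j' => lam fun u => lam fun v =>
  lam fun a₀ => lam fun a₁ => lam fun b₀ => lam fun b₁ => lam fun a₀' => lam fun a₁' => lam fun b₀' => lam fun b₁' =>
  lam fun p => lam fun r => lam fun p' => lam fun r' =>
    let P {a₁ : El A} {b₁ : El B} {a₁' : El A'} {b₁' : El B'} (p : El (a₀ ≐ a₁)) (r : El (b₀ ≐ b₁))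
        (p' : El (a₀' ≐ a₁')) (r' : El (b₀' ≐ b₁')) : Ty :=
      pi (i a₁ ≐ j b₁) fun q => pi (i' a₁' ≐ j' b₁') fun q' =>
      pi (u (i a₀) ≐ v (i' a₀')) fun t => pi (u (j b₀) ≐ v (j' b₀')) fun t' =>
      pi (Sq (ap u (side i j p q r)) (ap v (side i' j' p' q' r')) t t') fun s =>
        sideNatTy k i j i' j' u v p q r p' q' r' t t' s
    -- Induction on `q` needs a free endpoint, whereas `q` ends at `j b₀`. Replacing `j` and `j'` by
    -- constant functions frees the endpoints; as `r` and `r'` are already constant, the statement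
    -- for `j` and `j'` is recovered by conversion.
    let Q {y : El Y} {y' : El Y'} (q : El (i a₀ ≐ y)) (q' : El (i' a₀' ≐ y'))
        (t : El (u (i a₀) ≐ v (i' a₀'))) (t' : El (u y ≐ v y')) (s : El (Sq (ap u q) (ap v q') t t')) : Ty :=
      sideNatTy k i (lam fun _ : El B => y) i' (lam fun _ : El B' => y') u v (refl a₀) (b₁ := b₀) q.coerce (refl b₀)
        (refl a₀') (b₁' := b₀') q'.coerce (refl b₀') t t'.coerce s.coerce
    J (fun _ p => P p r p' r') (J (fun _ r => P (refl a₀) r p' r') (J (fun _ p' => P (refl a₀) (refl b₀) p' r')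
      (J (fun _ r' => P (refl a₀) (refl b₀) (refl a₀') r')
        (coerce <| lam fun q : El (i a₀ ≐ j b₀) => lam fun q' : El (i' a₀' ≐ j' b₀') => lam fun t : El (u (i a₀) ≐ v (i' a₀')) =>
        J (fun y q => pi (u y ≐ v (j' b₀')) fun t' => pi (Sq (ap u (refl (i a₀) ⊙ q)) (ap v (refl (i' a₀') ⊙ q')) t t') fun s =>
            Q q q' t t' s.coerce)
          (coerce <| J (fun y' q' => pi (u (i a₀) ≐ v y') fun t' => pi (Sq (refl (u (i a₀))) (ap v (refl (i' a₀') ⊙ q')) t t') fun s =>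
              Q (refl (i a₀)) q' t t' s.coerce)
            (coerce <| lam fun t' : El (u (i a₀) ≐ v (i' a₀')) => lam fun s : El (t ≐ t') =>
              J (fun t' s => Q (refl (i a₀)) (refl (i' a₀')) t t' s.coerce) rfl' s) q') q) r').coerce p').coerce r).coerce p

end El

/-- Induction on cocones. -/
def coconeInd {A B C : Ty} {L : El A → Ty} {R : El B → Ty} {f : El (C ⟹ A)} {g : El (C ⟹ B)}
    {K : (c : El C) → El (L (f c)) → El (R (g c)) → Ty} (P : El (cocone L R f g K) → Ty)
    (d : (l : El (pi A L)) → (r : El (pi B R)) → (k : El (pi C fun c => K c (l (f c)) (r (g c)))) →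
      El (P (coconeMk l r k))) (z : El (cocone L R f g K)) : El (P z) :=
  (split (A := pi A L) (B := fun l => sigma (pi B R) fun r => pi C fun c => K c (l (f c)) (r (g c)))
    (fun z => P z.coerce)
    (fun l z => coerce <| split (A := pi B R) (B := fun r => pi C fun c => K c (l (f c)) (r (g c)))
      (fun z => P (coerce <| pair (A := pi A L) (B := fun l => sigma (pi B R) fun r => pi C fun c => K c (l (f c)) (r (g c))) l z))
      (fun r k => (d l r k).coerce) z)
    (coconePair z)).coerce

def coconeMapDef :=
  lam fun A : El U => lam fun B : El U => lam fun C : El U => lam fun L : El (A ⟹ U) => lam fun R : El (B ⟹ U) =>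
  lam fun f : El (C ⟹ A) => lam fun g : El (C ⟹ B) => lam fun K : El (pi C fun c => L (f c) ⟹ R (g c) ⟹ U) =>
  lam fun K' : El (pi C fun c => L (f c) ⟹ R (g c) ⟹ U) =>
  lam fun φ : El (pi C fun c => pi (L (f c)) fun x => pi (R (g c)) fun y => K c x y ⟹ K' c x y) =>
  lam fun z : El (coconeOf A B C L R f g K) => (coconeMk (L := fun a => L a) (R := fun b => R b)
    (K := fun c x y => K' c x y) (coconeL z) (coconeR z)
    (lam fun c => φ c (coconeL z (f c)) (coconeR z (g c)) (coconeP z c))).coerce (B := coconeOf A B C L R f g K')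

/-- The map of cocones given by a map of the path data. -/
def coconeMap {A B C : Ty} {L : El A → Ty} {R : El B → Ty} {f : El (C ⟹ A)} {g : El (C ⟹ B)}
    {K K' : (c : El C) → El (L (f c)) → El (R (g c)) → Ty} (φ : ∀ c x y, El (K c x y ⟹ K' c x y)) :
    El (cocone L R f g K ⟹ cocone L R f g K') :=
  (glob 52 coconeMapDef A.code B.code C.code (lam fun a => (L a).code) (lam fun b => (R b).code) f.coerce g.coerce
    (coerce <| lam fun c => lam fun x => lam fun y => (K c x y).code)
    (coerce <| lam fun c => lam fun x => lam fun y => (K' c x y).code)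
    (coerce <| lam fun c => lam fun x => lam fun y => φ c x y)).coerce

abbrev coconeMapEquivTy : Ty :=
  pi U fun A => pi U fun B => pi U fun C => pi (A ⟹ U) fun L => pi (B ⟹ U) fun R => pi (C ⟹ A) fun f =>
  pi (C ⟹ B) fun g => pi (pi C fun c => L (f c) ⟹ R (g c) ⟹ U) fun K =>
  pi (pi C fun c => L (f c) ⟹ R (g c) ⟹ U) fun K' =>
  pi (pi C fun c => pi (L (f c)) fun x => pi (R (g c)) fun y => K c x y ⟹ K' c x y) fun φ =>
  (pi C fun c => pi (L (f c)) fun x => pi (R (g c)) fun y => isEquiv (A := K c x y) (B := K' c x y) (φ c x y)) ⟹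
    isEquiv (coconeMap (L := fun a => L a) (R := fun b => R b) (f := f) (g := g) (K := fun c x y => K c x y)
      (K' := fun c x y => K' c x y) fun c x y => φ c x y)

def coconeMapEquivProof : El coconeMapEquivTy :=
  lam fun A => lam fun B => lam fun C => lam fun L => lam fun R => lam fun f => lam fun g =>
  lam fun K => lam fun K' => lam fun φ => lam fun e =>
    let T := cocone (fun a : El A => L a) (fun b : El B => R b) f g fun c x y => K c x y
    let T' := cocone (fun a : El A => L a) (fun b : El B => R b) f g fun c x y => K' c x y
    let mk (l : El (pi A fun a => L a)) (r : El (pi B fun b => R b)) (k : El (pi C fun c => K c (l (f c)) (r (g c)))) :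
      El T := coconeMk l r k
    let mk' (l : El (pi A fun a => L a)) (r : El (pi B fun b => R b)) (k : El (pi C fun c => K' c (l (f c)) (r (g c)))) :
      El T' := coconeMk l r k
    let F : El (T ⟹ T') := coconeMap fun c x y => φ c x y
    let G : El (T' ⟹ T) := coconeMap fun c x y => linv (e c x y)
    let G' : El (T' ⟹ T) := coconeMap fun c x y => rinv (e c x y)
    mkEquiv₂ (f := F) G (lam fun z => coconeInd (fun z => G (F z) ≐ z) (fun l r k => coerce <|
        apf (mk l r) (funExt (f := lam fun c => linv (e c (l (f c)) (r (g c))) (φ c (l (f c)) (r (g c)) (k c)))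
          (g := k) (coerce <| lam fun c => linv_apply (e c (l (f c)) (r (g c))) (k c)))) z)
      G' (lam fun z => coconeInd (fun z => F (G' z) ≐ z) (fun l r k => coerce <|
        apf (mk' l r) (funExt (f := lam fun c => φ c (l (f c)) (r (g c)) (rinv (e c (l (f c)) (r (g c))) (k c)))
          (g := k) (coerce <| lam fun c => apply_rinv (e c (l (f c)) (r (g c))) (k c)))) z)

def coconeMapEquiv {A B C : Ty} {L : El A → Ty} {R : El B → Ty} {f : El (C ⟹ A)} {g : El (C ⟹ B)}
    {K K' : (c : El C) → El (L (f c)) → El (R (g c)) → Ty} (φ : ∀ c x y, El (K c x y ⟹ K' c x y))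
    (e : ∀ c x y, El (isEquiv (φ c x y))) : El (isEquiv (coconeMap φ)) :=
  (glob 53 coconeMapEquivProof A.code B.code C.code (lam fun a => (L a).code) (lam fun b => (R b).code) f.coerce g.coerce
    (coerce <| lam fun c => lam fun x => lam fun y => (K c x y).code)
    (coerce <| lam fun c => lam fun x => lam fun y => (K' c x y).code)
    (coerce <| lam fun c => lam fun x => lam fun y => φ c x y)
    (coerce <| lam fun c => lam fun x => lam fun y => e c x y)).coerce

/-! #### Diagrams -/

/-- The diagrams of the theorem: three columns, maps between them and homotopies. -/
structure Diagram where
  (S₀ S₂ S₄ : Span)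
  a : El (S₂.A ⟹ S₀.A)
  a' : El (S₂.A ⟹ S₄.A)
  b : El (S₂.B ⟹ S₀.B)
  b' : El (S₂.B ⟹ S₄.B)
  c : El (S₂.C ⟹ S₀.C)
  c' : El (S₂.C ⟹ S₄.C)
  p : El (pi S₂.C fun x => a (S₂.f x) ≐ S₀.f (c x))
  p' : El (pi S₂.C fun x => a' (S₂.f x) ≐ S₄.f (c' x))
  r : El (pi S₂.C fun x => b (S₂.g x) ≐ S₀.g (c x))
  r' : El (pi S₂.C fun x => b' (S₂.g x) ≐ S₄.g (c' x))

namespace Diagram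

abbrev piAll (k : Diagram → Ty) : Ty :=
  piSpan fun S₀ => piSpan fun S₂ => piSpan fun S₄ => pi (S₂.A ⟹ S₀.A) fun a => pi (S₂.A ⟹ S₄.A) fun a' =>
  pi (S₂.B ⟹ S₀.B) fun b => pi (S₂.B ⟹ S₄.B) fun b' => pi (S₂.C ⟹ S₀.C) fun c => pi (S₂.C ⟹ S₄.C) fun c' =>
  pi (pi S₂.C fun x => a (S₂.f x) ≐ S₀.f (c x)) fun p => pi (pi S₂.C fun x => a' (S₂.f x) ≐ S₄.f (c' x)) fun p' =>
  pi (pi S₂.C fun x => b (S₂.g x) ≐ S₀.g (c x)) fun r => pi (pi S₂.C fun x => b' (S₂.g x) ≐ S₄.g (c' x)) fun r' =>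
    k ⟨S₀, S₂, S₄, a, a', b, b', c, c', p, p', r, r'⟩

def lamAll (k : Diagram → Ty) (d : (D : Diagram) → El (k D)) : El (piAll k) :=
  lam fun A₀ => lam fun B₀ => lam fun C₀ => lam fun f₀ => lam fun g₀ =>
  lam fun A₂ => lam fun B₂ => lam fun C₂ => lam fun f₂ => lam fun g₂ =>
  lam fun A₄ => lam fun B₄ => lam fun C₄ => lam fun f₄ => lam fun g₄ =>
  lam fun a => lam fun a' => lam fun b => lam fun b' => lam fun c => lam fun c' => lam fun p => lam fun p' =>
  lam fun r => lam fun r' => d ⟨⟨A₀, B₀, C₀, f₀, g₀⟩, ⟨A₂, B₂, C₂, f₂, g₂⟩, ⟨A₄, B₄, C₄, f₄, g₄⟩,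
    a, a', b, b', c, c', p, p', r, r'⟩

def appAll {k : Diagram → Ty} (d : El (piAll k)) (D : Diagram) : El (k D) :=
  (d D.S₀.A.code D.S₀.B.code D.S₀.C.code D.S₀.f.coerce D.S₀.g.coerce
    D.S₂.A.code D.S₂.B.code D.S₂.C.code D.S₂.f.coerce D.S₂.g.coerce
    D.S₄.A.code D.S₄.B.code D.S₄.C.code D.S₄.f.coerce D.S₄.g.coerce
    D.a.coerce D.a'.coerce D.b.coerce D.b'.coerce D.c.coerce D.c'.coerce D.p.coerce D.p'.coerce D.r.coerce
    D.r'.coerce).coerce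

abbrev lTy (D : Diagram) : Ty := pi D.S₂.C fun x => D.S₀.inl (D.a (D.S₂.f x)) ≐ D.S₀.inr (D.b (D.S₂.g x))

def lDef : El (piAll lTy) :=
  lamAll lTy fun D => lam fun x => side D.S₀.inl D.S₀.inr (D.p x) (D.S₀.push (D.c x)) (D.r x)

abbrev l'Ty (D : Diagram) : Ty := pi D.S₂.C fun x => D.S₄.inl (D.a' (D.S₂.f x)) ≐ D.S₄.inr (D.b' (D.S₂.g x))

def l'Def : El (piAll l'Ty) :=
  lamAll l'Ty fun D => lam fun x => side D.S₄.inl D.S₄.inr (D.p' x) (D.S₄.push (D.c' x)) (D.r' x)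

variable (D : Diagram) {X X' : Ty}

/-- The first two sides of the squares, before the decomposition of maps. -/
def l : El D.lTy := appAll (k := lTy) (glob 54 lDef) D

def l' : El D.l'Ty := appAll (k := l'Ty) (glob 55 l'Def) D

abbrev fillerTyTy (D : Diagram) : Ty := pi U fun X => (D.S₀.pushout ⟹ X) ⟹ (D.S₄.pushout ⟹ X) ⟹ U

/-- The fillers over maps on the outer columns, as cocones. -/
abbrev fillerCocone (u : El (D.S₀.pushout ⟹ X)) (v : El (D.S₄.pushout ⟹ X)) : Ty :=
  cocone (fun x => u (D.S₀.inl (D.a x)) ≐ v (D.S₄.inl (D.a' x))) (fun x => u (D.S₀.inr (D.b x)) ≐ v (D.S₄.inr (D.b' x)))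
    D.S₂.f D.S₂.g fun x t t' => Sq (ap u (D.l x)) (ap v (D.l' x)) t t'

def fillerTyDef : El (piAll fillerTyTy) :=
  lamAll fillerTyTy fun D => lam fun X => lam fun u => lam fun v => code <| D.fillerCocone u v

/-- The fillers over maps on the outer columns. -/
def fillerTy (u : El (D.S₀.pushout ⟹ X)) (v : El (D.S₄.pushout ⟹ X)) : Ty :=
  appAll (k := fillerTyTy) (glob 56 fillerTyDef) D X.code u.coerce v.coerce

abbrev mapsTy (X : Ty) : Ty :=
  sigma (D.S₀.pushout ⟹ X) fun u => sigma (D.S₄.pushout ⟹ X) fun v => D.fillerTy u v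

/-- Quantification over the components of cocones on the outer columns. -/
abbrev piComponents (D : Diagram) (k : (X : El U) → (g : El (D.S₀.A ⟹ X)) → (g' : El (D.S₀.B ⟹ X)) →
    El (pi D.S₀.C fun x => g (D.S₀.f x) ≐ g' (D.S₀.g x)) → (h : El (D.S₄.A ⟹ X)) → (h' : El (D.S₄.B ⟹ X)) →
    El (pi D.S₄.C fun x => h (D.S₄.f x) ≐ h' (D.S₄.g x)) → Ty) : Ty :=
  pi U fun X => pi (D.S₀.A ⟹ X) fun g => pi (D.S₀.B ⟹ X) fun g' =>
    pi (pi D.S₀.C fun x => g (D.S₀.f x) ≐ g' (D.S₀.g x)) fun P => pi (D.S₄.A ⟹ X) fun h => pi (D.S₄.B ⟹ X) fun h' =>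
    pi (pi D.S₄.C fun x => h (D.S₄.f x) ≐ h' (D.S₄.g x)) fun Q => k X g g' P h h' Q

/-- The squares with sides in given cocones on the outer columns, as cocones. -/
abbrev squaresCocone (g : El (D.S₀.A ⟹ X)) (g' : El (D.S₀.B ⟹ X)) (P : El (pi D.S₀.C fun x => g (D.S₀.f x) ≐ g' (D.S₀.g x)))
    (h : El (D.S₄.A ⟹ X)) (h' : El (D.S₄.B ⟹ X)) (Q : El (pi D.S₄.C fun x => h (D.S₄.f x) ≐ h' (D.S₄.g x))) : Ty :=
  cocone (fun x => g (D.a x) ≐ h (D.a' x)) (fun x => g' (D.b x) ≐ h' (D.b' x)) D.S₂.f D.S₂.g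
    fun x t t' => Sq (side g g' (D.p x) (P (D.c x)) (D.r x)) (side h h' (D.p' x) (Q (D.c' x)) (D.r' x)) t t'

abbrev squaresTyOfTy (D : Diagram) : Ty := piComponents D fun _ _ _ _ _ _ _ => U

def squaresTyOfDef : El (piAll squaresTyOfTy) :=
  lamAll squaresTyOfTy fun D => lam fun X => lam fun g => lam fun g' => lam fun P => lam fun h => lam fun h' => lam fun Q =>
    code <| D.squaresCocone g g' P h h' Q

/-- The squares with sides in given cocones on the outer columns. -/
def squaresTyOf (g : El (D.S₀.A ⟹ X)) (g' : El (D.S₀.B ⟹ X)) (P : El (pi D.S₀.C fun x => g (D.S₀.f x) ≐ g' (D.S₀.g x)))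
    (h : El (D.S₄.A ⟹ X)) (h' : El (D.S₄.B ⟹ X)) (Q : El (pi D.S₄.C fun x => h (D.S₄.f x) ≐ h' (D.S₄.g x))) : Ty :=
  appAll (k := squaresTyOfTy) (glob 57 squaresTyOfDef) D X.code g.coerce g'.coerce P.coerce h.coerce
    h'.coerce Q.coerce

abbrev squaresTyTy (D : Diagram) : Ty := pi U fun X => evalTy D.S₀ X ⟹ evalTy D.S₄ X ⟹ U

def squaresTyDef : El (piAll squaresTyTy) :=
  lamAll squaresTyTy fun D => lam fun X => lam fun z => lam fun z' => code <|
    D.squaresTyOf (coconeL z) (coconeR z) (coerce <| coconeP z) (coconeL z') (coconeR z') (coerce <| coconeP z')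

def squaresTy (z : El (evalTy D.S₀ X)) (z' : El (evalTy D.S₄ X)) : Ty :=
  appAll (k := squaresTyTy) (glob 58 squaresTyDef) D X.code z.coerce z'.coerce

/-- The data of a cocone with vertex `X` under a diagram. -/
abbrev dataTy (X : Ty) : Ty :=
  sigma (evalTy D.S₀ X) fun z => sigma (evalTy D.S₄ X) fun z' => D.squaresTy z z'

end Diagram

abbrev mapEvalTy (S : Span) : Ty := pi U fun X => pi U fun X' => (X ⟹ X') ⟹ evalTy S X ⟹ evalTy S X'

def mapEvalDef : El (piSpan mapEvalTy) :=
  lamSpan (k := mapEvalTy) fun S => lam fun X => lam fun X' => lam fun k => lam fun z =>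
    coconeMk (lam fun a => k (coconeL z a)) (lam fun b => k (coconeR z b)) (coerce <| lam fun c => ap k (coconeP z c))

/-- The action of a function on a cocone. -/
def mapEval {S : Span} {X X' : Ty} (k : El (X ⟹ X')) (z : El (evalTy S X)) : El (evalTy S X') :=
  (appSpan (k := mapEvalTy) (glob 59 mapEvalDef) S X.code X'.code k.coerce z.coerce).coerce

namespace Diagram

section

variable (D : Diagram) {X : Ty}

def apL (u : El (D.S₀.pushout ⟹ X)) (x : El D.S₂.C) : El (ap u (D.l x) ≐ (side (lam fun a => u (D.S₀.inl a))
    (lam fun b => u (D.S₀.inr b)) (D.p x) (ap u (D.S₀.push (D.c x))).coerce (D.r x)).coerce) :=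
  (apSide D.S₀.inl D.S₀.inr u (D.p x) (D.S₀.push (D.c x)) (D.r x)).coerce

def apL' (v : El (D.S₄.pushout ⟹ X)) (x : El D.S₂.C) : El (ap v (D.l' x) ≐ (side (lam fun a => v (D.S₄.inl a))
    (lam fun b => v (D.S₄.inr b)) (D.p' x) (ap v (D.S₄.push (D.c' x))).coerce (D.r' x)).coerce) :=
  (apSide D.S₄.inl D.S₄.inr v (D.p' x) (D.S₄.push (D.c' x)) (D.r' x)).coerce

end

abbrev squaresMapTy (D : Diagram) : Ty := pi U fun X => pi (D.S₀.pushout ⟹ X) fun u => pi (D.S₄.pushout ⟹ X) fun v =>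
  D.fillerTy u v ⟹ D.squaresTy (eval D.S₀ u) (eval D.S₄ v)

/-- Points and connecting paths are kept. Only the first two sides of each square change, from the
image of a side to a side made of images. -/
def squaresDef : El (piAll squaresMapTy) :=
  lamAll squaresMapTy fun D => lam fun X => lam fun u => lam fun v => lam fun f =>
  (coconeMap (L := fun x => u (D.S₀.inl (D.a x)) ≐ v (D.S₄.inl (D.a' x)))
    (R := fun x => u (D.S₀.inr (D.b x)) ≐ v (D.S₄.inr (D.b' x))) (f := D.S₂.f) (g := D.S₂.g)
    (K := fun x t t' => Sq (ap u (D.l x)) (ap v (D.l' x)) t t')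
    (K' := fun x t t' => Sq
      (side (lam fun a => u (D.S₀.inl a)) (lam fun b => u (D.S₀.inr b)) (D.p x) (ap u (D.S₀.push (D.c x))).coerce (D.r x)).coerce
      (side (lam fun a => v (D.S₄.inl a)) (lam fun b => v (D.S₄.inr b)) (D.p' x) (ap v (D.S₄.push (D.c' x))).coerce (D.r' x)).coerce
      t t')
    (fun x _ _ => sqCast (D.apL u x)
      (D.apL' v x)) f.coerce).coerce

variable (D : Diagram) {X X' : Ty}

def squares {u : El (D.S₀.pushout ⟹ X)} {v : El (D.S₄.pushout ⟹ X)} (f : El (D.fillerTy u v)) :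
    El (D.squaresTy (eval D.S₀ u) (eval D.S₄ v)) :=
  (appAll (k := squaresMapTy) (glob 60 squaresDef) D X.code u.coerce v.coerce f.coerce).coerce

abbrev restrictInnerTy (D : Diagram) : Ty := pi U fun X => pi (D.S₀.pushout ⟹ X) fun u =>
  (sigma (D.S₄.pushout ⟹ X) fun v => D.fillerTy u v) ⟹ sigma (evalTy D.S₄ X) fun z' => D.squaresTy (eval D.S₀ u) z'

def restrictInnerDef : El (piAll restrictInnerTy) :=
  lamAll restrictInnerTy fun D => lam fun X => lam fun u =>
  sigmaMap (A := D.S₄.pushout ⟹ X) (B := evalTy D.S₄ X) (S := fun v => D.fillerTy u v)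
    (T := fun v => D.squaresTy (eval D.S₀ u) v) (lam fun v => eval D.S₄ v) (fun _ f => (D.squares f).coerce)

def restrictInner (u : El (D.S₀.pushout ⟹ X)) : El ((sigma (D.S₄.pushout ⟹ X) fun v => D.fillerTy u v) ⟹
    sigma (evalTy D.S₄ X) fun z' => D.squaresTy (eval D.S₀ u) z') :=
  (appAll (k := restrictInnerTy) (glob 61 restrictInnerDef) D X.code u.coerce).coerce

abbrev restrictTy (D : Diagram) : Ty := pi U fun X => D.mapsTy X ⟹ D.dataTy X

def restrictDef : El (piAll restrictTy) :=
  lamAll restrictTy fun D => lam fun X =>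
  sigmaMap (A := D.S₀.pushout ⟹ X) (B := evalTy D.S₀ X) (S := fun u => sigma (D.S₄.pushout ⟹ X) fun v => D.fillerTy u v)
    (T := fun z => sigma (evalTy D.S₄ X) fun z' => D.squaresTy z z')
    (lam fun u => eval D.S₀ u) fun u z => coerce <| D.restrictInner u z

/-- The decomposition of maps on the outer columns. -/
def restrict (X : Ty) : El (D.mapsTy X ⟹ D.dataTy X) :=
  (appAll (k := restrictTy) (glob 62 restrictDef) D X.code).coerce

abbrev squaresEquivTy (D : Diagram) : Ty := pi U fun X => pi (D.S₀.pushout ⟹ X) fun u => pi (D.S₄.pushout ⟹ X) fun v =>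
  isEquiv (lam fun f : El (D.fillerTy u v) => D.squares f)

def squaresEquivProof : El (piAll squaresEquivTy) :=
  lamAll squaresEquivTy fun D => lam fun X => lam fun u => lam fun v => coerce <|
    coconeMapEquiv (L := fun x => u (D.S₀.inl (D.a x)) ≐ v (D.S₄.inl (D.a' x)))
    (R := fun x => u (D.S₀.inr (D.b x)) ≐ v (D.S₄.inr (D.b' x))) (f := D.S₂.f) (g := D.S₂.g)
    (K := fun x t t' => Sq (ap u (D.l x)) (ap v (D.l' x)) t t')
    (K' := fun x t t' => Sq
      (side (lam fun a => u (D.S₀.inl a)) (lam fun b => u (D.S₀.inr b)) (D.p x) (ap u (D.S₀.push (D.c x))).coerce (D.r x)).coerce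
      (side (lam fun a => v (D.S₄.inl a)) (lam fun b => v (D.S₄.inr b)) (D.p' x) (ap v (D.S₄.push (D.c' x))).coerce (D.r' x)).coerce
      t t') _ fun x _ _ =>
        sqCastEquiv (D.apL u x)
          (D.apL' v x)

abbrev restrictInnerEquivTy (D : Diagram) : Ty := pi U fun X => pi (D.S₀.pushout ⟹ X) fun u =>
  isEquiv (D.restrictInner (X := X) u)

def restrictInnerEquivProof : El (piAll restrictInnerEquivTy) :=
  lamAll restrictInnerEquivTy fun D => lam fun X => lam fun u => coerce <|
    isEquivSigmaMap (A := D.S₄.pushout ⟹ X) (B := evalTy D.S₄ X) (f := lam fun v => eval D.S₄ v)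
      (S := fun v => D.fillerTy u v) (T := fun z' => D.squaresTy (eval D.S₀ u) z')
      (φ := fun v z => (D.squares z).coerce) (evalEquiv D.S₄ X) fun v => coerce <|
    appAll (k := squaresEquivTy) (glob 63 squaresEquivProof) D X u v

abbrev restrictEquivTy (D : Diagram) : Ty := pi U fun X => isEquiv (D.restrict X)

/-- Both outer columns are decomposed by `evalEquiv`, one after the other, and the fillers
fibrewise. The base maps are not identities, so the full strength of `sigmaMapProof` is used. -/
def restrictEquivProof : El (piAll restrictEquivTy) :=
  lamAll restrictEquivTy fun D => lam fun X => coerce <|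
    isEquivSigmaMap (A := D.S₀.pushout ⟹ X) (B := evalTy D.S₀ X) (f := lam fun u => eval D.S₀ u)
      (S := fun u => sigma (D.S₄.pushout ⟹ X) fun v => D.fillerTy u v)
      (T := fun z => sigma (evalTy D.S₄ X) fun z' => D.squaresTy z z')
      (φ := fun u z => coerce <| D.restrictInner u z) (evalEquiv D.S₀ X) fun u => coerce <|
      appAll (k := restrictInnerEquivTy) (glob 64 restrictInnerEquivProof) D X u

variable (k : El (X ⟹ X'))

abbrev mapFillerTy (D : Diagram) : Ty := pi U fun X => pi U fun X' => pi (X ⟹ X') fun k =>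
  pi (D.S₀.pushout ⟹ X) fun u => pi (D.S₄.pushout ⟹ X) fun v =>
    D.fillerTy u v ⟹ D.fillerTy (lam fun y => k (u y)) (lam fun y => k (v y))

def mapFillerDef : El (piAll mapFillerTy) :=
  lamAll mapFillerTy fun D => lam fun X => lam fun X' => lam fun k => lam fun u => lam fun v => lam fun f =>
    let f : El (D.fillerCocone u v) := f.coerce
    coerce <| coconeMk (L := fun x => k (u (D.S₀.inl (D.a x))) ≐ k (v (D.S₄.inl (D.a' x))))
      (R := fun x => k (u (D.S₀.inr (D.b x))) ≐ k (v (D.S₄.inr (D.b' x)))) (f := D.S₂.f) (g := D.S₂.g)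
      (K := fun x t t' => Sq (ap (lam fun y => k (u y)) (D.l x)).coerce (ap (lam fun y => k (v y)) (D.l' x)).coerce t t')
      (lam fun x => ap k (coconeL f x)) (lam fun x => ap k (coconeR f x))
      (coerce <| lam fun x => mapSq k (coconeP f x))

def mapFiller {u : El (D.S₀.pushout ⟹ X)} {v : El (D.S₄.pushout ⟹ X)} (f : El (D.fillerTy u v)) :
    El (D.fillerTy (lam fun y => k (u y)) (lam fun y => k (v y))) :=
  (appAll (k := mapFillerTy) (glob 66 mapFillerDef) D X.code X'.code k.coerce u.coerce v.coerce f.coerce).coerce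

abbrev mapMapsTy (D : Diagram) : Ty := pi U fun X => pi U fun X' => (X ⟹ X') ⟹ D.mapsTy X ⟹ D.mapsTy X'

def mapMapsDef : El (piAll mapMapsTy) :=
  lamAll mapMapsTy fun D => lam fun X => lam fun X' => lam fun k => lam fun z => withTriple z fun u v f =>
    pair (lam fun y => k (u y)) <| pair (lam fun y => k (v y)) <| (D.mapFiller k f).coerce

/-- The action of a function on maps on the outer columns. -/
def mapMaps (z : El (D.mapsTy X)) : El (D.mapsTy X') :=
  (appAll (k := mapMapsTy) (glob 67 mapMapsDef) D X.code X'.code k.coerce z.coerce).coerce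

abbrev mapSquaresOfTy (D : Diagram) : Ty := piComponents D fun X g g' P h h' Q => pi U fun X' => pi (X ⟹ X') fun k =>
  D.squaresTyOf g g' P h h' Q ⟹ D.squaresTyOf (lam fun y => k (g y)) (lam fun y => k (g' y))
    (coerce <| lam fun x => ap k (P x)) (lam fun y => k (h y)) (lam fun y => k (h' y)) (coerce <| lam fun x => ap k (Q x))

/-- The image of a side under `k` is a side only up to `apSide`; hence the cast. -/
def mapSquaresOfDef : El (piAll mapSquaresOfTy) :=
  lamAll mapSquaresOfTy fun D => lam fun X => lam fun g => lam fun g' => lam fun P => lam fun h => lam fun h' => lam fun Q =>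
  lam fun X' => lam fun k => lam fun f =>
    let f : El (D.squaresCocone g g' P h h' Q) := f.coerce
    coerce <| coconeMk (L := fun x => k (g (D.a x)) ≐ k (h (D.a' x))) (R := fun x => k (g' (D.b x)) ≐ k (h' (D.b' x)))
      (f := D.S₂.f) (g := D.S₂.g)
      (K := fun x t t' => Sq (side (lam fun y => k (g y)) (lam fun y => k (g' y)) (D.p x) (ap k (P (D.c x))).coerce (D.r x)).coerce
        (side (lam fun y => k (h y)) (lam fun y => k (h' y)) (D.p' x) (ap k (Q (D.c' x))).coerce (D.r' x)).coerce t t')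
      (lam fun x => ap k (coconeL f x)) (lam fun x => ap k (coconeR f x))
      (coerce <| lam fun x => sqCast (apSide g g' k (D.p x) (P (D.c x)) (D.r x))
        (apSide h h' k (D.p' x) (Q (D.c' x)) (D.r' x)) (apSq k (coconeP f x)))

abbrev mapSquaresTy (D : Diagram) : Ty := pi U fun X => pi U fun X' => pi (X ⟹ X') fun k => pi (evalTy D.S₀ X) fun z =>
  pi (evalTy D.S₄ X) fun z' => D.squaresTy z z' ⟹ D.squaresTy (mapEval k z) (mapEval k z')

def mapSquaresDef : El (piAll mapSquaresTy) :=
  lamAll mapSquaresTy fun D => lam fun X => lam fun X' => lam fun k => lam fun z => lam fun z' => lam fun f =>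
    (appAll (k := mapSquaresOfTy) (glob 68 mapSquaresOfDef) D X (coconeL z) (coconeR z) (coerce <| coconeP z)
      (coconeL z') (coconeR z') (coerce <| coconeP z') X' k f.coerce).coerce

def mapSquares {z : El (evalTy D.S₀ X)} {z' : El (evalTy D.S₄ X)} (f : El (D.squaresTy z z')) :
    El (D.squaresTy (mapEval k z) (mapEval k z')) :=
  (appAll (k := mapSquaresTy) (glob 69 mapSquaresDef) D X.code X'.code k.coerce z.coerce z'.coerce f.coerce).coerce

abbrev mapDataTy (D : Diagram) : Ty := pi U fun X => pi U fun X' => (X ⟹ X') ⟹ D.dataTy X ⟹ D.dataTy X'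

def mapDataDef : El (piAll mapDataTy) :=
  lamAll mapDataTy fun D => lam fun X => lam fun X' => lam fun k => lam fun z => withTriple z fun u v f =>
    pair (mapEval k u) <| pair (mapEval k v) <| (D.mapSquares k f).coerce

/-- The action of a function on data. -/
def mapData (z : El (D.dataTy X)) : El (D.dataTy X') :=
  (appAll (k := mapDataTy) (glob 70 mapDataDef) D X.code X'.code k.coerce z.coerce).coerce

abbrev dataMkTy (D : Diagram) : Ty := piComponents D fun X g g' P h h' Q => D.squaresTyOf g g' P h h' Q ⟹ D.dataTy X

def dataMkDef : El (piAll dataMkTy) :=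
  lamAll dataMkTy fun D => lam fun X => lam fun g => lam fun g' => lam fun P => lam fun h => lam fun h' => lam fun Q =>
  lam fun σ => pair (coconeMk g g' P) <| pair (coconeMk h h' Q) σ.coerce

section

variable (D : Diagram) {X : Ty} (g : El (D.S₀.A ⟹ X)) (g' : El (D.S₀.B ⟹ X)) (h : El (D.S₄.A ⟹ X)) (h' : El (D.S₄.B ⟹ X))
  (t : El (pi D.S₂.A fun x => g (D.a x) ≐ h (D.a' x))) (t' : El (pi D.S₂.B fun x => g' (D.b x) ≐ h' (D.b' x)))

/-- Data with given points. -/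
def dataMk (Q : El (pi D.S₀.C fun x => g (D.S₀.f x) ≐ g' (D.S₀.g x))) (Q' : El (pi D.S₄.C fun x => h (D.S₄.f x) ≐ h' (D.S₄.g x)))
    (σ : El (pi D.S₂.C fun x => Sq (side g g' (D.p x) (Q (D.c x)) (D.r x)) (side h h' (D.p' x) (Q' (D.c' x)) (D.r' x))
      (t (D.S₂.f x)) (t' (D.S₂.g x)))) : El (D.dataTy X) :=
  (appAll (k := dataMkTy) (glob 71 dataMkDef) D X.code g.coerce g'.coerce Q.coerce h.coerce h'.coerce Q'.coerce
    (coerce <| coconeMk t t' σ)).coerce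

abbrev dataMkEqTy (D : Diagram) : Ty :=
  pi U fun X => pi (D.S₀.A ⟹ X) fun g => pi (D.S₀.B ⟹ X) fun g' => pi (D.S₄.A ⟹ X) fun h =>
  pi (D.S₄.B ⟹ X) fun h' => pi (pi D.S₂.A fun x => g (D.a x) ≐ h (D.a' x)) fun t =>
  pi (pi D.S₂.B fun x => g' (D.b x) ≐ h' (D.b' x)) fun t' =>
  pi (pi D.S₀.C fun x => g (D.S₀.f x) ≐ g' (D.S₀.g x)) fun Q₁ =>
  pi (pi D.S₄.C fun x => h (D.S₄.f x) ≐ h' (D.S₄.g x)) fun Q₁' =>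
  pi (pi D.S₂.C fun x => g (D.a (D.S₂.f x)) ≐ g' (D.b (D.S₂.g x))) fun l =>
  pi (pi D.S₂.C fun x => h (D.a' (D.S₂.f x)) ≐ h' (D.b' (D.S₂.g x))) fun l' =>
  pi (pi D.S₂.C fun x => l x ≐ side g g' (D.p x) (Q₁ (D.c x)) (D.r x)) fun e =>
  pi (pi D.S₂.C fun x => l' x ≐ side h h' (D.p' x) (Q₁' (D.c' x)) (D.r' x)) fun e' =>
  pi (pi D.S₂.C fun x => Sq (l x) (l' x) (t (D.S₂.f x)) (t' (D.S₂.g x))) fun s =>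
  pi (pi D.S₀.C fun x => g (D.S₀.f x) ≐ g' (D.S₀.g x)) fun Q => pi (pi D.S₀.C fun c => Q₁ c ≐ Q c) fun ε =>
  pi (pi D.S₄.C fun x => h (D.S₄.f x) ≐ h' (D.S₄.g x)) fun Q' => pi (pi D.S₄.C fun c => Q₁' c ≐ Q' c) fun ε' =>
    D.dataMk g g' h h' t t' Q₁ Q₁' (lam fun x => sqCast (e x) (e' x) (s x)) ≐
      D.dataMk g g' h h' t t' Q Q' (lam fun x =>
        sqCast (e x ⊙ apf (fun q => side g g' (D.p x) q (D.r x)) (ε (D.c x)))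
          (e' x ⊙ apf (fun q => side h h' (D.p' x) q (D.r' x)) (ε' (D.c' x))) (s x))

/-- By induction on the homotopies `ε` and `ε'`. For constant homotopies the added factors compute
away, since composition with a constant path on the right is trivial. -/
def dataMkEqProof : El (piAll dataMkEqTy) :=
  lamAll dataMkEqTy fun D =>
  lam fun X => lam fun g => lam fun g' => lam fun h => lam fun h' => lam fun t => lam fun t' => lam fun Q₁ => lam fun Q₁' =>
  lam fun l => lam fun l' => lam fun e => lam fun e' => lam fun s => lam fun Q => lam fun ε => lam fun Q' => lam fun ε' =>
    let M (Q : El (pi D.S₀.C fun x => g (D.S₀.f x) ≐ g' (D.S₀.g x))) (ε : El (pi D.S₀.C fun c => Q₁ c ≐ Q c))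
        (Q' : El (pi D.S₄.C fun x => h (D.S₄.f x) ≐ h' (D.S₄.g x))) (ε' : El (pi D.S₄.C fun c => Q₁' c ≐ Q' c)) : Ty :=
      D.dataMk g g' h h' t t' Q₁ Q₁' (lam fun x => sqCast (e x) (e' x) (s x)) ≐
        D.dataMk g g' h h' t t' Q Q' (lam fun x =>
          sqCast (e x ⊙ apf (fun q => side g g' (D.p x) q (D.r x)) (ε (D.c x)))
            (e' x ⊙ apf (fun q => side h h' (D.p' x) q (D.r' x)) (ε' (D.c' x))) (s x))
    (homotopyInd (fun Q ε => M Q ε Q' ε') (homotopyInd (fun Q' ε' => M Q₁ (lam fun c => refl (Q₁ c)) Q' ε')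
      (coerce <| refl (D.dataMk g g' h h' t t' Q₁ Q₁' (lam fun x => sqCast (e x) (e' x) (s x)))) ε') ε).coerce

end

abbrev restrictNatTy (D : Diagram) : Ty :=
  pi U fun X => pi U fun X' => pi (X ⟹ X') fun k => pi (D.S₀.pushout ⟹ X) fun u =>
    pi (D.S₄.pushout ⟹ X) fun v => pi (D.fillerTy u v) fun f =>
    D.restrict X' (D.mapMaps k (pair u (pair v f))) ≐ D.mapData k (D.restrict X (pair u (pair v f)))

-- The two results have the same points and the same connecting paths by conversion. The paths on
-- the outer columns differ by `apApp`: `dataMkEqProof` replaces one by the other and adjusts the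
-- squares, and `sideNatProof` identifies the adjusted squares with those on the other side.
set_option maxHeartbeats 1000000 in
def restrictNatProof : El (piAll restrictNatTy) :=
  lamAll restrictNatTy fun D =>
  lam fun X => lam fun X' => lam fun k => lam fun u => lam fun v => lam fun f =>
    let f' : El (D.fillerCocone u v) := f.coerce
    let g : El (D.S₀.A ⟹ X') := lam fun a => k (u (D.S₀.inl a))
    let g' : El (D.S₀.B ⟹ X') := lam fun a => k (u (D.S₀.inr a))
    let h : El (D.S₄.A ⟹ X') := lam fun a => k (v (D.S₄.inl a))
    let h' : El (D.S₄.B ⟹ X') := lam fun a => k (v (D.S₄.inr a))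
    let t : El (pi D.S₂.A fun x => g (D.a x) ≐ h (D.a' x)) := coerce <| lam fun x => ap k (coconeL f' x)
    let t' : El (pi D.S₂.B fun x => g' (D.b x) ≐ h' (D.b' x)) := coerce <| lam fun x => ap k (coconeR f' x)
    let QTy : Ty := pi D.S₀.C fun x => g (D.S₀.f x) ≐ g' (D.S₀.g x)
    let Q'Ty : Ty := pi D.S₄.C fun x => h (D.S₄.f x) ≐ h' (D.S₄.g x)
    let ku : El (D.S₀.pushout ⟹ X') := lam fun y => k (u y)
    let kv : El (D.S₄.pushout ⟹ X') := lam fun y => k (v y)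
    let Q₁ : El QTy := coerce <| lam fun c => ap ku (D.S₀.push c)
    let Q₁' : El Q'Ty := coerce <| lam fun c => ap kv (D.S₄.push c)
    let Q₂ : El QTy := coerce <| lam fun c => ap k (ap u (D.S₀.push c))
    let Q₂' : El Q'Ty := coerce <| lam fun c => ap k (ap v (D.S₄.push c))
    let S (x : El D.S₂.C) (q : El (g (D.S₀.f (D.c x)) ≐ g' (D.S₀.g (D.c x)))) := side g g' (D.p x) q (D.r x)
    let S' (x : El D.S₂.C) (q : El (h (D.S₄.f (D.c' x)) ≐ h' (D.S₄.g (D.c' x)))) := side h h' (D.p' x) q (D.r' x)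
    let σTy (Q : El QTy) (Q' : El Q'Ty) : Ty :=
      pi D.S₂.C fun x => Sq (S x (Q (D.c x))) (S' x (Q' (D.c' x))) (t (D.S₂.f x)) (t' (D.S₂.g x))
    let e (x : El D.S₂.C) : El ((ap ku (D.l x)).coerce ≐ S x (Q₁ (D.c x))) :=
      (apSide D.S₀.inl D.S₀.inr ku (D.p x) (D.S₀.push (D.c x)) (D.r x)).coerce
    -- As for `e`, this straightens the image of a side under the composite with `k`; composing it
    -- with the image of `ε'` gives the cast occurring in `El.apSideCompDef`.
    let e' (x : El D.S₂.C) : El ((ap kv (D.l' x)).coerce ≐ S' x (Q₁' (D.c' x))) :=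
      (apSide D.S₄.inl D.S₄.inr kv (D.p' x) (D.S₄.push (D.c' x)) (D.r' x)).coerce
    let ε : El (pi D.S₀.C fun c => Q₁ c ≐ Q₂ c) := coerce <| lam fun c => apApp k u (D.S₀.push c)
    let ε' : El (pi D.S₄.C fun c => Q₁' c ≐ Q₂' c) := coerce <| lam fun c => apApp k v (D.S₄.push c)
    let s : El (pi D.S₂.C fun x => Sq (coerce <| ap ku (D.l x)) (coerce <| ap kv (D.l' x)) (t (D.S₂.f x)) (t' (D.S₂.g x))) :=
      lam fun x => coerce <| mapSq k (coconeP f' x)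
    let σ : El (σTy Q₂ Q₂') := lam fun x => sqCast (e x ⊙ apf (S x) (ε (D.c x))) (e' x ⊙ apf (S' x) (ε' (D.c' x))) (s x)
    let path : El (D.dataMk g g' h h' t t' Q₁ Q₁' (lam fun x => sqCast (e x) (e' x) (s x)) ≐
        D.dataMk g g' h h' t t' Q₂ Q₂' σ) :=
      (appAll (k := dataMkEqTy) (glob 72 dataMkEqProof) D X' g.coerce g'.coerce h.coerce h'.coerce t.coerce t'.coerce Q₁.coerce Q₁'.coerce
    (coerce <| lam fun x => coerce (B := g (D.a (D.S₂.f x)) ≐ g' (D.b (D.S₂.g x))) (ap ku (D.l x)))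
    (coerce <| lam fun x => coerce (B := h (D.a' (D.S₂.f x)) ≐ h' (D.b' (D.S₂.g x))) (ap kv (D.l' x)))
    (coerce <| lam e) (coerce <| lam e') s.coerce Q₂.coerce ε.coerce Q₂'.coerce ε'.coerce).coerce
    let u₁ : El (D.S₀.A ⟹ X) := lam fun a => u (D.S₀.inl a)
    let u₂ : El (D.S₀.B ⟹ X) := lam fun a => u (D.S₀.inr a)
    let v₁ : El (D.S₄.A ⟹ X) := lam fun a => v (D.S₄.inl a)
    let v₂ : El (D.S₄.B ⟹ X) := lam fun a => v (D.S₄.inr a)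
    let s₂ (x : El D.S₂.C) : El (Sq (a := u₁ (D.a (D.S₂.f x))) (b := v₁ (D.a' (D.S₂.f x))) (c := u₂ (D.b (D.S₂.g x)))
        (d := v₂ (D.b' (D.S₂.g x))) (side u₁ u₂ (D.p x) (coerce <| ap u (D.S₀.push (D.c x))) (D.r x))
        (side v₁ v₂ (D.p' x) (coerce <| ap v (D.S₄.push (D.c' x))) (D.r' x))
        (coconeL f' (D.S₂.f x)).coerce (coconeR f' (D.S₂.g x)).coerce) := coerce <|
      sqCast (D.apL u x)
          (D.apL' v x) (coconeP f' x)
    let σ₂ : El (σTy Q₂ Q₂') := lam fun x => coerce <|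
      sqCast (apSide u₁ u₂ k (D.p x) (coerce <| ap u (D.S₀.push (D.c x))) (D.r x))
        (apSide v₁ v₂ k (D.p' x) (coerce <| ap v (D.S₄.push (D.c' x))) (D.r' x)) (apSq k (s₂ x))
    let n : El (σ ≐ σ₂) := funExt (coerce <| lam fun x =>
      coerce (B := σ x ≐ σ₂ x) <|
      glob 51 sideNatProof X X' D.S₀.pushout.code D.S₄.pushout.code D.S₀.A.code D.S₀.B.code D.S₄.A.code D.S₄.B.code k
        D.S₀.inl.coerce D.S₀.inr.coerce D.S₄.inl.coerce D.S₄.inr.coerce u.coerce v.coerce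
        (D.a (D.S₂.f x)).coerce (D.S₀.f (D.c x)).coerce (D.b (D.S₂.g x)).coerce (D.S₀.g (D.c x)).coerce
        (D.a' (D.S₂.f x)).coerce (D.S₄.f (D.c' x)).coerce (D.b' (D.S₂.g x)).coerce (D.S₄.g (D.c' x)).coerce
        (D.p x).coerce (D.r x).coerce (D.p' x).coerce (D.r' x).coerce (D.S₀.push (D.c x)).coerce
        (D.S₄.push (D.c' x)).coerce (coconeL f' (D.S₂.f x)).coerce (coconeR f' (D.S₂.g x)).coerce
        (coconeP f' x).coerce)
    (trans path (apf (D.dataMk g g' h h' t t' Q₂ Q₂') n)).coerce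

end Diagram

/-! ### Representations and the Yoneda argument. -/

/-- Functors from types to types, as far as natural transformations are concerned. -/
abbrev actionTy (T : El (U ⟹ U)) : Ty := pi U fun X => pi U fun X' => (X ⟹ X') ⟹ T X ⟹ T X'

/-- Natural families of functions on the maps out of a type. -/
abbrev naturalTy (P : El U) {T : El (U ⟹ U)} (m : El (actionTy T)) (ev : El (pi U fun X => (P ⟹ X) ⟹ T X)) : Ty :=
  pi U fun X => pi U fun X' => pi (X ⟹ X') fun k => pi (P ⟹ X) fun h =>
    ev X' (lam fun y => k (h y)) ≐ m X X' k (ev X h)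

/-- Representations of `T` by `P`, as an impredicative encoding of dependent pairs. -/
abbrev repTy (P : El U) (T : El (U ⟹ U)) (m : El (actionTy T)) : Ty :=
  pi U fun R => (pi (pi U fun X => (P ⟹ X) ⟹ T X) fun ev =>
    (pi U fun X => isEquiv (A := P ⟹ X) (B := T X) (ev X)) ⟹ naturalTy P m ev ⟹ R) ⟹ R

abbrev yonedaTy : Ty :=
  pi U fun P => pi U fun Q => pi (U ⟹ U) fun T => pi (actionTy T) fun m =>
    repTy P T m ⟹ repTy Q T m ⟹ equiv P Q

/-- The maps `f` and `g` correspond under the representations to the images of the identities.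
Naturality shows that `g ∘ f` and the identity have the same image under `ev`, and the left inverse
of `ev` makes `ev` injective; likewise for `f ∘ g`. The functor laws for `m` are not needed. The
encoded pairs can be opened because the goal is a small type. -/
def yonedaProof : El yonedaTy :=
  lam fun P => lam fun Q => lam fun T => lam fun m => lam fun r => lam fun r' =>
    r (equiv P Q).code <| lam fun ev => lam fun e => lam fun n =>
    coerce <| r' (equiv P Q).code <| lam fun ev' => lam fun e' => lam fun n' =>
    let i : El (P ⟹ P) := lam fun x => x
    let i' : El (Q ⟹ Q) := lam fun x => x
    let inv₁ (X : El U) : El (T X ⟹ (P ⟹ X)) := rinv (e X)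
    let inv₂ (X : El U) : El (T X ⟹ (Q ⟹ X)) := rinv (e' X)
    -- Only the equation satisfied by `f` is kept, so that the rest does not depend on how it was
    -- obtained.
    withF (A := P ⟹ Q) (ev Q) (apply_rinv (e Q) (ev' Q i')) (G := equiv P Q) fun f ef =>
    withF (A := Q ⟹ P) (ev' P) (apply_rinv (e' P) (ev P i)) fun g eg =>
    let p : El ((lam fun x => g (f x)) ≐ i) := injective (e P) <|
      El.trans (n Q P g f) <| El.trans (apf (fun d => m Q P g d) ef) <| El.trans (inv (n' Q P g i')) (coerce eg)
    let q : El ((lam fun x => f (g x)) ≐ i') := injective (e' Q) <|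
      El.trans (n' P Q f g) <| El.trans (apf (fun d => m P Q f d) eg) <| El.trans (inv (n P Q f i)) (coerce ef)
    coerce <| pair (A := P ⟹ Q) (B := fun f => isEquiv f) f <| mkEquiv g
      (coerce <| lam fun x => apf (fun f : El (P ⟹ P) => f x) p) (coerce <| lam fun x => apf (fun f : El (Q ⟹ Q) => f x) q)
where
  withF {A B G : Ty} (v : El (A ⟹ B)) {a : El A} {b : El B} (p : El (v a ≐ b))
      (k : (a : El A) → El (v a ≐ b) → El G) : El G :=
    (lam fun a => lam fun p => k a p) a p
  injective {A B : Ty} {f : El (A ⟹ B)} (e : El (isEquiv f)) {a a' : El A} (p : El (f a ≐ f a')) : El (a ≐ a') :=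
    El.trans (inv (linv_apply e a)) <| El.trans (apf (fun b => linv e b) p) (linv_apply e a')

abbrev repTransportTy : Ty :=
  pi U fun P => pi (U ⟹ U) fun T => pi (actionTy T) fun m => pi (U ⟹ U) fun T' => pi (actionTy T') fun m' =>
    pi (pi U fun X => T X ⟹ T' X) fun τ => (pi U fun X => isEquiv (A := T X) (B := T' X) (τ X)) ⟹
    (pi U fun X => pi U fun X' => pi (X ⟹ X') fun k => pi (T X) fun z => τ X' (m X X' k z) ≐ m' X X' k (τ X z)) ⟹
    repTy P T m ⟹ repTy P T' m'

/-- Compose the representation with the natural equivalence `τ`; the encoding of pairs is opened and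
closed with the same target `R`. -/
def repTransportProof : El repTransportTy :=
  lam fun P => lam fun T => lam fun m => lam fun T' => lam fun m' => lam fun τ => lam fun e => lam fun n =>
  lam fun r => lam fun R => lam fun d => r R <| lam fun ev => lam fun ee => lam fun en =>
    d (lam fun X => lam fun h => τ X (ev X h))
      (lam fun X => coerce <| isEquivComp (ee X) (e X))
      (coerce <| lam fun X => lam fun X' => lam fun k => lam fun h =>
        El.trans (apf (fun z => τ X' z) (en X X' k h)) (n X X' k (ev X h)))

namespace Legs

/-- Maps out of the pushout of the legs, as cocones. -/
abbrev cocones (L : Legs) : El (U ⟹ U) := lam fun X => (L.coconeTy X).code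

abbrev mapCocones (L : Legs) : El (actionTy L.cocones) :=
  (appAll (k := mapCoconeTy) (glob 43 mapCoconeDef) L).coerce

abbrev repTyOf (L : Legs) : Ty := repTy L.span.pushout.code L.cocones L.mapCocones

def repTyOfProof : El (piAll repTyOf) :=
  lamAll repTyOf fun L => lam fun R => lam fun d =>
    let ev : El (pi U fun X => (L.span.pushout ⟹ X) ⟹ L.coconeTy X) := lam fun X => lam fun h => L.eval h
    app (app (app d ev.coerce) (coerce <| appAll (k := fun L => pi U fun X =>
        isEquiv (A := L.span.pushout ⟹ X) (B := L.coconeTy X) (lam fun h => L.eval h)) (glob 38 evalEquivProof) L))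
      (coerce <| appAll (k := fun L => pi U fun X => pi U fun X' => pi (X ⟹ X') fun k => pi (L.span.pushout ⟹ X) fun h =>
        L.eval (lam fun y => k (h y)) ≐ L.mapCocone k (L.eval h)) (glob 44 evalNatProof) L)

end Legs

namespace Diagram

abbrev legFTy (D : Diagram) : Ty := D.S₂.pushout ⟹ D.S₀.pushout

def legFDef : El (piAll legFTy) := lamAll legFTy fun D =>
  D.S₂.recur (lam fun x => D.S₀.inl (D.a x)) (lam fun x => D.S₀.inr (D.b x)) (coerce <| lam fun x => D.l x)

abbrev legGTy (D : Diagram) : Ty := D.S₂.pushout ⟹ D.S₄.pushout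

def legGDef : El (piAll legGTy) := lamAll legGTy fun D =>
  D.S₂.recur (lam fun x => D.S₄.inl (D.a' x)) (lam fun x => D.S₄.inr (D.b' x)) (coerce <| lam fun x => D.l' x)

def legF (D : Diagram) : El D.legFTy := appAll (k := legFTy) (glob 77 legFDef) D

def legG (D : Diagram) : El D.legGTy := appAll (k := legGTy) (glob 78 legGDef) D

abbrev legFPushTy (D : Diagram) : Ty := pi D.S₂.C fun x => ap D.legF (D.S₂.push x) ≐ (D.l x).coerce

def legFPushProof : El (piAll legFPushTy) := lamAll legFPushTy fun D => lam fun x => coerce <|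
  D.S₂.recurPush (lam fun x => D.S₀.inl (D.a x)) (lam fun x => D.S₀.inr (D.b x)) (coerce <| lam fun x => D.l x) x
    (q := (D.l x).coerce)

abbrev legGPushTy (D : Diagram) : Ty := pi D.S₂.C fun x => ap D.legG (D.S₂.push x) ≐ (D.l' x).coerce

def legGPushProof : El (piAll legGPushTy) := lamAll legGPushTy fun D => lam fun x => coerce <|
  D.S₂.recurPush (lam fun x => D.S₄.inl (D.a' x)) (lam fun x => D.S₄.inr (D.b' x)) (coerce <| lam fun x => D.l' x) x
    (q := (D.l' x).coerce)

variable (D : Diagram)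

/-- The maps between the pushouts of the columns. -/
def legs : Legs where
  S := D.S₂
  Y₀ := D.S₀.pushout
  Y₁ := D.S₄.pushout
  F := D.legF
  G := D.legG
  l := D.l.coerce
  r := D.l'.coerce
  β₀ := (appAll (k := legFPushTy) (glob 79 legFPushProof) D).coerce
  β₁ := (appAll (k := legGPushTy) (glob 80 legGPushProof) D).coerce

/-- The pushout of the pushouts of the columns. -/
def total : Ty := D.legs.span.pushout

abbrev maps : El (U ⟹ U) := lam fun X => (D.mapsTy X).code

abbrev mapsMap : El (actionTy D.maps) := (appAll (k := mapMapsTy) (glob 67 mapMapsDef) D).coerce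

abbrev data : El (U ⟹ U) := lam fun X => (D.dataTy X).code

abbrev dataMap : El (actionTy D.data) := (appAll (k := mapDataTy) (glob 70 mapDataDef) D).coerce

abbrev mapsRep : Ty := repTy D.total.code D.maps D.mapsMap

abbrev mapFillerEqTy (D : Diagram) : Ty :=
  pi U fun X => pi U fun X' => pi (X ⟹ X') fun k => pi (D.S₀.pushout ⟹ X) fun u =>
    pi (D.S₄.pushout ⟹ X) fun v => pi (D.fillerTy u v) fun f =>
    (D.legs.mapFiller (u := u) (v := v) k f.coerce).coerce ≐ D.mapFiller k f

/-- The legs compute on points, so fillers for the legs and fillers for the diagram form the same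
type up to conversion, and the two actions agree by unfolding. -/
def mapFillerEqProof : El (piAll mapFillerEqTy) :=
  lamAll mapFillerEqTy fun D => lam fun X => lam fun X' => lam fun k => lam fun u => lam fun v => lam fun f =>
    coerce <| refl (D.mapFiller k f)

abbrev mapsIdTy (D : Diagram) : Ty :=
  pi U fun X => pi U fun X' => pi (X ⟹ X') fun k => pi (D.mapsTy X) fun z =>
    (D.legs.mapCocone k z.coerce).coerce ≐ D.mapMaps k z

def mapsIdProof : El (piAll mapsIdTy) :=
  lamAll mapsIdTy fun D => lam fun X => lam fun X' => lam fun k => lam fun z =>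
    let P (z : El (D.mapsTy X)) : Ty := (D.legs.mapCocone k z.coerce).coerce ≐ D.mapMaps k z
    split P (fun u z => (split (fun z => P (pair u z)) (fun v f =>
      (apf (fun f : El (D.fillerTy (lam fun y => k (u y)) (lam fun y => k (v y))) =>
        (pair (lam fun y => k (u y)) (pair (lam fun y => k (v y)) f) : El (D.mapsTy X')))
      (appAll (k := mapFillerEqTy) (glob 81 mapFillerEqProof) D X X' k u v f)).coerce) z).coerce) z

/-- The representation of cocones under the legs is transported along the identity; only the
presentation of the functor changes. -/
def mapsRepProof : El (piAll mapsRep) :=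
  lamAll mapsRep fun D =>
    glob 75 repTransportProof D.total.code D.legs.cocones D.legs.mapCocones D.maps D.mapsMap
      (coerce <| lam fun X : El U => lam fun z : El (D.mapsTy X) => z)
      (coerce <| lam fun X : El U => mkEquiv (A := D.mapsTy X) (B := D.mapsTy X) (f := lam fun z => z) (lam fun z => z) (coerce <| lam fun z : El (D.mapsTy X) => El.refl z) (coerce <| lam fun z : El (D.mapsTy X) => El.refl z))
      (coerce <| appAll (k := mapsIdTy) (glob 82 mapsIdProof) D)
      (Legs.appAll (k := Legs.repTyOf) (glob 76 Legs.repTyOfProof) D.legs).coerce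

abbrev dataRep : Ty := repTy D.total.code D.data D.dataMap

abbrev restrictNaturalTy (D : Diagram) : Ty :=
  pi U fun X => pi U fun X' => pi (X ⟹ X') fun k => pi (D.mapsTy X) fun z =>
    D.restrict X' (D.mapMaps k z) ≐ D.mapData k (D.restrict X z)

def restrictNaturalProof : El (piAll restrictNaturalTy) :=
  lamAll restrictNaturalTy fun D => lam fun X => lam fun X' => lam fun k => lam fun z =>
    let P (z : El (D.mapsTy X)) : Ty := D.restrict X' (D.mapMaps k z) ≐ D.mapData k (D.restrict X z)
    let N := appAll (k := restrictNatTy) (glob 73 restrictNatProof) D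
    split P (fun u z => (split (fun z => P (pair u z)) (fun v f => (N X X' k u v f).coerce) z).coerce) z

def dataRepProof : El (piAll dataRep) :=
  lamAll dataRep fun D =>
    glob 75 repTransportProof D.total.code D.maps D.mapsMap D.data D.dataMap
      (appAll (k := restrictTy) (glob 62 restrictDef) D).coerce
      (appAll (k := restrictEquivTy) (glob 65 restrictEquivProof) D).coerce
      (appAll (k := restrictNaturalTy) (glob 84 restrictNaturalProof) D).coerce
      (appAll (k := mapsRep) (glob 83 mapsRepProof) D)

end Diagram

/-! ### Transposition of squares and its naturality. -/

namespace El

abbrev compInvEquivTy : Ty :=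
  pi U fun A => pi A fun x => pi A fun y => pi A fun z => pi (x ≐ y) fun e =>
    isEquiv (A := z ≐ y) (B := x ≐ z) (lam fun s => (e ⊙ inv s).coerce)

def compInvEquivProof : El compInvEquivTy :=
  lam fun A => lam fun x => lam fun y => lam fun z => lam fun e =>
    J (fun y e => isEquiv (A := z ≐ y) (B := x ≐ z) (lam fun s => (e ⊙ inv s).coerce))
      (coerce <| mkEquiv (A := z ≐ x) (B := x ≐ z) (f := lam fun s => (El.refl x ⊙ inv s).coerce)
        (lam fun u => (inv u).coerce)
        (coerce <| lam fun s : El (z ≐ x) => J (fun x s => inv (El.refl x ⊙ inv s) ≐ s) rfl' s)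
        (coerce <| lam fun u : El (x ≐ z) => J (fun z u => El.refl x ⊙ inv (inv u) ≐ u) rfl' u)) e

abbrev carryReflTy : Ty :=
  pi U fun X => pi X fun w => pi X fun z => pi (w ≐ z) fun t => carry (El.refl w) (El.refl w ⊙ t) (El.refl w) ≐ t

def carryReflDef : El carryReflTy :=
  lam fun X => lam fun w => lam fun z => lam fun t =>
    J (fun _ t => carry (El.refl w) (El.refl w ⊙ t) (El.refl w) ≐ t) rfl' t

/-- Squares with constant paths as the first two sides, and their transposes. -/
abbrev flipPathTy : Ty :=
  pi U fun X => pi X fun w => pi X fun x => pi (w ≐ x) fun t => pi (w ≐ x) fun t' =>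
    (t ≐ t') ⟹ Sq (El.refl w ⊙ t) (El.refl w ⊙ t') (El.refl w) (El.refl x)

def flipPathDef : El flipPathTy :=
  lam fun X => lam fun w => lam fun x => lam fun t =>
    J (fun x t => pi (w ≐ x) fun t' => (t ≐ t') ⟹ Sq (El.refl w ⊙ t) (El.refl w ⊙ t') (El.refl w) (El.refl x))
      (coerce <| lam fun t' : El (w ≐ w) => lam fun s : El (El.refl w ≐ t') =>
        -- With `t` constant, `s` runs from the constant path to `t'`, and the goal is a path from
        -- the carried path to the constant one. The carried path equals `t'`, and `s` is then
        -- followed backwards; this is an equivalence by `compInvEquivProof`.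
        glob 87 carryReflDef X w w t' ⊙ inv s) t

def flipPath {X : Ty} {w x : El X} (t t' : El (w ≐ x)) (s : El (t ≐ t')) :
    El (Sq (El.refl w ⊙ t) (El.refl w ⊙ t') (El.refl w) (El.refl x)) :=
  (glob 88 flipPathDef X.code w.coerce x.coerce t.coerce t'.coerce s.coerce).coerce

abbrev flipPathEquivTy : Ty :=
  pi U fun X => pi X fun w => pi X fun x => pi (w ≐ x) fun t => pi (w ≐ x) fun t' =>
    isEquiv (A := t ≐ t') (B := Sq (El.refl w ⊙ t) (El.refl w ⊙ t') (El.refl w) (El.refl x)) (lam fun s => flipPath t t' s)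

def flipPathEquivProof : El flipPathEquivTy :=
  lam fun X => lam fun w => lam fun x => lam fun t =>
    J (fun x t => pi (w ≐ x) fun t' =>
        isEquiv (A := t ≐ t') (B := Sq (El.refl w ⊙ t) (El.refl w ⊙ t') (El.refl w) (El.refl x)) (lam fun s => flipPath t t' s))
      (coerce <| lam fun t' : El (w ≐ w) =>
        glob 86 compInvEquivProof (w ≐ w).code
          (carry (El.refl w) (El.refl w ⊙ t') (El.refl w)).coerce t'.coerce (El.refl w).coerce
          (glob 87 carryReflDef X w w t').coerce) t

/-- The transposition of squares whose first two sides are paths composed with constant paths. -/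
abbrev flipSqTy : Ty :=
  pi U fun X => pi X fun w => pi X fun x => pi X fun y => pi X fun z => pi (w ≐ x) fun t =>
  pi (w ≐ y) fun q => pi (x ≐ z) fun q' => pi (y ≐ z) fun t' =>
    Sq (El.refl w ⊙ q) (El.refl x ⊙ q') t t' ⟹ Sq (El.refl w ⊙ t) (El.refl y ⊙ t') q q'

/-- The factors `refl ⊙ _` are what `side` computes to for constant homotopies: its right factor
disappears by conversion, its left factor does not. Induction on `q` and `q'` leaves a path between
`t` and `t'`, treated by `flipPath`. -/
def flipSqDef : El flipSqTy :=
  lam fun X => lam fun w => lam fun x => lam fun y => lam fun z => lam fun t => lam fun q => lam fun q' =>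
    J (fun y q => pi (y ≐ z) fun t' =>
        Sq (El.refl w ⊙ q) (El.refl x ⊙ q') t t' ⟹ Sq (El.refl w ⊙ t) (El.refl y ⊙ t') q q')
      (coerce <| J (fun z q' => pi (w ≐ z) fun t' =>
          Sq (El.refl w) (El.refl x ⊙ q') t t' ⟹ Sq (El.refl w ⊙ t) (El.refl w ⊙ t') (El.refl w) q')
        (coerce <| lam fun t' : El (w ≐ x) => lam fun s : El (t ≐ t') => flipPath t t' s) q') q

def flipSq {X : Ty} {w x y z : El X} (t : El (w ≐ x)) (q : El (w ≐ y)) (q' : El (x ≐ z)) (t' : El (y ≐ z))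
    (s : El (Sq (El.refl w ⊙ q) (El.refl x ⊙ q') t t')) : El (Sq (El.refl w ⊙ t) (El.refl y ⊙ t') q q') :=
  (glob 90 flipSqDef X.code w.coerce x.coerce y.coerce z.coerce t.coerce q.coerce q'.coerce t'.coerce s.coerce).coerce

abbrev flipSqEquivTy : Ty :=
  pi U fun X => pi X fun w => pi X fun x => pi X fun y => pi X fun z => pi (w ≐ x) fun t =>
  pi (w ≐ y) fun q => pi (x ≐ z) fun q' => pi (y ≐ z) fun t' =>
    isEquiv (A := Sq (El.refl w ⊙ q) (El.refl x ⊙ q') t t') (B := Sq (El.refl w ⊙ t) (El.refl y ⊙ t') q q')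
      (lam fun s => flipSq t q q' t' s)

def flipSqEquivProof : El flipSqEquivTy :=
  lam fun X => lam fun w => lam fun x => lam fun y => lam fun z => lam fun t => lam fun q => lam fun q' =>
    let P {y z : El X} (q : El (w ≐ y)) (q' : El (x ≐ z)) : Ty := pi (y ≐ z) fun t' =>
      isEquiv (A := Sq (El.refl w ⊙ q) (El.refl x ⊙ q') t t') (B := Sq (El.refl w ⊙ t) (El.refl y ⊙ t') q q')
        (lam fun s => flipSq t q q' t' s)
    J (fun _ q => P q q') (J (fun _ q' => P (El.refl w) q')
      (coerce <| lam fun t' : El (w ≐ x) => glob 89 flipPathEquivProof X w x t t') q') q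

/-- Quantification over the sides of the squares of a diagram. -/
abbrev piSquare (k : (X : El U) → {A B A' B' : El U} → (g : El (A ⟹ X)) → (g' : El (B ⟹ X)) → (h : El (A' ⟹ X)) →
    (h' : El (B' ⟹ X)) → {a₀ a₁ : El A} → {b₀ b₁ : El B} → {a₀' a₁' : El A'} → {b₀' b₁' : El B'} →
    (p : El (a₀ ≐ a₁)) → (r : El (b₀ ≐ b₁)) → (p' : El (a₀' ≐ a₁')) → (r' : El (b₀' ≐ b₁')) →
    (t : El (g a₀ ≐ h a₀')) → (t' : El (g' b₀ ≐ h' b₀')) → (q : El (g a₁ ≐ g' b₁)) → (q' : El (h a₁' ≐ h' b₁')) → Ty) : Ty :=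
  pi U fun X => pi U fun A => pi U fun B => pi U fun A' => pi U fun B' =>
  pi (A ⟹ X) fun g => pi (B ⟹ X) fun g' => pi (A' ⟹ X) fun h => pi (B' ⟹ X) fun h' =>
  pi A fun a₀ => pi A fun a₁ => pi B fun b₀ => pi B fun b₁ =>
  pi A' fun a₀' => pi A' fun a₁' => pi B' fun b₀' => pi B' fun b₁' =>
  pi (a₀ ≐ a₁) fun p => pi (b₀ ≐ b₁) fun r => pi (a₀' ≐ a₁') fun p' => pi (b₀' ≐ b₁') fun r' =>
  pi (g a₀ ≐ h a₀') fun t => pi (g' b₀ ≐ h' b₀') fun t' => pi (g a₁ ≐ g' b₁) fun q => pi (h a₁' ≐ h' b₁') fun q' =>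
    k X g g' h h' p r p' r' t t' q q'

/-- Reduction to constant `p`, `r`, `p'`, `r'`. The paths `q` and `q'` are quantified in the motive
because their endpoints move in these inductions, whereas those of `t` and `t'` stay fixed. -/
def lamSquare {k : (X : El U) → {A B A' B' : El U} → (g : El (A ⟹ X)) → (g' : El (B ⟹ X)) → (h : El (A' ⟹ X)) →
    (h' : El (B' ⟹ X)) → {a₀ a₁ : El A} → {b₀ b₁ : El B} → {a₀' a₁' : El A'} → {b₀' b₁' : El B'} →
    (p : El (a₀ ≐ a₁)) → (r : El (b₀ ≐ b₁)) → (p' : El (a₀' ≐ a₁')) → (r' : El (b₀' ≐ b₁')) →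
    (t : El (g a₀ ≐ h a₀')) → (t' : El (g' b₀ ≐ h' b₀')) → (q : El (g a₁ ≐ g' b₁)) → (q' : El (h a₁' ≐ h' b₁')) → Ty}
    (d : (X : El U) → {A B A' B' : El U} → (g : El (A ⟹ X)) → (g' : El (B ⟹ X)) → (h : El (A' ⟹ X)) →
    (h' : El (B' ⟹ X)) → (a₀ : El A) → (b₀ : El B) → (a₀' : El A') → (b₀' : El B') →
    (t : El (g a₀ ≐ h a₀')) → (t' : El (g' b₀ ≐ h' b₀')) → (q : El (g a₀ ≐ g' b₀)) → (q' : El (h a₀' ≐ h' b₀')) →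
    El (k X g g' h h' (El.refl a₀) (El.refl b₀) (El.refl a₀') (El.refl b₀') t t' q q')) : El (piSquare k) :=
  lam fun X => lam fun A => lam fun B => lam fun A' => lam fun B' => lam fun g => lam fun g' => lam fun h => lam fun h' =>
  lam fun a₀ => lam fun a₁ => lam fun b₀ => lam fun b₁ => lam fun a₀' => lam fun a₁' => lam fun b₀' => lam fun b₁' =>
  lam fun p => lam fun r => lam fun p' => lam fun r' => lam fun t => lam fun t' =>
    let P {a₁ : El A} {b₁ : El B} {a₁' : El A'} {b₁' : El B'} (p : El (a₀ ≐ a₁)) (r : El (b₀ ≐ b₁))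
        (p' : El (a₀' ≐ a₁')) (r' : El (b₀' ≐ b₁')) : Ty :=
      pi (g a₁ ≐ g' b₁) fun q => pi (h a₁' ≐ h' b₁') fun q' => k X g g' h h' p r p' r' t t' q q'
    J (fun _ p => P p r p' r') (J (fun _ r => P (El.refl a₀) r p' r') (J (fun _ p' => P (El.refl a₀) (El.refl b₀) p' r')
      (J (fun _ r' => P (El.refl a₀) (El.refl b₀) (El.refl a₀') r')
        (coerce <| lam fun q : El (g a₀ ≐ g' b₀) => lam fun q' : El (h a₀' ≐ h' b₀') => d X g g' h h' a₀ b₀ a₀' b₀' t t' q q')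
        r').coerce p').coerce r).coerce p

section

variable {X A B A' B' : Ty} (g : El (A ⟹ X)) (g' : El (B ⟹ X)) (h : El (A' ⟹ X)) (h' : El (B' ⟹ X))
  {a₀ a₁ : El A} {b₀ b₁ : El B} {a₀' a₁' : El A'} {b₀' b₁' : El B'}
  (p : El (a₀ ≐ a₁)) (r : El (b₀ ≐ b₁)) (p' : El (a₀' ≐ a₁')) (r' : El (b₀' ≐ b₁'))
  (t : El (g a₀ ≐ h a₀')) (t' : El (g' b₀ ≐ h' b₀')) (q : El (g a₁ ≐ g' b₁)) (q' : El (h a₁' ≐ h' b₁'))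

def appSquare {k : (X : El U) → {A B A' B' : El U} → (g : El (A ⟹ X)) → (g' : El (B ⟹ X)) → (h : El (A' ⟹ X)) →
    (h' : El (B' ⟹ X)) → {a₀ a₁ : El A} → {b₀ b₁ : El B} → {a₀' a₁' : El A'} → {b₀' b₁' : El B'} →
    (p : El (a₀ ≐ a₁)) → (r : El (b₀ ≐ b₁)) → (p' : El (a₀' ≐ a₁')) → (r' : El (b₀' ≐ b₁')) →
    (t : El (g a₀ ≐ h a₀')) → (t' : El (g' b₀ ≐ h' b₀')) → (q : El (g a₁ ≐ g' b₁)) → (q' : El (h a₁' ≐ h' b₁')) → Ty}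
    (d : El (piSquare k)) {T : Ty} : El T :=
  (d X.code A.code B.code A'.code B'.code g.coerce g'.coerce h.coerce h'.coerce a₀.coerce a₁.coerce b₀.coerce b₁.coerce
    a₀'.coerce a₁'.coerce b₀'.coerce b₁'.coerce p.coerce r.coerce p'.coerce r'.coerce t.coerce t'.coerce q.coerce q'.coerce).coerce

/-- The squares of the data of a diagram. -/
abbrev sideSq : Ty := Sq (side g g' p q r) (side h h' p' q' r') t t'

/-- The squares of the data of the transposed diagram. -/
abbrev flippedSq : Ty := Sq (side g h (inv p) t (inv p')) (side g' h' (inv r) t' (inv r')) q q'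

end

abbrev flipTy : Ty := piSquare fun _ _ _ _ _ g g' h h' _ _ _ _ _ _ _ _ p r p' r' t t' q q' =>
  sideSq g g' h h' p r p' r' t t' q q' ⟹ flippedSq g g' h h' p r p' r' t t' q q'

def flipDef : El flipTy :=
  lamSquare fun X _ _ _ _ g g' h h' a₀ b₀ a₀' b₀' t t' q q' =>
    lam fun s : El (sideSq g g' h h' (El.refl a₀) (El.refl b₀) (El.refl a₀') (El.refl b₀') t t' q q') =>
      (flipSq (X := X) t q q' t' s.coerce).coerce

def flip {X A B A' B' : Ty} (g : El (A ⟹ X)) (g' : El (B ⟹ X)) (h : El (A' ⟹ X)) (h' : El (B' ⟹ X))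
    {a₀ a₁ : El A} {b₀ b₁ : El B} {a₀' a₁' : El A'} {b₀' b₁' : El B'}
    (p : El (a₀ ≐ a₁)) (r : El (b₀ ≐ b₁)) (p' : El (a₀' ≐ a₁')) (r' : El (b₀' ≐ b₁'))
    (t : El (g a₀ ≐ h a₀')) (t' : El (g' b₀ ≐ h' b₀')) (q : El (g a₁ ≐ g' b₁)) (q' : El (h a₁' ≐ h' b₁')) :
    El (sideSq g g' h h' p r p' r' t t' q q' ⟹ flippedSq g g' h h' p r p' r' t t' q q') :=
  appSquare g g' h h' p r p' r' t t' q q' (glob 92 flipDef)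

abbrev flipEquivTy : Ty := piSquare fun X _ _ _ _ g g' h h' _ _ _ _ _ _ _ _ p r p' r' t t' q q' =>
  isEquiv (flip (X := X) g g' h h' p r p' r' t t' q q')

/-- For constant homotopies `flip` computes to `flipSq`. -/
def flipEquivProof : El flipEquivTy :=
  lamSquare fun X _ _ _ _ g g' h h' a₀ b₀ a₀' b₀' t t' q q' =>
    (glob 91 flipSqEquivProof X (g a₀) (h a₀').coerce (g' b₀) (h' b₀') t.coerce q.coerce q'.coerce t'.coerce).coerce

def flipEquiv {X A B A' B' : Ty} (g : El (A ⟹ X)) (g' : El (B ⟹ X)) (h : El (A' ⟹ X)) (h' : El (B' ⟹ X))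
    {a₀ a₁ : El A} {b₀ b₁ : El B} {a₀' a₁' : El A'} {b₀' b₁' : El B'}
    (p : El (a₀ ≐ a₁)) (r : El (b₀ ≐ b₁)) (p' : El (a₀' ≐ a₁')) (r' : El (b₀' ≐ b₁'))
    (t : El (g a₀ ≐ h a₀')) (t' : El (g' b₀ ≐ h' b₀')) (q : El (g a₁ ≐ g' b₁)) (q' : El (h a₁' ≐ h' b₁')) :
    El (isEquiv (flip g g' h h' p r p' r' t t' q q')) :=
  appSquare g g' h h' p r p' r' t t' q q' (glob 93 flipEquivProof)

section

variable {X A B A' B' : Ty} {X' : Ty} (k : El (X ⟹ X')) (g : El (A ⟹ X)) (g' : El (B ⟹ X)) (h : El (A' ⟹ X)) (h' : El (B' ⟹ X))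
  {a₀ a₁ : El A} {b₀ b₁ : El B} {a₀' a₁' : El A'} {b₀' b₁' : El B'}
  (p : El (a₀ ≐ a₁)) (r : El (b₀ ≐ b₁)) (p' : El (a₀' ≐ a₁')) (r' : El (b₀' ≐ b₁'))
  (t : El (g a₀ ≐ h a₀')) (t' : El (g' b₀ ≐ h' b₀')) (q : El (g a₁ ≐ g' b₁)) (q' : El (h a₁' ≐ h' b₁'))

abbrev flipNatEq (s : El (sideSq g g' h h' p r p' r' t t' q q')) : Ty :=
  let gk : El (A ⟹ X') := lam fun y => k (g y)
  let gk' : El (B ⟹ X') := lam fun y => k (g' y)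
  let hk : El (A' ⟹ X') := lam fun y => k (h y)
  let hk' : El (B' ⟹ X') := lam fun y => k (h' y)
  let tk : El (gk a₀ ≐ hk a₀') := (ap k t).coerce
  let tk' : El (gk' b₀ ≐ hk' b₀') := (ap k t').coerce
  let qk : El (gk a₁ ≐ gk' b₁) := (ap k q).coerce
  let qk' : El (hk a₁' ≐ hk' b₁') := (ap k q').coerce
  let s₁ : El (sideSq gk gk' hk hk' p r p' r' tk tk' qk qk') :=
    (sqCast (apSide g g' k p q r) (apSide h h' k p' q' r') (apSq k s)).coerce
  let s₂ : El (flippedSq gk gk' hk hk' p r p' r' tk tk' qk qk') :=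
    (sqCast (apSide g h k (inv p) t (inv p')) (apSide g' h' k (inv r) t' (inv r'))
      (apSq k (flip g g' h h' p r p' r' t t' q q' s))).coerce
  flip gk gk' hk hk' p r p' r' tk tk' qk qk' s₁ ≐ s₂

end

abbrev flipNatTy : Ty := pi U fun X' => piSquare fun X _ _ _ _ g g' h h' _ _ _ _ _ _ _ _ p r p' r' t t' q q' =>
  pi (X ⟹ X') fun k => pi (sideSq g g' h h' p r p' r' t t' q q') fun s =>
    flipNatEq k g g' h h' p r p' r' t t' q q' s

def flipNatProof : El flipNatTy :=
  lam fun X' => lamSquare fun X A B A' B' g g' h h' a₀ b₀ a₀' b₀' t t' q q' => lam fun k =>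
    let w := g a₀
    -- Replacing `g'`, `h` and `h'` by constant functions frees three corners of the square, so that
    -- induction is possible on `q`, `q'`, the square and finally `t`. With constant homotopies
    -- nothing is lost up to conversion.
    let Q {x y z : El X} (t : El (w ≐ x)) (t' : El (y ≐ z)) (q : El (w ≐ y)) (q' : El (x ≐ z))
        (s : El (Sq (El.refl w ⊙ q) (El.refl x ⊙ q') t t')) : Ty :=
      flipNatEq (X := X) k g (lam fun _ : El B => y) (lam fun _ : El A' => x) (lam fun _ : El B' => z)
        (El.refl a₀) (El.refl b₀) (El.refl a₀') (El.refl b₀') t.coerce t'.coerce q.coerce q'.coerce s.coerce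
    let z := h' b₀'
    let x := h a₀'
    let q : El (w ≐ g' b₀) := q.coerce
    let q' : El (x ≐ z) := q'.coerce
    let t : El (w ≐ x) := t.coerce
    let R : El (pi (g' b₀ ≐ z) fun t' => pi (Sq (El.refl w ⊙ q) (El.refl x ⊙ q') t t') fun s => Q t t' q q' s) :=
      El.ann <| J (fun y q => pi (y ≐ z) fun t' => pi (Sq (El.refl w ⊙ q) (El.refl x ⊙ q') t t') fun s => Q t t' q q' s)
        (coerce <| J (fun z q' => pi (w ≐ z) fun t' => pi (Sq (El.refl w) (El.refl x ⊙ q') t t') fun s =>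
            Q t t' (El.refl w) q' s.coerce)
          (coerce <| lam fun t' : El (w ≐ x) => lam fun s : El (t ≐ t') =>
            J (fun t' s => Q t t' (El.refl w) (El.refl x) s.coerce)
              (coerce <| J (fun x t => Q t t (El.refl w) (El.refl x) (El.refl t).coerce) rfl' t) s) q') q
    (R t').coerce

end El

/-- Naturality of the transposition of squares. -/
def El.flipNat {X A B A' B' X' : Ty} (k : El (X ⟹ X')) (g : El (A ⟹ X)) (g' : El (B ⟹ X)) (h : El (A' ⟹ X)) (h' : El (B' ⟹ X))
    {a₀ a₁ : El A} {b₀ b₁ : El B} {a₀' a₁' : El A'} {b₀' b₁' : El B'}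
    (p : El (a₀ ≐ a₁)) (r : El (b₀ ≐ b₁)) (p' : El (a₀' ≐ a₁')) (r' : El (b₀' ≐ b₁'))
    (t : El (g a₀ ≐ h a₀')) (t' : El (g' b₀ ≐ h' b₀')) (q : El (g a₁ ≐ g' b₁)) (q' : El (h a₁' ≐ h' b₁'))
    (s : El (sideSq g g' h h' p r p' r' t t' q q')) : El (flipNatEq k g g' h h' p r p' r' t t' q q' s) :=
  let n : El (pi (X ⟹ X') fun k => pi (sideSq g g' h h' p r p' r' t t' q q') fun s =>
      flipNatEq k g g' h h' p r p' r' t t' q q' s) :=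
    appSquare g g' h h' p r p' r' t t' q q' (k := fun X _ _ _ _ g g' h h' _ _ _ _ _ _ _ _ p r p' r' t t' q q' =>
      pi (X ⟹ X') fun k => pi (sideSq g g' h h' p r p' r' t t' q q') fun s =>
        flipNatEq k g g' h h' p r p' r' t t' q q' s) (glob 94 flipNatProof X'.code)
  n k s

/-! ### Transposition of diagrams and of the data under them. -/

namespace Diagram

/-- The diagram with rows and columns exchanged. -/
def transpose (D : Diagram) : Diagram where
  S₀ := ⟨D.S₀.A, D.S₄.A, D.S₂.A, D.a, D.a'⟩
  S₂ := ⟨D.S₀.C, D.S₄.C, D.S₂.C, D.c, D.c'⟩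
  S₄ := ⟨D.S₀.B, D.S₄.B, D.S₂.B, D.b, D.b'⟩
  a := D.S₀.f
  a' := D.S₀.g
  b := D.S₄.f
  b' := D.S₄.g
  c := D.S₂.f
  c' := D.S₂.g
  p := coerce <| lam fun x => inv (D.p x)
  p' := coerce <| lam fun x => inv (D.r x)
  r := coerce <| lam fun x => inv (D.p' x)
  r' := coerce <| lam fun x => inv (D.r' x)

section

variable (D : Diagram) {X : Ty} (g : El (D.S₀.A ⟹ X)) (g' : El (D.S₀.B ⟹ X)) (h : El (D.S₄.A ⟹ X)) (h' : El (D.S₄.B ⟹ X))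
  (t : El (pi D.S₂.A fun x => g (D.a x) ≐ h (D.a' x))) (t' : El (pi D.S₂.B fun x => g' (D.b x) ≐ h' (D.b' x)))
  (Q : El (pi D.S₀.C fun x => g (D.S₀.f x) ≐ g' (D.S₀.g x))) (Q' : El (pi D.S₄.C fun x => h (D.S₄.f x) ≐ h' (D.S₄.g x)))

/-- The type of the squares of data with given points and paths. -/
abbrev squareTy (x : El D.S₂.C) : Ty :=
  sideSq g g' h h' (D.p x) (D.r x) (D.p' x) (D.r' x) (t (D.S₂.f x)).coerce (t' (D.S₂.g x)).coerce (Q (D.c x)).coerce (Q' (D.c' x)).coerce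

abbrev flippedTy (x : El D.S₂.C) : Ty :=
  flippedSq g g' h h' (D.p x) (D.r x) (D.p' x) (D.r' x) (t (D.S₂.f x)).coerce (t' (D.S₂.g x)).coerce (Q (D.c x)).coerce (Q' (D.c' x)).coerce

/-- The transposition of one of the squares. -/
def flipAt (x : El D.S₂.C) : El (D.squareTy g g' h h' t t' Q Q' x ⟹ D.flippedTy g g' h h' t t' Q Q' x) :=
  flip g g' h h' (D.p x) (D.r x) (D.p' x) (D.r' x) (t (D.S₂.f x)).coerce (t' (D.S₂.g x)).coerce (Q (D.c x)).coerce (Q' (D.c' x)).coerce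

def flipAtEquiv (x : El D.S₂.C) : El (isEquiv (D.flipAt g g' h h' t t' Q Q' x)) :=
  (flipEquiv g g' h h' (D.p x) (D.r x) (D.p' x) (D.r' x) (t (D.S₂.f x)).coerce (t' (D.S₂.g x)).coerce (Q (D.c x)).coerce
    (Q' (D.c' x)).coerce).coerce

end

abbrev dataIndTy (D : Diagram) : Ty := pi U fun X => pi (D.dataTy X ⟹ U) fun P =>
  (pi (D.S₀.A ⟹ X) fun g => pi (D.S₀.B ⟹ X) fun g' => pi (D.S₄.A ⟹ X) fun h =>
  pi (D.S₄.B ⟹ X) fun h' => pi (pi D.S₂.A fun x => g (D.a x) ≐ h (D.a' x)) fun t =>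
  pi (pi D.S₂.B fun x => g' (D.b x) ≐ h' (D.b' x)) fun t' =>
  pi (pi D.S₀.C fun x => g (D.S₀.f x) ≐ g' (D.S₀.g x)) fun Q =>
  pi (pi D.S₄.C fun x => h (D.S₄.f x) ≐ h' (D.S₄.g x)) fun Q' =>
  pi (pi D.S₂.C fun x => D.squareTy g g' h h' t t' Q Q' x) fun σ =>
    P (D.dataMk g g' h h' t t' Q Q' σ.coerce)) ⟹ pi (D.dataTy X) fun z => P z

/-- Pair types have no η-rule, so the components are opened one at a time. Later components depend
on earlier ones, and are therefore abstracted before the induction on a cocone and supplied again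
afterwards. -/
def dataIndProof : El (piAll dataIndTy) :=
  lamAll dataIndTy fun D => lam fun X => lam fun P => lam fun d => lam fun z =>
    split (fun z => P z) (fun z₀ w => coerce <| split (fun w => P (pair z₀ w)) (fun z₄ s =>
      app (A := D.squaresTy z₀ z₄) (B := fun s => P (pair z₀ (pair z₄ s))) (ann <| app (A := evalTy D.S₄ X) (B := fun z₄ => pi (D.squaresTy z₀ z₄) fun s => P (pair z₀ (pair z₄ s)))
      (ann <| app (A := evalTy D.S₀ X) (B := fun z₀ => pi (evalTy D.S₄ X) fun z₄ => pi (D.squaresTy z₀ z₄) fun s => P (pair z₀ (pair z₄ s)))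
      (ann <| lam fun z₀ => coconeInd (fun z₀ => pi (evalTy D.S₄ X) fun z₄ => pi (D.squaresTy z₀ z₄) fun s => P (pair z₀ (pair z₄ s)))
        (fun g g' Q => lam fun z₄ => coconeInd (fun z₄ => pi (D.squaresTy (coconeMk g g' Q) z₄) fun s =>
            P (pair (coconeMk g g' Q) (pair z₄ s)))
          (fun h h' Q' => coerce <| lam fun s : El (D.squaresCocone g g' Q h h' Q') =>
            coconeInd (fun s => P (pair (coconeMk g g' Q) (pair (coconeMk h h' Q') s.coerce)))
              (fun t t' σ => (d g g' h h' t t' Q Q' σ.coerce).coerce) s) z₄) z₀) z₀) z₄) s) w) z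

variable (D : Diagram) {X : Ty}

/-- Induction on data. -/
def dataInd (P : El (D.dataTy X) → Ty) (d : (g : El (D.S₀.A ⟹ X)) → (g' : El (D.S₀.B ⟹ X)) → (h : El (D.S₄.A ⟹ X)) →
    (h' : El (D.S₄.B ⟹ X)) → (t : El (pi D.S₂.A fun x => g (D.a x) ≐ h (D.a' x))) →
    (t' : El (pi D.S₂.B fun x => g' (D.b x) ≐ h' (D.b' x))) → (Q : El (pi D.S₀.C fun x => g (D.S₀.f x) ≐ g' (D.S₀.g x))) →
    (Q' : El (pi D.S₄.C fun x => h (D.S₄.f x) ≐ h' (D.S₄.g x))) →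
    (σ : El (pi D.S₂.C fun x => D.squareTy g g' h h' t t' Q Q' x)) → El (P (D.dataMk g g' h h' t t' Q Q' σ.coerce)))
    (z : El (D.dataTy X)) : El (P z) :=
  (app (app (app (app (appAll (k := dataIndTy) (glob 95 dataIndProof) D) X.code) (coerce <| lam fun z => (P z).code))
    (coerce <| lam fun g => lam fun g' => lam fun h => lam fun h' => lam fun t => lam fun t' => lam fun Q => lam fun Q' =>
      lam fun σ => d g g' h h' t t' Q Q' σ)) z.coerce).coerce

/-- Quantification over the points and paths of data. -/
abbrev piPoints (D : Diagram) (k : (X : El U) → (g : El (D.S₀.A ⟹ X)) → (g' : El (D.S₀.B ⟹ X)) → (h : El (D.S₄.A ⟹ X)) →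
    (h' : El (D.S₄.B ⟹ X)) → (t : El (pi D.S₂.A fun x => g (D.a x) ≐ h (D.a' x))) →
    (t' : El (pi D.S₂.B fun x => g' (D.b x) ≐ h' (D.b' x))) → (Q : El (pi D.S₀.C fun x => g (D.S₀.f x) ≐ g' (D.S₀.g x))) →
    (Q' : El (pi D.S₄.C fun x => h (D.S₄.f x) ≐ h' (D.S₄.g x))) → Ty) : Ty :=
  pi U fun X => pi (D.S₀.A ⟹ X) fun g => pi (D.S₀.B ⟹ X) fun g' => pi (D.S₄.A ⟹ X) fun h =>
  pi (D.S₄.B ⟹ X) fun h' => pi (pi D.S₂.A fun x => g (D.a x) ≐ h (D.a' x)) fun t =>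
  pi (pi D.S₂.B fun x => g' (D.b x) ≐ h' (D.b' x)) fun t' =>
  pi (pi D.S₀.C fun x => g (D.S₀.f x) ≐ g' (D.S₀.g x)) fun Q =>
  pi (pi D.S₄.C fun x => h (D.S₄.f x) ≐ h' (D.S₄.g x)) fun Q' => k X g g' h h' t t' Q Q'

abbrev transposeMkTy (D : Diagram) : Ty := D.piPoints fun X g g' h h' t t' Q Q' =>
  (pi D.S₂.C fun x => D.squareTy g g' h h' t t' Q Q' x) ⟹ D.transpose.dataTy X

def transposeMkDef : El (piAll transposeMkTy) := lamAll transposeMkTy fun D =>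
  lam fun X => lam fun g => lam fun g' => lam fun h => lam fun h' => lam fun t => lam fun t' => lam fun Q => lam fun Q' =>
  lam fun σ => D.transpose.dataMk g h g' h' Q.coerce Q'.coerce t.coerce t'.coerce
    (coerce <| lam fun x => D.flipAt g g' h h' t t' Q Q' x (σ x))

abbrev untransposeMkTy (D : Diagram) : Ty := D.piPoints fun X g g' h h' t t' Q Q' =>
  (pi D.S₂.C fun x => D.flippedTy g g' h h' t t' Q Q' x) ⟹ D.dataTy X

/-- Transposing a second time would not lead back, since it produces double inverses of the
homotopies and so data under a different diagram. The inverses of `flip` are used instead, in two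
versions because left and right inverses are separate. -/
def linvMkDef : El (piAll untransposeMkTy) := lamAll untransposeMkTy fun D =>
  lam fun X => lam fun g => lam fun g' => lam fun h => lam fun h' => lam fun t => lam fun t' => lam fun Q => lam fun Q' =>
  lam fun σ => D.dataMk g g' h h' t t' Q Q'
    (coerce <| lam fun x => linv (D.flipAtEquiv g g' h h' t t' Q Q' x) (σ x))

def rinvMkDef : El (piAll untransposeMkTy) := lamAll untransposeMkTy fun D =>
  lam fun X => lam fun g => lam fun g' => lam fun h => lam fun h' => lam fun t => lam fun t' => lam fun Q => lam fun Q' =>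
  lam fun σ => D.dataMk g g' h h' t t' Q Q'
    (coerce <| lam fun x => rinv (D.flipAtEquiv g g' h h' t t' Q Q' x) (σ x))

abbrev transposeDataTy (D : Diagram) : Ty := pi U fun X => D.dataTy X ⟹ D.transpose.dataTy X

def transposeDataDef : El (piAll transposeDataTy) :=
  lamAll transposeDataTy fun D => lam fun X => lam fun z => withTriple z fun u v f =>
    let f : El (D.squaresCocone (coconeL u) (coconeR u) (coconeP u).coerce (coconeL v) (coconeR v) (coconeP v).coerce) := f.coerce
    (appAll (k := transposeMkTy) (glob 96 transposeMkDef) D X (coconeL u) (coconeR u) (coconeL v) (coconeR v)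
      (coconeL f).coerce (coconeR f).coerce (coconeP u).coerce (coconeP v).coerce (coconeP f).coerce)

def transposeData (z : El (D.dataTy X)) : El (D.transpose.dataTy X) :=
  (appAll (k := transposeDataTy) (glob 99 transposeDataDef) D X.code z.coerce).coerce

/-- The inverse of the transposition of data given by an inverse of the transposition of squares. -/
abbrev untransposeTy (D : Diagram) : Ty := pi U fun X => D.transpose.dataTy X ⟹ D.dataTy X

def untranspose (D : Diagram) (X : El U) (mk : El (untransposeMkTy D)) (z : El (D.transpose.dataTy X)) : El (D.dataTy X) :=
  withTriple z fun u v f =>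
    let T := D.transpose
    let f : El (T.squaresCocone (coconeL u) (coconeR u) (coconeP u).coerce (coconeL v) (coconeR v) (coconeP v).coerce) := f.coerce
    mk X (coconeL u) (coconeL v) (coconeR u) (coconeR v) (coconeP u).coerce (coconeP v).coerce
      (coconeL f).coerce (coconeR f).coerce (coconeP f).coerce

def transposeLinvDef : El (piAll untransposeTy) :=
  lamAll untransposeTy fun D => lam fun X => lam fun z =>
    D.untranspose X (appAll (k := untransposeMkTy) (glob 97 linvMkDef) D) z

def transposeRinvDef : El (piAll untransposeTy) :=
  lamAll untransposeTy fun D => lam fun X => lam fun z =>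
    D.untranspose X (appAll (k := untransposeMkTy) (glob 98 rinvMkDef) D) z

def transposeLinv (z : El (D.transpose.dataTy X)) : El (D.dataTy X) :=
  (appAll (k := untransposeTy) (glob 100 transposeLinvDef) D X.code z.coerce).coerce

def transposeRinv (z : El (D.transpose.dataTy X)) : El (D.dataTy X) :=
  (appAll (k := untransposeTy) (glob 101 transposeRinvDef) D X.code z.coerce).coerce

section

variable (D : Diagram) {X : Ty} (g : El (D.S₀.A ⟹ X)) (g' : El (D.S₀.B ⟹ X)) (h : El (D.S₄.A ⟹ X)) (h' : El (D.S₄.B ⟹ X))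
  (t : El (pi D.S₂.A fun x => g (D.a x) ≐ h (D.a' x))) (t' : El (pi D.S₂.B fun x => g' (D.b x) ≐ h' (D.b' x)))
  (Q : El (pi D.S₀.C fun x => g (D.S₀.f x) ≐ g' (D.S₀.g x))) (Q' : El (pi D.S₄.C fun x => h (D.S₄.f x) ≐ h' (D.S₄.g x)))

def appPoints {k : (X : El U) → (g : El (D.S₀.A ⟹ X)) → (g' : El (D.S₀.B ⟹ X)) → (h : El (D.S₄.A ⟹ X)) →
    (h' : El (D.S₄.B ⟹ X)) → (t : El (pi D.S₂.A fun x => g (D.a x) ≐ h (D.a' x))) →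
    (t' : El (pi D.S₂.B fun x => g' (D.b x) ≐ h' (D.b' x))) → (Q : El (pi D.S₀.C fun x => g (D.S₀.f x) ≐ g' (D.S₀.g x))) →
    (Q' : El (pi D.S₄.C fun x => h (D.S₄.f x) ≐ h' (D.S₄.g x))) → Ty}
    (d : El (D.piPoints k)) {T : Ty} : El T :=
  (d X.code g.coerce g'.coerce h.coerce h'.coerce t.coerce t'.coerce Q.coerce Q'.coerce).coerce

def transposeMk (σ : El (pi D.S₂.C fun x => D.squareTy g g' h h' t t' Q Q' x)) : El (D.transpose.dataTy X) :=
  let m : El ((pi D.S₂.C fun x => D.squareTy g g' h h' t t' Q Q' x) ⟹ D.transpose.dataTy X) :=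
    D.appPoints g g' h h' t t' Q Q' (appAll (k := transposeMkTy) (glob 96 transposeMkDef) D)
  m σ

end

abbrev transposeDataMkTy (D : Diagram) : Ty := D.piPoints fun X g g' h h' t t' Q Q' =>
  pi (pi D.S₂.C fun x => D.squareTy g g' h h' t t' Q Q' x) fun σ =>
    D.transposeData (D.dataMk g g' h h' t t' Q Q' σ.coerce) ≐ D.transposeMk (X := X) g g' h h' t t' Q Q' σ

/-- All projections compute on data given by components. Recording this as a named path avoids
repeating the conversion in later proofs. -/
def transposeDataMkProof : El (piAll transposeDataMkTy) := lamAll transposeDataMkTy fun D =>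
  lam fun X => lam fun g => lam fun g' => lam fun h => lam fun h' => lam fun t => lam fun t' => lam fun Q => lam fun Q' =>
  lam fun σ => coerce <| El.refl (D.transposeMk (X := X) g g' h h' t t' Q Q' σ)

section

variable (D : Diagram) {X : Ty} {g : El (D.S₀.A ⟹ X)} {g' : El (D.S₀.B ⟹ X)} {h : El (D.S₄.A ⟹ X)} {h' : El (D.S₄.B ⟹ X)}
  {t : El (pi D.S₂.A fun x => g (D.a x) ≐ h (D.a' x))} {t' : El (pi D.S₂.B fun x => g' (D.b x) ≐ h' (D.b' x))}
  {Q : El (pi D.S₀.C fun x => g (D.S₀.f x) ≐ g' (D.S₀.g x))} {Q' : El (pi D.S₄.C fun x => h (D.S₄.f x) ≐ h' (D.S₄.g x))}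

def transposeDataMk (σ : El (pi D.S₂.C fun x => D.squareTy g g' h h' t t' Q Q' x)) :
    El (D.transposeData (D.dataMk g g' h h' t t' Q Q' σ.coerce) ≐ D.transposeMk g g' h h' t t' Q Q' σ) :=
  let m : El (pi (pi D.S₂.C fun x => D.squareTy g g' h h' t t' Q Q' x) fun σ =>
      D.transposeData (D.dataMk g g' h h' t t' Q Q' σ.coerce) ≐ D.transposeMk g g' h h' t t' Q Q' σ) :=
    D.appPoints g g' h h' t t' Q Q' (appAll (k := transposeDataMkTy) (glob 102 transposeDataMkProof) D)
  m σ

end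

abbrev transposeLinvMkTy (D : Diagram) : Ty := D.piPoints fun X g g' h h' t t' Q Q' =>
  pi (pi D.S₂.C fun x => D.squareTy g g' h h' t t' Q Q' x) fun σ =>
    D.transposeLinv (D.transposeMk (X := X) g g' h h' t t' Q Q' σ) ≐ D.dataMk g g' h h' t t' Q Q' σ.coerce

/-- Points and paths are only rearranged and return unchanged; the squares return by the left
inverse of `flip` together with function extensionality. -/
def transposeLinvMkProof : El (piAll transposeLinvMkTy) := lamAll transposeLinvMkTy fun D =>
  lam fun X => lam fun g => lam fun g' => lam fun h => lam fun h' => lam fun t => lam fun t' => lam fun Q => lam fun Q' => lam fun σ =>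
  let S (x : El D.S₂.C) := D.squareTy g g' h h' t t' Q Q' x
  let mk : El ((pi D.S₂.C fun x => D.flippedTy g g' h h' t t' Q Q' x) ⟹ D.dataTy X) :=
    D.appPoints (X := X) g g' h h' t t' Q Q' (appAll (k := untransposeMkTy) (glob 97 linvMkDef) D)
  (El.trans (A := D.dataTy X) (a := D.transposeLinv (D.transposeMk (X := X) g g' h h' t t' Q Q' σ))
      (b := mk (lam fun x => D.flipAt g g' h h' t t' Q Q' x (σ x))) rfl' <|
    coerce <| apf (fun σ : El (pi D.S₂.C S) => D.dataMk g g' h h' t t' Q Q' σ.coerce)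
      (funExt (B := S) (f := lam fun x => linv (D.flipAtEquiv g g' h h' t t' Q Q' x) (D.flipAt g g' h h' t t' Q Q' x (σ x)))
        (g := σ) (lam fun x => (linv_apply (D.flipAtEquiv g g' h h' t t' Q Q' x) (σ x)).coerce)))

abbrev transposeLinvTransposeTy (D : Diagram) : Ty := pi U fun X => pi (D.dataTy X) fun z =>
  D.transposeLinv (D.transposeData z) ≐ z

def transposeLinvTransposeProof : El (piAll transposeLinvTransposeTy) :=
  lamAll transposeLinvTransposeTy fun D => lam fun X => lam fun z =>
    D.dataInd (fun z => D.transposeLinv (D.transposeData z) ≐ z) (fun g g' h h' t t' Q Q' σ =>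
      El.trans (apf (fun z => D.transposeLinv z) (D.transposeDataMk σ)) (app (A := pi D.S₂.C fun x => D.squareTy g g' h h' t t' Q Q' x)
        (B := fun σ => D.transposeLinv (D.transposeMk (X := X) g g' h h' t t' Q Q' σ) ≐ D.dataMk g g' h h' t t' Q Q' σ.coerce)
        (D.appPoints (X := X) g g' h h' t t' Q Q' (appAll (k := transposeLinvMkTy) (glob 103 transposeLinvMkProof) D)) σ)) z

abbrev transposeRinvMkTy (D : Diagram) : Ty := D.piPoints fun X g g' h h' t t' Q Q' =>
  pi (pi D.S₂.C fun x => D.flippedTy g g' h h' t t' Q Q' x) fun σ =>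
    D.transposeData (D.transposeRinv (D.transpose.dataMk g h g' h' Q.coerce Q'.coerce t.coerce t'.coerce σ.coerce)) ≐
      D.transpose.dataMk (X := X) g h g' h' Q.coerce Q'.coerce t.coerce t'.coerce σ.coerce

def transposeRinvMkProof : El (piAll transposeRinvMkTy) := lamAll transposeRinvMkTy fun D =>
  lam fun X => lam fun g => lam fun g' => lam fun h => lam fun h' => lam fun t => lam fun t' => lam fun Q => lam fun Q' => lam fun σ =>
  let S (x : El D.S₂.C) := D.flippedTy g g' h h' t t' Q Q' x
  let z : El (D.transpose.dataTy X) := D.transpose.dataMk g h g' h' Q.coerce Q'.coerce t.coerce t'.coerce σ.coerce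
  let mk : El ((pi D.S₂.C fun x => D.flippedTy g g' h h' t t' Q Q' x) ⟹ D.dataTy X) :=
    D.appPoints (X := X) g g' h h' t t' Q Q' (appAll (k := untransposeMkTy) (glob 98 rinvMkDef) D)
  let σ' : El (pi D.S₂.C fun x => D.squareTy g g' h h' t t' Q Q' x) :=
    coerce <| lam fun x => rinv (D.flipAtEquiv g g' h h' t t' Q Q' x) (σ x)
  El.trans (apf (fun z => D.transposeData z) (rfl' : El (D.transposeRinv z ≐ mk σ))) <|
    El.trans (a := D.transposeData (mk σ)) (b := D.transposeMk (X := X) g g' h h' t t' Q Q' σ') (D.transposeDataMk σ').coerce <| coerce <|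
    apf (fun σ : El (pi D.S₂.C S) => D.transpose.dataMk g h g' h' Q.coerce Q'.coerce t.coerce t'.coerce σ.coerce)
        (funExt (B := S) (f := lam fun x => D.flipAt g g' h h' t t' Q Q' x (rinv (D.flipAtEquiv g g' h h' t t' Q Q' x) (σ x)))
          (g := σ) (lam fun x => (apply_rinv (D.flipAtEquiv g g' h h' t t' Q Q' x) (σ x)).coerce))

abbrev transposeTransposeRinvTy (D : Diagram) : Ty := pi U fun X => pi (D.transpose.dataTy X) fun z =>
  D.transposeData (D.transposeRinv z) ≐ z

def transposeTransposeRinvProof : El (piAll transposeTransposeRinvTy) :=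
  lamAll transposeTransposeRinvTy fun D => lam fun X => lam fun z =>
    D.transpose.dataInd (fun z => D.transposeData (D.transposeRinv z) ≐ z) (fun g h g' h' Q Q' t t' σ =>
      let t : El (pi D.S₂.A fun x => g (D.a x) ≐ h (D.a' x)) := t.coerce
      let t' : El (pi D.S₂.B fun x => g' (D.b x) ≐ h' (D.b' x)) := t'.coerce
      let Q : El (pi D.S₀.C fun x => g (D.S₀.f x) ≐ g' (D.S₀.g x)) := Q.coerce
      let Q' : El (pi D.S₄.C fun x => h (D.S₄.f x) ≐ h' (D.S₄.g x)) := Q'.coerce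
      coerce <| app (A := pi D.S₂.C fun x => D.flippedTy g g' h h' t t' Q Q' x) (B := fun _ => U)
        (D.appPoints (X := X) g g' h h' t t' Q Q' (appAll (k := transposeRinvMkTy) (glob 105 transposeRinvMkProof) D))
        σ.coerce) z

abbrev transposeDataEquivTy (D : Diagram) : Ty := pi U fun X =>
  isEquiv (A := D.dataTy X) (B := D.transpose.dataTy X) (appAll (k := transposeDataTy) (glob 99 transposeDataDef) D X).coerce

def transposeDataEquivProof : El (piAll transposeDataEquivTy) :=
  lamAll transposeDataEquivTy fun D => lam fun X => coerce <|
    mkEquiv₂ (A := D.dataTy X) (B := D.transpose.dataTy X) (f := (appAll (k := transposeDataTy) (glob 99 transposeDataDef) D X).coerce)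
      (lam fun z => D.transposeLinv z)
      (coerce <| appAll (k := transposeLinvTransposeTy) (glob 104 transposeLinvTransposeProof) D X)
      (lam fun z => D.transposeRinv z)
      (coerce <| appAll (k := transposeTransposeRinvTy) (glob 106 transposeTransposeRinvProof) D X)

/-- The action of a function on the squares of data. -/
abbrev mapDataMkTy (D : Diagram) : Ty := pi U fun X' => D.piPoints fun X g g' h h' t t' Q Q' => pi (X ⟹ X') fun k =>
  pi (pi D.S₂.C fun x => D.squareTy g g' h h' t t' Q Q' x) fun σ =>
    D.mapData k (D.dataMk g g' h h' t t' Q Q' σ.coerce) ≐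
      D.dataMk (X := X') (lam fun y => k (g y)) (lam fun y => k (g' y)) (lam fun y => k (h y)) (lam fun y => k (h' y))
        (coerce <| lam fun x => ap k (t x)) (coerce <| lam fun x => ap k (t' x)) (coerce <| lam fun x => ap k (Q x))
        (coerce <| lam fun x => ap k (Q' x)) (coerce <| lam fun x =>
          sqCast (apSide g g' k (D.p x) (Q (D.c x)).coerce (D.r x)) (apSide h h' k (D.p' x) (Q' (D.c' x)).coerce (D.r' x))
            (apSq k (σ x)))

def mapDataMkProof : El (piAll mapDataMkTy) := lamAll mapDataMkTy fun D => lam fun X' =>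
  lam fun X => lam fun g => lam fun g' => lam fun h => lam fun h' => lam fun t => lam fun t' => lam fun Q => lam fun Q' => lam fun k => lam fun σ => rfl'

section

variable (D : Diagram) {X X' : Ty} (k : El (X ⟹ X')) (g : El (D.S₀.A ⟹ X)) (g' : El (D.S₀.B ⟹ X)) (h : El (D.S₄.A ⟹ X)) (h' : El (D.S₄.B ⟹ X))
  (t : El (pi D.S₂.A fun x => g (D.a x) ≐ h (D.a' x))) (t' : El (pi D.S₂.B fun x => g' (D.b x) ≐ h' (D.b' x)))
  (Q : El (pi D.S₀.C fun x => g (D.S₀.f x) ≐ g' (D.S₀.g x))) (Q' : El (pi D.S₄.C fun x => h (D.S₄.f x) ≐ h' (D.S₄.g x)))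

def mapDataMk (σ : El (pi D.S₂.C fun x => D.squareTy g g' h h' t t' Q Q' x)) {a b : El (D.dataTy X')} : El (a ≐ b) :=
  let m : El (pi (X ⟹ X') fun _ => pi (pi D.S₂.C fun x => D.squareTy g g' h h' t t' Q Q' x) fun _ => a ≐ b) :=
    D.appPoints g g' h h' t t' Q Q'
      (appAll (k := mapDataMkTy) (glob 108 mapDataMkProof) D X'.code)
  m k σ

end

abbrev transposeNatTy (D : Diagram) : Ty := pi U fun X => pi U fun X' => pi (X ⟹ X') fun k => pi (D.dataTy X) fun z =>
  D.transposeData (D.mapData k z) ≐ D.transpose.mapData k (D.transposeData z)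

abbrev transposeNatMkTy (D : Diagram) : Ty := pi U fun X' => D.piPoints fun X g g' h h' t t' Q Q' => pi (X ⟹ X') fun k =>
  pi (pi D.S₂.C fun x => D.squareTy g g' h h' t t' Q Q' x) fun σ =>
    D.transposeData (D.mapData k (D.dataMk g g' h h' t t' Q Q' σ.coerce)) ≐
      D.transpose.mapData k (D.transposeData (D.dataMk g g' h h' t t' Q Q' σ.coerce))

/-- Both sides are first computed on components. Points and paths then agree, and the squares agree
by `flipNat` at each `x`, assembled by function extensionality. -/
def transposeNatMkProof : El (piAll transposeNatMkTy) := lamAll transposeNatMkTy fun D => lam fun X' =>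
  lam fun X => lam fun g => lam fun g' => lam fun h => lam fun h' => lam fun t => lam fun t' => lam fun Q => lam fun Q' => lam fun k => lam fun σ =>
      let gk : El (D.S₀.A ⟹ X') := lam fun y => k (g y)
      let gk' : El (D.S₀.B ⟹ X') := lam fun y => k (g' y)
      let hk : El (D.S₄.A ⟹ X') := lam fun y => k (h y)
      let hk' : El (D.S₄.B ⟹ X') := lam fun y => k (h' y)
      let tk : El (pi D.S₂.A fun x => gk (D.a x) ≐ hk (D.a' x)) := coerce <| lam fun x => ap k (t x)
      let tk' : El (pi D.S₂.B fun x => gk' (D.b x) ≐ hk' (D.b' x)) := coerce <| lam fun x => ap k (t' x)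
      let Qk : El (pi D.S₀.C fun x => gk (D.S₀.f x) ≐ gk' (D.S₀.g x)) := coerce <| lam fun x => ap k (Q x)
      let Qk' : El (pi D.S₄.C fun x => hk (D.S₄.f x) ≐ hk' (D.S₄.g x)) := coerce <| lam fun x => ap k (Q' x)
      let S (x : El D.S₂.C) := D.flippedTy gk gk' hk hk' tk tk' Qk Qk' x
      let s₁ : El (pi D.S₂.C fun x => D.squareTy gk gk' hk hk' tk tk' Qk Qk' x) := lam fun x =>
        (sqCast (apSide g g' k (D.p x) (Q (D.c x)).coerce (D.r x)) (apSide h h' k (D.p' x) (Q' (D.c' x)).coerce (D.r' x))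
          (apSq k (σ x))).coerce
      let s₂ (x : El D.S₂.C) : El (S x) :=
        (sqCast (apSide g h k (inv (D.p x)) (t (D.S₂.f x)).coerce (inv (D.p' x)))
          (apSide g' h' k (inv (D.r x)) (t' (D.S₂.g x)).coerce (inv (D.r' x)))
          (apSq k (D.flipAt g g' h h' t t' Q Q' x (σ x)))).coerce
      let z := D.dataMk g g' h h' t t' Q Q' σ.coerce
      let zk := D.dataMk gk gk' hk hk' tk tk' Qk Qk' s₁.coerce
      let w := D.transposeMk (X := X) g g' h h' t t' Q Q' σ
      let mk (σ : El (pi D.S₂.C S)) : El (D.transpose.dataTy X') :=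
        D.transpose.dataMk gk hk gk' hk' Qk.coerce Qk'.coerce tk.coerce tk'.coerce σ.coerce
      El.trans (apf (fun z => D.transposeData z) (D.mapDataMk (X := X) k g g' h h' t t' Q Q' σ : El (D.mapData k z ≐ zk))) <|
      El.trans (D.transposeDataMk s₁) <|
      El.trans (b := mk (lam s₂)) (coerce <| apf mk (funExt (B := S) (f := lam fun x => D.flipAt gk gk' hk hk' tk tk' Qk Qk' x (s₁ x)) (g := lam fun x => s₂ x)
          (lam fun x => coerce <| flipNat (X := X) k g g' h h' (D.p x) (D.r x) (D.p' x) (D.r' x) (t (D.S₂.f x)).coerce (t' (D.S₂.g x)).coerce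
            (Q (D.c x)).coerce (Q' (D.c' x)).coerce (σ x)))) <|
      El.trans (inv (D.transpose.mapDataMk (X := X) k g h g' h' Q.coerce Q'.coerce t.coerce t'.coerce
        (coerce <| lam fun x => D.flipAt g g' h h' t t' Q Q' x (σ x)) : El (D.transpose.mapData k w ≐ mk (lam s₂)))) <|
      apf (fun z => D.transpose.mapData k z) (inv (D.transposeDataMk σ))

def transposeNatProof : El (piAll transposeNatTy) :=
  lamAll transposeNatTy fun D => lam fun X => lam fun X' => lam fun k => lam fun z =>
    D.dataInd (fun z => D.transposeData (D.mapData k z) ≐ D.transpose.mapData k (D.transposeData z)) (fun g g' h h' t t' Q Q' σ =>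
      coerce <| app (A := pi D.S₂.C fun x => D.squareTy g g' h h' t t' Q Q' x) (B := fun _ => U)
        (app (A := X ⟹ X') (B := fun _ => (pi D.S₂.C fun x => D.squareTy g g' h h' t t' Q Q' x) ⟹ U)
        (D.appPoints (X := X) g g' h h' t t' Q Q' (appAll (k := transposeNatMkTy) (glob 109 transposeNatMkProof) D X')) k) σ) z

abbrev totalEquivTy (D : Diagram) : Ty := equiv D.total D.transpose.total

/-- Both total pushouts represent the data under the transposed diagram: one by its own
decomposition, the other by transporting its representation along the transposition. -/
def totalEquivProof : El (piAll totalEquivTy) :=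
  lamAll totalEquivTy fun D =>
    let T := D.transpose
    (glob 74 yonedaProof D.total.code T.total.code T.data T.dataMap
      (coerce <| glob 75 repTransportProof D.total.code D.data D.dataMap T.data T.dataMap
        (coerce <| appAll (k := transposeDataTy) (glob 99 transposeDataDef) D)
        (coerce <| appAll (k := transposeDataEquivTy) (glob 107 transposeDataEquivProof) D)
        (coerce <| appAll (k := transposeNatTy) (glob 110 transposeNatProof) D)
        (appAll (k := dataRep) (glob 85 dataRepProof) D))
      (coerce <| appAll (k := dataRep) (glob 85 dataRepProof) T)).coerce

end Diagram

/-- With the columns taken as the three spans, `total` of the diagram and of its transpose unfold to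
the two pushouts of the statement; the inverted homotopies of the transpose are those in the
definition of `f_{1•}` and `f_{3•}`. -/
def threeByThreeProof : El (⟨Src.threeByThree⟩ : Ty) := coerce <|
  lam fun A00 : El U => lam fun A02 : El U => lam fun A04 : El U => lam fun A20 : El U => lam fun A22 : El U =>
  lam fun A24 : El U => lam fun A40 : El U => lam fun A42 : El U => lam fun A44 : El U =>
  lam fun f01 : El (A02 ⟹ A00) => lam fun f03 : El (A02 ⟹ A04) => lam fun f10 : El (A20 ⟹ A00) =>
  lam fun f12 : El (A22 ⟹ A02) => lam fun f14 : El (A24 ⟹ A04) => lam fun f21 : El (A22 ⟹ A20) =>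
  lam fun f23 : El (A22 ⟹ A24) => lam fun f30 : El (A20 ⟹ A40) => lam fun f32 : El (A22 ⟹ A42) =>
  lam fun f34 : El (A24 ⟹ A44) => lam fun f41 : El (A42 ⟹ A40) => lam fun f43 : El (A42 ⟹ A44) =>
  lam fun H11 : El (pi A22 fun x => f01 (f12 x) ≐ f10 (f21 x)) =>
  lam fun H13 : El (pi A22 fun x => f03 (f12 x) ≐ f14 (f23 x)) =>
  lam fun H31 : El (pi A22 fun x => f41 (f32 x) ≐ f30 (f21 x)) =>
  lam fun H33 : El (pi A22 fun x => f43 (f32 x) ≐ f34 (f23 x)) =>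
    Diagram.appAll (k := Diagram.totalEquivTy) (glob 111 Diagram.totalEquivProof)
      ⟨⟨A00, A40, A20, f10, f30⟩, ⟨A02, A42, A22, f12, f32⟩, ⟨A04, A44, A24, f14, f34⟩,
        f01, f03, f41, f43, f21, f23, H11, H13, H31, H33⟩

end HoTT

namespace HoTT

/-! ### The library of named terms -/

/-- A closed term with its type. -/
structure Entry where
  /-- The type. -/
  type : Raw
  /-- The term. -/
  term : Raw
  /-- Whether the name of the term may be unfolded. -/
  unfoldable : Bool

namespace Entry

/-- A term whose name may be unfolded. -/
noncomputable def unfolding {A : Ty} (a : El A) : Entry := ⟨A.val 0, a.val 0, true⟩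

/-- A term whose name is not unfolded. -/
noncomputable def sealed {A : Ty} (a : El A) : Entry := ⟨A.val 0, a.val 0, false⟩

/-- The name for the term. -/
noncomputable def toGlobal (e : Entry) : Code × Option Code :=
  (e.type.erase, bif e.unfoldable then some e.term.erase else none)

end Entry

open Raw

/-- The named terms, in the order of their numbers. -/
noncomputable def entries : List Entry :=
  [.unfolding El.fstDef, .unfolding El.sndDef, .unfolding El.apfDef, .unfolding El.transDef,
   .sealed funextProof, .sealed homotopyIndProof, .unfolding Ty.isEquivDef, .unfolding El.mkEquivDef,
   .unfolding El.linvDef, .unfolding El.rinvDef, .sealed El.linvApplyProof, .sealed El.applyRinvProof,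
   .sealed equivIndProof, .unfolding withTripleDef, .unfolding sigmaMapDef, .sealed sigmaMapProof,
   .sealed equivCompProof, .unfolding lunitDef, .sealed overEqProof, .unfolding coconeDef,
   .unfolding coconeMkDef, .unfolding coconeLDef, .unfolding coconeRDef, .unfolding coconePDef,
   .sealed pushoutUniversalProof, .unfolding El.overConstDef, .unfolding El.constOverDef, .unfolding evalDef,
   .sealed evalEquivProof, .sealed recurPushProof, .unfolding El.carryDef, .sealed El.compInvCompProof,
   .sealed El.invCompCompProof, .unfolding El.transportPathDef, .unfolding El.squareOfOverDef,
   .unfolding Legs.fillerTyDef, .unfolding Legs.fillerDef, .unfolding Legs.evalDef,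
   .sealed Legs.evalEquivProof, .unfolding El.apAppDef, .unfolding El.mapSqDef,
   .sealed El.squareOfOverNatProof, .unfolding Legs.mapFillerDef, .unfolding Legs.mapCoconeDef,
   .sealed Legs.evalNatProof, .unfolding El.sideDef, .unfolding El.apSideDef, .unfolding El.sqCastDef,
   .sealed El.sqCastEquivProof, .unfolding El.apSqDef, .unfolding El.apSideCompDef, .sealed El.sideNatProof,
   .unfolding coconeMapDef, .sealed coconeMapEquivProof, .unfolding Diagram.lDef,
   .unfolding Diagram.l'Def, .unfolding Diagram.fillerTyDef, .unfolding Diagram.squaresTyOfDef,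
   .unfolding Diagram.squaresTyDef, .unfolding mapEvalDef, .unfolding Diagram.squaresDef,
   .unfolding Diagram.restrictInnerDef, .unfolding Diagram.restrictDef, .sealed Diagram.squaresEquivProof,
   .sealed Diagram.restrictInnerEquivProof, .sealed Diagram.restrictEquivProof,
   .unfolding Diagram.mapFillerDef, .unfolding Diagram.mapMapsDef, .unfolding Diagram.mapSquaresOfDef,
   .unfolding Diagram.mapSquaresDef, .unfolding Diagram.mapDataDef, .unfolding Diagram.dataMkDef,
   .sealed Diagram.dataMkEqProof, .sealed Diagram.restrictNatProof, .sealed yonedaProof,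
   .sealed repTransportProof, .sealed Legs.repTyOfProof, .unfolding Diagram.legFDef,
   .unfolding Diagram.legGDef, .sealed Diagram.legFPushProof, .sealed Diagram.legGPushProof,
   .sealed Diagram.mapFillerEqProof, .sealed Diagram.mapsIdProof, .sealed Diagram.mapsRepProof,
   .sealed Diagram.restrictNaturalProof, .sealed Diagram.dataRepProof, .sealed El.compInvEquivProof,
   .unfolding El.carryReflDef, .unfolding El.flipPathDef, .sealed El.flipPathEquivProof, .unfolding El.flipSqDef,
   .sealed El.flipSqEquivProof, .unfolding El.flipDef, .sealed El.flipEquivProof,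
   .sealed El.flipNatProof, .sealed Diagram.dataIndProof, .unfolding Diagram.transposeMkDef,
   .unfolding Diagram.linvMkDef, .unfolding Diagram.rinvMkDef, .unfolding Diagram.transposeDataDef,
   .unfolding Diagram.transposeLinvDef, .unfolding Diagram.transposeRinvDef, .sealed Diagram.transposeDataMkProof,
   .sealed Diagram.transposeLinvMkProof, .sealed Diagram.transposeLinvTransposeProof,
   .sealed Diagram.transposeRinvMkProof, .sealed Diagram.transposeTransposeRinvProof,
   .sealed Diagram.transposeDataEquivProof, .sealed Diagram.mapDataMkProof,
   .sealed Diagram.transposeNatMkProof, .sealed Diagram.transposeNatProof, .sealed Diagram.totalEquivProof,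
   .sealed threeByThreeProof]

/-- The names given to the terms. -/
noncomputable def globals : Globals := entries.map Entry.toGlobal

set_option maxRecDepth 100000 in
set_option maxHeartbeats 0 in
/-- Every entry passes the check, given the names of the entries before it. -/
lemma check_entries (n : ℕ) (e : Entry) (h : entries[n]? = some e) :
    check (globals.take n) (Const.available 5) e.term e.type = true := by
  -- There are 113 entries, and each is settled separately by evaluating the checker.
  have hn : n < 113 := (List.getElem?_eq_some_iff.1 h).1
  interval_cases n <;> (obtain rfl := Option.some.inj h; decide +kernel)

/-- The named terms are derivable. -/
theorem realizable_globals (n : ℕ) : Globals.Realizable (globals.take n) := by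
  induction n with
  | zero => exact realizable_nil
  | succ n ih =>
    cases h : entries[n]? with
    | none =>
      have : globals.length ≤ n := by simpa [globals] using h
      rwa [List.take_of_length_le (this.trans n.le_succ), ← List.take_of_length_le this]
    | some e =>
      -- A sealed entry contributes only its type, so conversion tests never unfold it.
      have := realizable_append ih (sound_available 5) (check_entries n e h)
        (v := bif e.unfoldable then some e.term.erase else none)
        (by cases e.unfoldable <;> simp [eq_comm])
      rwa [List.take_add_one, show globals[n]? = some e.toGlobal by simp [globals, h]]

/-! ### The theorem -/

lemma interp_threeByThree (E : ℕ → Tm) :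
    Code.interp E (Src.threeByThree 0).erase = Exp.threeByThree 0 0 := by
  rfl

/-- The shift is added on the left, so that `ℓ + 0` computes to `ℓ`. -/
lemma raise_threeByThree (ℓ : ℕ) : (Exp.threeByThree 0 0).raise ℓ = Exp.threeByThree ℓ 0 := by
  rfl

end HoTT

open HoTT HoTT.Raw in
/-- **The 3×3-lemma.** -/
theorem mainTheorem1 (ℓ : ℕ) : HoTT.IsTheorem (HoTT.Exp.threeByThree ℓ) := by
  -- The last entry, number 112, is the theorem itself; it is checked over the 112 names before it.
  obtain ⟨E, hE⟩ := realizable_globals 112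
  obtain ⟨ht, ⟨i, hT⟩, -⟩ := hasType_of_check hE (sound_available 5) (check_entries 112 (.sealed threeByThreeProof) rfl)
  change HasType [] _ (Code.interp E (Src.threeByThree 0).erase) at ht
  change HasType [] (Code.interp E (Src.threeByThree 0).erase) _ at hT
  rw [interp_threeByThree] at ht hT
  rw [IsTheorem, ← raise_threeByThree]
  exact ⟨⟨_, hT.raise ℓ⟩, _, ht.raise ℓ⟩
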